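/- Let $k$ be a field, $\Gamma$ a finite-dimensional $k$-algebra, and $M$ a $\Gamma$-bimodule on which $k$ acts centrally and which is finitely generated as a left and as a right $\Gamma$-module. Let $\theta\colon M\otimes_\Gamma M\to M$ be an associative homomorphism of $\Gamma$-bimodules, i.e. $\theta(\theta(a\otimes b)\otimes c)=\theta(a\otimes\theta(b\otimes c))$ for all $a,b,c\in M$, and let $\Lambda=\Gamma\ltimes_\theta M$ be the corresponding $\theta$-extension: the abelian group $\Gamma\oplus M$ with multiplication $$(\gamma,m)(\gamma',m')=(\gamma\gamma',\ \gamma m'+m\gamma'+\theta(m\otimes m')).$$ For a right Noetherian ring $A$, let $\operatorname{mod}A$ be the category of finitely generated right $A$-modules and let $\operatorname{Gproj}A\subseteq\operatorname{mod}A$ be the full subcategory of Gorenstein projective modules, i.e. of the images of $P^{-1}\to P^0$ for exact complexes $P^\bullet$ of projectives in $\operatorname{mod}A$ such that $\operatorname{Hom}(P^\bullet,Q)$ is exact for every projective $Q$ in $\operatorname{mod}A$. Its stable category $\underline{\operatorname{Gproj}}\,A$, the quotient by the morphisms that factor through a projective module, is triangulated in the usual way: the suspension of $X$ is a cosyzygy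 of $X$ in $\operatorname{Gproj}A$, and the distinguished triangles are those isomorphic to the ones coming from short exact sequences in $\operatorname{Gproj}A$. Let $D_{sg}(A)=D^b(\operatorname{mod}A)/K^b(\operatorname{proj}A)$ be the singularity category, and let $\underline{\operatorname{Gproj}}\,A\to D_{sg}(A)$ be the canonical functor that sends a module to the corresponding complex in degree $0$. Let $e\colon\operatorname{mod}\Lambda\to\operatorname{mod}\Gamma$ be the exact functor of restriction of scalars along the ring homomorphism $\Gamma\to\Lambda$, $\gamma\mapsto(\gamma,0)$. Suppose that 1. $\operatorname{Tor}_i^\Gamma(M,M^{\otimes_\Gamma j})=0$ for all $i,j\ge 1$; 2. $M$ has finite projective dimension as a module over $\Gamma^e=\Gamma\otimes_k\Gamma^{op}$; 3. $M$ is nilpotent, i.e. $M^{\otimes_\Gamma n}=0$ for some $n\ge1$. Then $e$ induces a triangle equivalence $\underline{\operatorname{Gproj}}\,\Lambda\xrightarrow{\ \simeq\ }\underline{\operatorname{Gproj}}\,\Gamma$. That is: $e$ induces a triangle functor $D_{sg}(\Lambda)\to D_{sg}(\Gamma)$, and there is a triangle functor $\underline{\operatorname{Gproj}}\,\Lambda\to\underline{\operatorname{Gproj}}\,\Gamma$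 which is an equivalence of categories and which is, up to a natural isomorphism in $D_{sg}(\Gamma)$ compatible with the suspensions, the restriction of that functor along the canonical functors $\underline{\operatorname{Gproj}}\to D_{sg}$. -/

import Mathlib

open CategoryTheory CategoryTheory.Limits MulOpposite
open scoped ZeroObject TensorProduct

universe w v u v' u'

attribute [local instance] HasDerivedCategory.standard

noncomputable section

namespace CategoryTheory

section Gorenstein

variable {C : Type u} [Category.{v} C] [Abelian C]

/-- Totally acyclic complexes of projectives: `P` is exact, consists of projective objects, and
`Hom(P, Q)` is exact for every projective `Q`. -/
structure IsTotallyAcyclic (P : CochainComplex C ℤ) : Prop where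
  projective (n : ℤ) : Projective (P.X n)
  acyclic : P.Acyclic
  hom_exact (Q : C) [Projective Q] (n : ℤ) (f : P.X n ⟶ Q) (hf : P.d (n - 1) n ≫ f = 0) :
    ∃ g : P.X (n + 1) ⟶ Q, P.d n (n + 1) ≫ g = f

lemma IsTotallyAcyclic.hom_exact' {P : CochainComplex C ℤ} (h : IsTotallyAcyclic P)
    (Q : C) [Projective Q] (i j k : ℤ) (hij : i + 1 = j) (hjk : j + 1 = k)
    (f : P.X j ⟶ Q) (hf : P.d i j ≫ f = 0) : ∃ g : P.X k ⟶ Q, P.d j k ≫ g = f := by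
  obtain rfl : i = j - 1 := by lia
  subst hjk
  exact h.hom_exact Q j f hf

lemma shift_one_d (P : CochainComplex C ℤ) (i j : ℤ) :
    ((CategoryTheory.shiftFunctor (CochainComplex C ℤ) (1 : ℤ)).obj P).d i j =
      (-P.d (i + 1) (j + 1) : P.X (i + 1) ⟶ P.X (j + 1)) := by
  simp [CochainComplex.shiftFunctor_obj_d', Int.negOnePow_one]

lemma IsTotallyAcyclic.shift {P : CochainComplex C ℤ} (h : IsTotallyAcyclic P) :
    IsTotallyAcyclic ((CategoryTheory.shiftFunctor (CochainComplex C ℤ) (1 : ℤ)).obj P) where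
  projective n := h.projective (n + 1)
  acyclic := by
    intro n
    have := h.acyclic (n + 1)
    rw [HomologicalComplex.exactAt_iff_isZero_homology] at this ⊢
    exact this.of_iso (ShortComplex.homologyMapIso
      ((CochainComplex.shiftShortComplexFunctorIso C 1 n (n + 1) (by lia)).app P))
  hom_exact Q _ n f hf := by
    rw [shift_one_d] at hf
    obtain ⟨g, hg⟩ := h.hom_exact' Q (n - 1 + 1) (n + 1) (n + 1 + 1) (by lia) rfl f
      (neg_eq_zero.1 ((Preadditive.neg_comp _ _).symm.trans hf))
    refine ⟨(-g : P.X (n + 1 + 1) ⟶ Q), ?_⟩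
    rw [shift_one_d]
    exact (Preadditive.neg_comp_neg _ _).trans hg

lemma nonempty_image_iso_of_eq_neg {A B : C} (f g : A ⟶ B) (h : g = -f) :
    Nonempty (image f ≅ image g) := by
  have := strongEpi_of_epi (factorThruImage f)
  have : Mono (-image.ι f) := by
    rw [← neg_one_smul ℤ, ← Units.val_one, ← Units.val_neg]
    infer_instance
  exact ⟨image.isoStrongEpiMono (factorThruImage f) (-image.ι f) (by simp [h])⟩

variable (C) in
/-- `X` is Gorenstein projective if it is the image of `P⁻¹ ⟶ P⁰` for a totally acyclic complex. -/
def gorensteinProjective : ObjectProperty C := fun X =>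
  ∃ P : CochainComplex C ℤ, IsTotallyAcyclic P ∧ Nonempty (X ≅ image (P.d (-1) 0))

variable (C) in
/-- The category of Gorenstein projective objects. -/
abbrev GProj := (gorensteinProjective C).FullSubcategory

variable (C) in
/-- Two morphisms of Gorenstein projectives are stably equal if their difference factors through
a projective object. -/
def stableRel : HomRel (GProj C) := fun X Y f g =>
  ∃ (Q : C) (_ : Projective Q) (a : X.obj ⟶ Q) (b : Q ⟶ Y.obj), f.hom - g.hom = a ≫ b

lemma stableRel_add ⦃X Y : GProj C⦄ (f₁ f₂ g₁ g₂ : X ⟶ Y) (hf : stableRel C f₁ f₂)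
    (hg : stableRel C g₁ g₂) : stableRel C (f₁ + g₁) (f₂ + g₂) := by
  obtain ⟨Q, _, a, b, h⟩ := hf
  obtain ⟨Q', _, a', b', h'⟩ := hg
  refine ⟨Q ⊞ Q', inferInstance, biprod.lift a a', biprod.desc b b', ?_⟩
  rw [biprod.lift_desc, ← h, ← h']
  change (f₁.hom + g₁.hom) - (f₂.hom + g₂.hom) = _
  abel

instance : Congruence (stableRel C) where
  equivalence :=
    { refl f := ⟨0, inferInstance, 0, 0, by simp⟩
      symm := by
        rintro f g ⟨Q, _, a, b, h⟩
        exact ⟨Q, ‹_›, -a, b, by rw [Preadditive.neg_comp, ← h]; abel⟩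
      trans := by
        rintro f g l h₁ h₂
        obtain ⟨Q, _, a, b, h⟩ := stableRel_add _ _ _ _ h₁ h₂
        refine ⟨Q, ‹_›, a, b, ?_⟩
        rw [← h]
        change _ = (f.hom + g.hom) - (g.hom + l.hom)
        abel }
  comp_left f g g' := by
    rintro ⟨Q, _, a, b, h⟩
    exact ⟨Q, ‹_›, f.hom ≫ a, b, by
      simp only [ObjectProperty.FullSubcategory.comp_hom, ← Preadditive.comp_sub, h,
        Category.assoc]⟩
  comp_right g := by
    rintro ⟨Q, _, a, b, h⟩
    exact ⟨Q, ‹_›, a, b ≫ g.hom, by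
      simp only [ObjectProperty.FullSubcategory.comp_hom, ← Preadditive.sub_comp, h,
        Category.assoc]⟩

variable (C) in
/-- The stable category of Gorenstein projective objects: morphisms are taken modulo those that
factor through a projective object. -/
abbrev StableGProj := Quotient (stableRel C)

instance : Preadditive (StableGProj C) := Quotient.preadditive _ stableRel_add

variable (C) in
/-- The canonical functor from Gorenstein projectives to the stable category. -/
abbrev StableGProj.proj : GProj C ⥤ StableGProj C := Quotient.functor (stableRel C)

/-- A short exact sequence `0 ⟶ X ⟶ I ⟶ S ⟶ 0` of Gorenstein projectives with `I` projective, such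
that every morphism from `X` to a projective object extends to `I`: a cosyzygy sequence of `X` in
the Frobenius category of Gorenstein projectives. -/
structure Cosyzygy (X : GProj C) where
  I : C
  S : GProj C
  ι : X.obj ⟶ I
  π : I ⟶ S.obj
  zero : ι ≫ π = 0
  shortExact : (ShortComplex.mk ι π zero).ShortExact
  projective : Projective I
  extend (Q : C) [Projective Q] (f : X.obj ⟶ Q) : ∃ g : I ⟶ Q, ι ≫ g = f

instance (X : GProj C) : Nonempty (Cosyzygy X) := by
  obtain ⟨P, hP, ⟨e⟩⟩ := X.property
  have hS : gorensteinProjective C (image (P.d 0 1)) := by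
    exact ⟨_, hP.shift, nonempty_image_iso_of_eq_neg (P.d 0 1) _ (shift_one_d P (-1) 0)⟩
  have zero : (e.hom ≫ image.ι (P.d (-1) 0)) ≫ factorThruImage (P.d 0 1) = 0 := by
    rw [← cancel_mono (image.ι (P.d 0 1)), ← cancel_epi e.inv,
      ← cancel_epi (factorThruImage (P.d (-1) 0))]
    simp
  refine ⟨⟨P.X 0, ⟨_, hS⟩, e.hom ≫ image.ι _, factorThruImage _, zero, ?_, hP.projective 0, ?_⟩⟩
  · have : Mono (e.hom ≫ image.ι (P.d (-1) 0)) := mono_comp _ _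
    have w : P.d (-1) 0 ≫ factorThruImage (P.d 0 1) = 0 := by
      rw [← cancel_mono (image.ι (P.d 0 1))]; simp
    have hex : (ShortComplex.mk (P.d (-1) 0) (P.d 0 1) (by simp)).Exact :=
      (P.exactAt_iff' (-1) 0 1 (by simp) (by simp)).1 (hP.acyclic 0)
    let φ : ShortComplex.mk (P.d (-1) 0) (factorThruImage (P.d 0 1)) w ⟶
        ShortComplex.mk (P.d (-1) 0) (P.d 0 1) (by simp) :=
      { τ₁ := 𝟙 _, τ₂ := 𝟙 _, τ₃ := image.ι _ }
    let ψ : ShortComplex.mk (P.d (-1) 0) (factorThruImage (P.d 0 1)) w ⟶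
        ShortComplex.mk (e.hom ≫ image.ι (P.d (-1) 0)) (factorThruImage (P.d 0 1)) zero :=
      { τ₁ := factorThruImage _ ≫ e.inv, τ₂ := 𝟙 _, τ₃ := 𝟙 _ }
    have h₁ := (ShortComplex.exact_iff_of_epi_of_isIso_of_mono φ).2 hex
    have : Epi ψ.τ₁ := epi_comp _ _
    exact { exact := (ShortComplex.exact_iff_of_epi_of_isIso_of_mono ψ).1 h₁
            mono_f := ‹_›
            epi_g := by dsimp; infer_instance }
  · intro Q _ f
    obtain ⟨g, hg⟩ := hP.hom_exact' Q (-2) (-1) 0 (by lia) (by lia)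
      (factorThruImage (P.d (-1) 0) ≫ e.inv ≫ f) (by
        have : P.d (-2) (-1) ≫ factorThruImage (P.d (-1) 0) = 0 := by
          rw [← cancel_mono (image.ι (P.d (-1) 0))]; simp
        rw [reassoc_of% this]; simp)
    refine ⟨g, ?_⟩
    rw [← cancel_epi e.inv, ← cancel_epi (factorThruImage (P.d (-1) 0)), ← hg]
    simp

/-- A choice of a cosyzygy sequence. -/
def GProj.cosyzygy (X : GProj C) : Cosyzygy X := Classical.choice inferInstance

lemma Cosyzygy.exists_map {X Y : GProj C} (c : Cosyzygy X) (c' : Cosyzygy Y) (f : X ⟶ Y) :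
    ∃ (g : c.I ⟶ c'.I) (s : c.S ⟶ c'.S), c.ι ≫ g = f.hom ≫ c'.ι ∧ c.π ≫ s.hom = g ≫ c'.π := by
  have := c'.projective
  obtain ⟨g, hg⟩ := c.extend c'.I (f.hom ≫ c'.ι)
  have hc := c.shortExact
  have := hc.epi_g
  refine ⟨g, ⟨hc.exact.desc (g ≫ c'.π) ?_⟩, hg, hc.exact.g_desc _ _⟩
  simp [reassoc_of% hg, c'.zero]

lemma Cosyzygy.map_unique {X Y : GProj C} (c : Cosyzygy X) (c' : Cosyzygy Y) {f f' : X ⟶ Y}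
    (hf : stableRel C f f') {g g' : c.I ⟶ c'.I} {s s' : c.S ⟶ c'.S}
    (hg : c.ι ≫ g = f.hom ≫ c'.ι) (hg' : c.ι ≫ g' = f'.hom ≫ c'.ι)
    (hs : c.π ≫ s.hom = g ≫ c'.π) (hs' : c.π ≫ s'.hom = g' ≫ c'.π) : stableRel C s s' := by
  obtain ⟨Q, _, a, b, h⟩ := hf
  obtain ⟨a', ha'⟩ := c.extend Q a
  have hc := c.shortExact
  have := hc.epi_g
  have : Epi c.π := hc.epi_g
  have h0 : c.ι ≫ (g - g' - a' ≫ b ≫ c'.ι) = 0 := by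
    simp only [Preadditive.comp_sub, hg, hg', reassoc_of% ha', ← Preadditive.sub_comp, h,
      Category.assoc, sub_self]
  refine ⟨c'.I, c'.projective, hc.exact.desc _ h0, c'.π, ?_⟩
  rw [← cancel_epi c.π, Preadditive.comp_sub, hs, hs']
  have := hc.exact.g_desc _ h0
  dsimp at this
  rw [reassoc_of% this]
  simp [c'.zero]

variable (C) in
/-- The functor to the stable category sending `X` to its chosen cosyzygy. -/
def GProj.cosyzygyFunctor : GProj C ⥤ StableGProj C where
  obj X := (StableGProj.proj C).obj X.cosyzygy.S
  map {X Y} f := (StableGProj.proj C).map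
    (X.cosyzygy.exists_map Y.cosyzygy f).choose_spec.choose
  map_id X := by
    have h := (X.cosyzygy.exists_map X.cosyzygy (𝟙 X)).choose_spec.choose_spec
    rw [← (StableGProj.proj C).map_id]
    apply Quotient.sound
    exact X.cosyzygy.map_unique X.cosyzygy (Congruence.equivalence.refl (𝟙 X)) h.1
      (g' := 𝟙 _) (by simp) h.2 (by simp)
  map_comp {X Y Z} f g := by
    have h := (X.cosyzygy.exists_map Z.cosyzygy (f ≫ g)).choose_spec.choose_spec
    have h₁ := (X.cosyzygy.exists_map Y.cosyzygy f).choose_spec.choose_spec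
    have h₂ := (Y.cosyzygy.exists_map Z.cosyzygy g).choose_spec.choose_spec
    rw [← (StableGProj.proj C).map_comp]
    apply Quotient.sound
    refine X.cosyzygy.map_unique Z.cosyzygy (Congruence.equivalence.refl (f ≫ g)) h.1
      (g' := (X.cosyzygy.exists_map Y.cosyzygy f).choose ≫
        (Y.cosyzygy.exists_map Z.cosyzygy g).choose) ?_ h.2 ?_
    · rw [reassoc_of% h₁.1, h₂.1]; simp
    · simp only [ObjectProperty.FullSubcategory.comp_hom, Category.assoc]
      rw [reassoc_of% h₁.2, h₂.2]

variable (C) in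
/-- The suspension functor of the stable category of Gorenstein projectives. -/
def StableGProj.susp : StableGProj C ⥤ StableGProj C :=
  Quotient.lift _ (GProj.cosyzygyFunctor C) (fun X Y f g hfg => by
    have h₁ := (X.cosyzygy.exists_map Y.cosyzygy f).choose_spec.choose_spec
    have h₂ := (X.cosyzygy.exists_map Y.cosyzygy g).choose_spec.choose_spec
    exact Quotient.sound _ (X.cosyzygy.map_unique Y.cosyzygy hfg h₁.1 h₂.1 h₁.2 h₂.2))

/-- Distinguished triangles `X ⟶ Y ⟶ Z ⟶ ΣX` of the stable category: those isomorphic to a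
standard triangle `A ⟶ B ⟶ D ⟶ ΣA`, where `0 ⟶ A ⟶ B ⟶ D ⟶ 0` is a short exact sequence
of Gorenstein projectives, and `D ⟶ ΣA` is induced by a morphism to the chosen cosyzygy sequence
`0 ⟶ A ⟶ I ⟶ ΣA ⟶ 0` that is the identity on `A`. -/
def StableGProj.IsDistinguished {X Y Z : StableGProj C} (f : X ⟶ Y) (g : Y ⟶ Z)
    (h : Z ⟶ (susp C).obj X) : Prop :=
  ∃ (A B D : GProj C) (u : A ⟶ B) (v : B ⟶ D) (zero : u.hom ≫ v.hom = 0)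
    (_ : (ShortComplex.mk u.hom v.hom zero).ShortExact)
    (t : B.obj ⟶ A.cosyzygy.I) (w : D ⟶ A.cosyzygy.S)
    (_ : u.hom ≫ t = A.cosyzygy.ι) (_ : v.hom ≫ w.hom = t ≫ A.cosyzygy.π)
    (a : (proj C).obj A ≅ X) (b : (proj C).obj B ≅ Y) (c : (proj C).obj D ≅ Z),
    (proj C).map u ≫ b.hom = a.hom ≫ f ∧ (proj C).map v ≫ c.hom = b.hom ≫ g ∧
      (proj C).map w ≫ (susp C).map a.hom = c.hom ≫ h

end Gorenstein

section Singularity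

variable (C : Type u) [Category.{v} C] [Abelian C]

/-- The bounded derived category. -/
abbrev Db := (DerivedCategory.TStructure.t (C := C)).bounded.FullSubcategory

/-- Bounded complexes of projective objects, as objects of the homotopy category. -/
def boundedProjective : ObjectProperty (HomotopyCategory C (ComplexShape.up ℤ)) := fun K =>
  ∃ a b : ℤ, CochainComplex.IsStrictlyGE K.as a ∧ CochainComplex.IsStrictlyLE K.as b ∧
    ∀ n, Projective (K.as.X n)

lemma boundedProjective_quotient_iff (K : CochainComplex C ℤ) :
    boundedProjective C ((HomotopyCategory.quotient _ _).obj K) ↔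
      ∃ a b : ℤ, K.IsStrictlyGE a ∧ K.IsStrictlyLE b ∧ ∀ n, Projective (K.X n) := Iff.rfl

instance : (boundedProjective C).ContainsZero where
  exists_zero :=
    ⟨(HomotopyCategory.quotient _ _).obj 0, Functor.map_isZero _ (isZero_zero _), by
      rw [boundedProjective_quotient_iff]
      exact ⟨0, 0, inferInstance, inferInstance, fun n => Projective.of_iso
        ((HomologicalComplex.eval C (ComplexShape.up ℤ) n).map_isZero
          (isZero_zero _)).isoZero.symm inferInstance⟩⟩

instance : (boundedProjective C).IsStableUnderShift ℤ where
  isStableUnderShiftBy n :=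
    { le_shift K hK := by
        obtain ⟨K : CochainComplex _ _, rfl⟩ := K.quotient_obj_surjective
        rw [boundedProjective_quotient_iff] at hK
        obtain ⟨a, b, _, _, h⟩ := hK
        rw [ObjectProperty.prop_shift_iff, HomotopyCategory.shift_quotient_obj,
          boundedProjective_quotient_iff]
        exact ⟨a - n, b - n, K.isStrictlyGE_shift a n (a - n) (by lia),
          K.isStrictlyLE_shift b n (b - n) (by lia), fun m => h (m + n)⟩ }

lemma isStrictlyLE_mappingCone {K L : CochainComplex C ℤ} (f : K ⟶ L)
    (b₁ b₂ n : ℤ) [K.IsStrictlyLE b₁] [L.IsStrictlyLE b₂] (h₁ : b₁ ≤ n) (h₂ : b₂ ≤ n) :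
    (CochainComplex.mappingCone f).IsStrictlyLE n := by
  rw [CochainComplex.isStrictlyLE_iff]
  intro i hi
  simp only [CochainComplex.mappingCone.isZero_X_iff]
  exact ⟨K.isZero_of_isStrictlyLE b₁ _ (by lia), L.isZero_of_isStrictlyLE b₂ _ (by lia)⟩

instance : (boundedProjective C).IsTriangulatedClosed₃ where
  ext₃' T hT h₁ h₂ := by
    obtain ⟨a₁, b₁, _, _, p₁⟩ := h₁
    obtain ⟨a₂, b₂, _, _, p₂⟩ := h₂
    obtain ⟨f : T.obj₁.as ⟶ T.obj₂.as, hf⟩ :=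
      (HomotopyCategory.quotient _ _).map_surjective T.mor₁
    refine ⟨_, ?_, ⟨Pretriangulated.Triangle.π₃.mapIso
      (Pretriangulated.isoTriangleOfIso₁₂ T _ hT
        (HomotopyCategory.mappingCone_triangleh_distinguished f)
        (Iso.refl _) (Iso.refl _) ?_)⟩⟩
    · change boundedProjective C ((HomotopyCategory.quotient _ _).obj _)
      rw [boundedProjective_quotient_iff]
      refine ⟨min (a₁ - 1) a₂, max b₁ b₂,
        CochainComplex.isStrictlyGE_mappingCone f a₁ a₂ _ (by simp) (by simp),
        isStrictlyLE_mappingCone C f b₁ b₂ _ (by simp) (by simp), fun n => ?_⟩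
      have := p₁ (n + 1)
      have := p₂ n
      exact Projective.of_iso (HomologicalComplex.homotopyCofiber.XIsoBiprod f n (n + 1) rfl).symm
        inferInstance
    · exact (Category.comp_id _).trans (hf.symm.trans (Category.id_comp _).symm)

instance : (boundedProjective C).IsTriangulated where
  toIsTriangulatedClosed₂ := .of_isTriangulatedClosed₃

/-- The functor from `Kᵇ(Proj C)` to the derived category. -/
abbrev KbProjToDerived : (boundedProjective C).FullSubcategory ⥤ DerivedCategory C :=
  (boundedProjective C).ι ⋙ DerivedCategory.Qh

instance : (KbProjToDerived C).Full where
  map_surjective {K L} f := by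
    obtain ⟨⟨K⟩, a, b, _, _, _⟩ := K
    have : CochainComplex.IsKProjective K := CochainComplex.isKProjective_of_projective K b
    obtain ⟨g, hg⟩ := (CochainComplex.IsKProjective.Qh_map_bijective K L.obj).surjective f
    exact ⟨ObjectProperty.homMk g, hg⟩

/-- The objects of the bounded derived category which are isomorphic to a bounded complex of
projective objects. -/
def perfectObjects : ObjectProperty (Db C) :=
  (KbProjToDerived C).essImage.inverseImage (ObjectProperty.ι _)

instance : (perfectObjects C).IsTriangulated := by
  unfold perfectObjects; infer_instance

/-- The singularity category: the Verdier quotient `Dᵇ(C) / Kᵇ(Proj C)`. -/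
abbrev Dsg := (perfectObjects C).trW.Localization

/-- The quotient functor from the bounded derived category to the singularity category. -/
abbrev Dsg.Q : Db C ⥤ Dsg C := (perfectObjects C).trW.Q

/-- The inclusion of `C` in its bounded derived category, as complexes concentrated in degree `0`. -/
abbrev Db.single : C ⥤ Db C :=
  ObjectProperty.lift _ (DerivedCategory.singleFunctor C 0) (fun _ =>
    ⟨⟨0, inferInstance⟩, ⟨0, inferInstance⟩⟩)

instance : (Db.single C).Additive where
  map_add {X Y f g} := by
    ext
    exact (DerivedCategory.singleFunctor C 0).map_add

variable {C}

lemma perfectObjects_single (P : C) [Projective P] : perfectObjects C ((Db.single C).obj P) := by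
  refine ⟨⟨(HomotopyCategory.quotient _ _).obj ((CochainComplex.singleFunctor C 0).obj P),
    0, 0, ?_, ?_, ?_⟩, ⟨?_⟩⟩
  · exact inferInstanceAs (((CochainComplex.singleFunctor C 0).obj P).IsStrictlyGE 0)
  · exact inferInstanceAs (((CochainComplex.singleFunctor C 0).obj P).IsStrictlyLE 0)
  · intro n
    change Projective (((HomologicalComplex.single C (ComplexShape.up ℤ) 0).obj P).X n)
    by_cases h : n = 0
    · subst h
      exact Projective.of_iso (HomologicalComplex.singleObjXSelf (ComplexShape.up ℤ) 0 P).symm ‹_›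
    · exact Projective.of_iso (HomologicalComplex.isZero_single_obj_X (ComplexShape.up ℤ) 0 P n h
        |>.isoZero.symm) inferInstance
  · exact (DerivedCategory.quotientCompQhIso C).app _ ≪≫
      ((DerivedCategory.singleFunctorIsoCompQ C 0).app P).symm

lemma isZero_Dsg_single (P : C) [Projective P] :
    IsZero ((Dsg.Q C).obj ((Db.single C).obj P)) := by
  have h : (perfectObjects C).trW (0 : (Db.single C).obj P ⟶ 0) := by
    rw [ObjectProperty.trW_iff']
    exact ⟨_, _, _, Pretriangulated.contractible_distinguished _, perfectObjects_single P⟩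
  have := Localization.inverts (Dsg.Q C) _ _ h
  exact ((Dsg.Q C).map_isZero (isZero_zero _)).of_iso (asIso ((Dsg.Q C).map
    (0 : (Db.single C).obj P ⟶ 0)))

variable (C) in
/-- The canonical functor from the stable category of Gorenstein projectives to the singularity
category, sending `X` to the complex `X` concentrated in degree `0`. -/
def StableGProj.toDsg : StableGProj C ⥤ Dsg C :=
  Quotient.lift _ ((gorensteinProjective C).ι ⋙ Db.single C ⋙ Dsg.Q C) (by
    rintro X Y f g ⟨P, _, a, b, h⟩
    have h0 : (Db.single C ⋙ Dsg.Q C).map (a ≫ b) = 0 := by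
      rw [Functor.map_comp]
      exact (isZero_Dsg_single P).eq_zero_of_tgt _ =≫ _ |>.trans zero_comp
    rw [← h, Functor.map_sub, sub_eq_zero] at h0
    exact h0)

/-- The connecting morphism `X₃ ⟶ X₁⟦1⟧` in the singularity category of a short exact sequence. -/
def Dsg.δ {S : ShortComplex C} (hS : S.ShortExact) :
    (Dsg.Q C).obj ((Db.single C).obj S.X₃) ⟶
      ((Dsg.Q C).obj ((Db.single C).obj S.X₁))⟦(1 : ℤ)⟧ :=
  (Dsg.Q C).map (ObjectProperty.homMk
    (hS.singleδ ≫ ((ObjectProperty.ι _).commShiftIso (1 : ℤ)).inv.app ((Db.single C).obj S.X₁))) ≫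
    ((Dsg.Q C).commShiftIso (1 : ℤ)).hom.app _

/-- The canonical morphism `ΣX ⟶ X⟦1⟧` in the singularity category, for `X` in the stable category
of Gorenstein projectives: the connecting morphism of the chosen cosyzygy sequence of `X`. -/
def StableGProj.suspToShift (X : StableGProj C) :
    (toDsg C).obj ((susp C).obj X) ⟶ ((toDsg C).obj X)⟦(1 : ℤ)⟧ :=
  Dsg.δ X.as.cosyzygy.shortExact

end Singularity

section Functors

variable {C : Type u} [Category.{v} C] [Abelian C] {D : Type u'} [Category.{v'} D] [Abelian D]

variable (C D) in
/-- A triangle functor between stable categories of Gorenstein projectives: an additive functor with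
a natural isomorphism `EΣ ≅ ΣE` which preserves distinguished triangles. -/
structure StableTriangleFunctor where
  functor : StableGProj C ⥤ StableGProj D
  additive : functor.Additive
  suspIso : StableGProj.susp C ⋙ functor ≅ functor ⋙ StableGProj.susp D
  map_distinguished {X Y Z : StableGProj C} (f : X ⟶ Y) (g : Y ⟶ Z)
    (h : Z ⟶ (StableGProj.susp C).obj X) (_ : StableGProj.IsDistinguished f g h) :
    StableGProj.IsDistinguished (functor.map f) (functor.map g)
      (functor.map h ≫ suspIso.hom.app X)

variable (F : C ⥤ D) [F.Additive] [PreservesFiniteLimits F] [PreservesFiniteColimits F]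

lemma bounded_mapDerivedCategory (X : Db C) :
    (DerivedCategory.TStructure.t (C := D)).bounded (F.mapDerivedCategory.obj X.obj) := by
  obtain ⟨X, ⟨a, _⟩, ⟨b, _⟩⟩ := X
  have : X.IsGE a := ‹_›
  have : X.IsLE b := ‹_›
  obtain ⟨K, _, _, ⟨e⟩⟩ := DerivedCategory.exists_iso_Q_obj_of_isGE_of_isLE X a b
  have e' := F.mapDerivedCategory.mapIso e ≪≫ F.mapDerivedCategoryFactors.app K
  refine ObjectProperty.prop_of_iso _ e'.symm ⟨⟨a, ?_⟩, ⟨b, ?_⟩⟩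
  · have : CochainComplex.IsStrictlyGE
        ((F.mapHomologicalComplex (ComplexShape.up ℤ)).obj K) a := by
      rw [CochainComplex.isStrictlyGE_iff]
      exact fun i hi => F.map_isZero (K.isZero_of_isStrictlyGE a i hi)
    exact inferInstanceAs (DerivedCategory.IsGE (DerivedCategory.Q.obj _) a)
  · have : CochainComplex.IsStrictlyLE
        ((F.mapHomologicalComplex (ComplexShape.up ℤ)).obj K) b := by
      rw [CochainComplex.isStrictlyLE_iff]
      exact fun i hi => F.map_isZero (K.isZero_of_isStrictlyLE b i hi)
    exact inferInstanceAs (DerivedCategory.IsLE (DerivedCategory.Q.obj _) b)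

/-- The functor between bounded derived categories induced by an exact functor. -/
abbrev Db.map : Db C ⥤ Db D :=
  ObjectProperty.lift _ (ObjectProperty.ι _ ⋙ F.mapDerivedCategory) (bounded_mapDerivedCategory F)

/-- The exact functor `F` induces a triangle equivalence between stable categories of Gorenstein
projectives: there are a triangle functor `Fsg` between singularity categories induced
by `F`, a triangle functor `E` between the stable categories which is an equivalence,
and a natural isomorphism making `E` (with its isomorphism `EΣ ≅ ΣE`) the restriction
of the triangle functor `Fsg`. -/
def InducesStableTriangleEquivalence : Prop :=
  ∃ (Fsg : Dsg C ⥤ Dsg D) (_ : Fsg.CommShift ℤ) (_ : Fsg.IsTriangulated)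
    (β : Dsg.Q C ⋙ Fsg ≅ Db.map F ⋙ Dsg.Q D) (_ : NatTrans.CommShift β.hom ℤ)
    (E : StableTriangleFunctor C D)
    (α : E.functor ⋙ StableGProj.toDsg D ≅ StableGProj.toDsg C ⋙ Fsg),
    E.functor.IsEquivalence ∧
    ∀ X : StableGProj C,
      (StableGProj.toDsg D).map (E.suspIso.hom.app X) ≫
          (E.functor.obj X).suspToShift ≫ (α.hom.app X)⟦(1 : ℤ)⟧' =
        α.hom.app ((StableGProj.susp C).obj X) ≫ Fsg.map X.suspToShift ≫
          (Fsg.commShiftIso (1 : ℤ)).hom.app ((StableGProj.toDsg C).obj X)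

end Functors
end CategoryTheory

section Tensor

variable (Γ : Type u) [Ring Γ] (M : Type u) [AddCommGroup M] [Module Γᵐᵒᵖ M]
  (N : Type u) [AddCommGroup N] [Module Γ N]

/-- The relations `mγ ⊗ n = m ⊗ γn` in `M ⊗_ℤ N`, for a right `Γ`-module `M` (that is, a left module
over `Γᵐᵒᵖ`) and a left `Γ`-module `N`. -/
def balancedSubgroup : AddSubgroup (M ⊗[ℤ] N) :=
  AddSubgroup.closure {x | ∃ (m : M) (γ : Γ) (n : N), x = (op γ • m) ⊗ₜ[ℤ] n - m ⊗ₜ[ℤ] (γ • n)}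

/-- The tensor product `M ⊗_Γ N` of a right and a left module over a ring `Γ`. -/
def NCTensor : Type u := (M ⊗[ℤ] N) ⧸ balancedSubgroup Γ M N

instance : AddCommGroup (NCTensor Γ M N) :=
  inferInstanceAs (AddCommGroup ((M ⊗[ℤ] N) ⧸ balancedSubgroup Γ M N))

namespace NCTensor

/-- The projection `M ⊗_ℤ N → M ⊗_Γ N`. -/
def mk : M ⊗[ℤ] N →+ NCTensor Γ M N := QuotientAddGroup.mk' (balancedSubgroup Γ M N)

variable {M N}

/-- The pure tensor `m ⊗ n` in `M ⊗_Γ N`. -/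
def tmul (m : M) (n : N) : NCTensor Γ M N := mk Γ M N (m ⊗ₜ[ℤ] n)

lemma smul_tmul (m : M) (γ : Γ) (n : N) : tmul Γ (op γ • m) n = tmul Γ m (γ • n) := by
  rw [← sub_eq_zero, tmul, tmul, ← map_sub]
  exact (QuotientAddGroup.eq_zero_iff _).2 (AddSubgroup.subset_closure ⟨m, γ, n, rfl⟩)

lemma add_tmul (m m' : M) (n : N) : tmul Γ (m + m') n = tmul Γ m n + tmul Γ m' n := by
  simp [tmul, TensorProduct.add_tmul]

lemma tmul_add (m : M) (n n' : N) : tmul Γ m (n + n') = tmul Γ m n + tmul Γ m n' := by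
  simp [tmul, TensorProduct.tmul_add]

variable {Γ}

lemma hom_ext {A : Type*} [AddCommGroup A] {f g : NCTensor Γ M N →+ A}
    (h : ∀ m n, f (tmul Γ m n) = g (tmul Γ m n)) : f = g := by
  apply QuotientAddGroup.addMonoidHom_ext
  ext x
  induction x with
  | zero => simp
  | tmul m n => exact h m n
  | add x y hx hy => rw [map_add, map_add, hx, hy]

variable {M' : Type u} [AddCommGroup M'] [Module Γᵐᵒᵖ M'] {N' : Type u} [AddCommGroup N']
  [Module Γ N']

/-- The map `f ⊗ g` on tensor products over `Γ`. -/
def map (f : M →ₗ[Γᵐᵒᵖ] M') (g : N →ₗ[Γ] N') : NCTensor Γ M N →+ NCTensor Γ M' N' :=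
  QuotientAddGroup.map (balancedSubgroup Γ M N) (balancedSubgroup Γ M' N')
    (TensorProduct.map f.toAddMonoidHom.toIntLinearMap
      g.toAddMonoidHom.toIntLinearMap).toAddMonoidHom (by
    rw [balancedSubgroup, AddSubgroup.closure_le]
    rintro _ ⟨m, γ, n, rfl⟩
    apply AddSubgroup.subset_closure
    exact ⟨f m, γ, g n, by simp⟩)

@[simp]
lemma map_tmul (f : M →ₗ[Γᵐᵒᵖ] M') (g : N →ₗ[Γ] N') (m : M) (n : N) :
    map f g (tmul Γ m n) = tmul Γ (f m) (g n) := rfl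

/-- The left `Γ`-module structure on `M ⊗_Γ N` when `M` is a bimodule. -/
instance [Module Γ M] [SMulCommClass Γ Γᵐᵒᵖ M] : Module Γ (NCTensor Γ M N) :=
  Module.compHom _ (S := Γ) (R := AddMonoid.End (NCTensor Γ M N))
    { toFun γ := map (Module.toModuleEnd Γᵐᵒᵖ (S := Γ) M γ) LinearMap.id
      map_one' := hom_ext fun m n =>
        show tmul Γ ((1 : Γ) • m) n = tmul Γ m n by rw [one_smul]
      map_mul' γ γ' := hom_ext fun m n =>
        show tmul Γ ((γ * γ') • m) n = tmul Γ (γ • γ' • m) n by rw [mul_smul]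
      map_zero' := hom_ext fun m n =>
        show tmul Γ ((0 : Γ) • m) n = 0 by simp [tmul]
      map_add' γ γ' := hom_ext fun m n =>
        (congrArg (tmul Γ · n) (add_smul γ γ' m)).trans (add_tmul Γ _ _ _) }

/-- The right `Γ`-module structure on `M ⊗_Γ N` when `N` is a bimodule. -/
instance [Module Γᵐᵒᵖ N] [SMulCommClass Γ Γᵐᵒᵖ N] : Module Γᵐᵒᵖ (NCTensor Γ M N) :=
  letI : SMulCommClass Γᵐᵒᵖ Γ N := SMulCommClass.symm _ _ _
  Module.compHom _ (S := Γᵐᵒᵖ) (R := AddMonoid.End (NCTensor Γ M N))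
    { toFun γ := map LinearMap.id (Module.toModuleEnd Γ (S := Γᵐᵒᵖ) N γ)
      map_one' := hom_ext fun m n =>
        show tmul Γ m ((1 : Γᵐᵒᵖ) • n) = tmul Γ m n by rw [one_smul]
      map_mul' γ γ' := hom_ext fun m n =>
        show tmul Γ m ((γ * γ') • n) = tmul Γ m (γ • γ' • n) by rw [mul_smul]
      map_zero' := hom_ext fun m n =>
        show tmul Γ m ((0 : Γᵐᵒᵖ) • n) = 0 by simp [tmul]
      map_add' γ γ' := hom_ext fun m n =>
        (congrArg (tmul Γ m) (add_smul γ γ' n)).trans (tmul_add Γ _ _ _) }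

lemma smul_tmul_left [Module Γ M] [SMulCommClass Γ Γᵐᵒᵖ M] (γ : Γ) (m : M) (n : N) :
    γ • tmul Γ m n = tmul Γ (γ • m) n := rfl

lemma smul_tmul_right [Module Γᵐᵒᵖ N] [SMulCommClass Γ Γᵐᵒᵖ N] (γ : Γᵐᵒᵖ) (m : M) (n : N) :
    γ • tmul Γ m n = tmul Γ m (γ • n) := rfl

instance [Module Γ M] [SMulCommClass Γ Γᵐᵒᵖ M] [Module Γᵐᵒᵖ N] [SMulCommClass Γ Γᵐᵒᵖ N] :
    SMulCommClass Γ Γᵐᵒᵖ (NCTensor Γ M N) where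
  smul_comm γ γ' x := by
    have : (DistribSMul.toAddMonoidHom (NCTensor Γ M N) γ).comp
        (DistribSMul.toAddMonoidHom (NCTensor Γ M N) γ') =
        (DistribSMul.toAddMonoidHom (NCTensor Γ M N) γ').comp
        (DistribSMul.toAddMonoidHom (NCTensor Γ M N) γ) := hom_ext fun m n => rfl
    exact DFunLike.congr_fun this x

variable (Γ N) in
/-- The functor `- ⊗_Γ N` from right `Γ`-modules to abelian groups. -/
def functor : ModuleCat.{u} Γᵐᵒᵖ ⥤ AddCommGrpCat.{u} where
  obj X := AddCommGrpCat.of (NCTensor Γ X N)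
  map f := AddCommGrpCat.ofHom (map f.hom LinearMap.id)
  map_id X := by
    ext : 1
    exact hom_ext fun m n => rfl
  map_comp f g := by
    ext : 1
    exact hom_ext fun m n => rfl

instance : (functor Γ N).Additive where
  map_add {X Y f g} := by
    ext : 1
    exact hom_ext fun m n => add_tmul Γ _ _ _

end NCTensor

/-- `Tor_i^Γ(M, N)` for a right module `M` and a left module `N`: the `i`-th left derived functor of
`- ⊗_Γ N` applied to `M`. -/
def NCTor (i : ℕ) : AddCommGrpCat.{u} :=
  ((NCTensor.functor Γ N).leftDerived i).obj (ModuleCat.of Γᵐᵒᵖ M)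

end Tensor

/-- A bundled `Γ`-`Γ`-bimodule; right actions are actions of `Γᵐᵒᵖ`. -/
structure BimoduleObj (Γ : Type u) [Ring Γ] where
  carrier : Type u
  [addCommGroup : AddCommGroup carrier]
  [left : Module Γ carrier]
  [right : Module Γᵐᵒᵖ carrier]
  [comm : SMulCommClass Γ Γᵐᵒᵖ carrier]

attribute [instance] BimoduleObj.addCommGroup BimoduleObj.left BimoduleObj.right BimoduleObj.comm

section Bimodule

variable (Γ : Type u) [Ring Γ] (M : Type u) [AddCommGroup M] [Module Γ M] [Module Γᵐᵒᵖ M]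
  [SMulCommClass Γ Γᵐᵒᵖ M]

/-- The tensor powers `M^{⊗ j}` over `Γ`, with `M^{⊗ 0} = Γ`, `M^{⊗ 1} = M`. -/
def bimodulePow : ℕ → BimoduleObj Γ
  | 0 => { carrier := Γ }
  | 1 => { carrier := M }
  | (j + 2) => { carrier := NCTensor Γ M (bimodulePow (j + 1)).carrier }

/-- `M` is nilpotent: `M^{⊗ n} = 0` for some `n ≥ 1`. -/
def IsNilpotentBimodule : Prop := ∃ n : ℕ, 1 ≤ n ∧ Subsingleton (bimodulePow Γ M n).carrier

/-- `Tor_i^Γ(M, M^{⊗ j}) = 0` for all `i, j ≥ 1`. -/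
def TorVanishing : Prop :=
  ∀ i j : ℕ, 1 ≤ i → 1 ≤ j → IsZero (NCTor Γ M (bimodulePow Γ M j).carrier i)

/-- An associative homomorphism of `Γ`-bimodules `θ : M ⊗_Γ M → M`. -/
structure ThetaMap where
  toFun : NCTensor Γ M M →+ M
  map_smul_left (γ : Γ) (x : NCTensor Γ M M) : toFun (γ • x) = γ • toFun x
  map_smul_right (γ : Γᵐᵒᵖ) (x : NCTensor Γ M M) : toFun (γ • x) = γ • toFun x
  assoc (a b c : M) : toFun (NCTensor.tmul Γ (toFun (NCTensor.tmul Γ a b)) c) =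
    toFun (NCTensor.tmul Γ a (toFun (NCTensor.tmul Γ b c)))

variable (k : Type w) [Field k] [Algebra k Γ] [Module k M] [IsScalarTower k Γ M]
  [IsScalarTower k Γᵐᵒᵖ M]

/-- The bimodule `M` as a module over the enveloping algebra `Γᵉ = Γ ⊗_k Γᵒᵖ`. -/
def envelopingModule : ModuleCat.{u} (Γ ⊗[k] Γᵐᵒᵖ) :=
  letI : Module (Γ ⊗[k] Γᵐᵒᵖ) M := TensorProduct.Algebra.module
  ModuleCat.of _ M

end Bimodule

section ThetaExtension

variable {Γ : Type u} [Ring Γ] {M : Type u} [AddCommGroup M] [Module Γ M] [Module Γᵐᵒᵖ M]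
  [SMulCommClass Γ Γᵐᵒᵖ M]

/-- The underlying group `Γ ⊕ M` of the `θ`-extension `Γ ⋉_θ M`. -/
def ThetaExt (_ : ThetaMap Γ M) : Type u := Γ × M

variable (θ : ThetaMap Γ M)

/-- The product `M × M → M` given by `θ`. -/
def ThetaMap.mul (a b : M) : M := θ.toFun (NCTensor.tmul Γ a b)

lemma ThetaMap.add_mul (a b c : M) : θ.mul (a + b) c = θ.mul a c + θ.mul b c := by
  simp [mul, NCTensor.add_tmul]

lemma ThetaMap.mul_add (a b c : M) : θ.mul a (b + c) = θ.mul a b + θ.mul a c := by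
  simp [mul, NCTensor.tmul_add]

lemma ThetaMap.zero_mul (a : M) : θ.mul 0 a = 0 := by simp [mul, NCTensor.tmul]

lemma ThetaMap.mul_zero (a : M) : θ.mul a 0 = 0 := by simp [mul, NCTensor.tmul]

lemma ThetaMap.smul_mul (γ : Γ) (a b : M) : θ.mul (γ • a) b = γ • θ.mul a b :=
  θ.map_smul_left γ (NCTensor.tmul Γ a b)

lemma ThetaMap.mul_op_smul (γ : Γᵐᵒᵖ) (a b : M) : θ.mul a (γ • b) = γ • θ.mul a b :=
  θ.map_smul_right γ (NCTensor.tmul Γ a b)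

lemma ThetaMap.op_smul_mul (γ : Γ) (a b : M) : θ.mul (op γ • a) b = θ.mul a (γ • b) := by
  rw [mul, NCTensor.smul_tmul]; rfl

namespace ThetaExt

instance : AddCommGroup (ThetaExt θ) := inferInstanceAs (AddCommGroup (Γ × M))

variable {θ} in
@[ext] lemma ext {x y : ThetaExt θ} (h₁ : x.1 = y.1) (h₂ : x.2 = y.2) : x = y := Prod.ext h₁ h₂

instance : Mul (ThetaExt θ) where
  mul x y := (x.1 * y.1, x.1 • y.2 + op y.1 • x.2 + θ.mul x.2 y.2)

instance : One (ThetaExt θ) where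
  one := ((1 : Γ), (0 : M))

variable {θ}
@[simp] lemma mul_fst (x y : ThetaExt θ) : (x * y).1 = x.1 * y.1 := rfl
@[simp] lemma mul_snd (x y : ThetaExt θ) :
    (x * y).2 = x.1 • y.2 + op y.1 • x.2 + θ.mul x.2 y.2 := rfl
@[simp] lemma one_fst : (1 : ThetaExt θ).1 = 1 := rfl
@[simp] lemma one_snd : (1 : ThetaExt θ).2 = 0 := rfl
@[simp] lemma add_fst (x y : ThetaExt θ) : (x + y).1 = x.1 + y.1 := rfl
@[simp] lemma add_snd (x y : ThetaExt θ) : (x + y).2 = x.2 + y.2 := rfl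
@[simp] lemma zero_fst : (0 : ThetaExt θ).1 = 0 := rfl
@[simp] lemma zero_snd : (0 : ThetaExt θ).2 = 0 := rfl

variable (θ)

/-- The ring `Γ ⋉_θ M`, with product `(γ, m)(γ', m') = (γγ', γm' + mγ' + θ(m ⊗ m'))`. -/
instance : Ring (ThetaExt θ) :=
  { (inferInstance : AddCommGroup (ThetaExt θ)) with
    mul := (· * ·)
    one := 1
    one_mul x := by ext <;> simp [θ.zero_mul]
    mul_one x := by ext <;> simp [θ.mul_zero]
    zero_mul x := by ext <;> simp [θ.zero_mul]
    mul_zero x := by ext <;> simp [θ.mul_zero]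
    left_distrib x y z := by
      ext
      · simp [mul_add]
      · simp [add_smul, smul_add, θ.mul_add]; abel
    right_distrib x y z := by
      ext
      · simp [add_mul]
      · simp [add_smul, smul_add, θ.add_mul]; abel
    mul_assoc x y z := by
      ext
      · simp [mul_assoc]
      · have h := θ.assoc x.2 y.2 z.2
        change θ.mul (θ.mul x.2 y.2) z.2 = θ.mul x.2 (θ.mul y.2 z.2) at h
        simp only [mul_snd, mul_fst, smul_add, θ.add_mul, θ.mul_add, θ.smul_mul, θ.mul_op_smul,
          θ.op_smul_mul, mul_smul, op_mul, h, smul_comm x.1 (op z.1) y.2]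
        abel }

/-- The ring homomorphism `Γ → Γ ⋉_θ M`, `γ ↦ (γ, 0)`. -/
def inl : Γ →+* ThetaExt θ where
  toFun γ := (γ, 0)
  map_one' := rfl
  map_mul' x y := ThetaExt.ext rfl
    (show (0 : M) = x • (0 : M) + op y • (0 : M) + θ.mul 0 0 by simp [θ.mul_zero])
  map_zero' := rfl
  map_add' _ _ := ThetaExt.ext rfl (add_zero (0 : M)).symm

lemma finite_op [Module.Finite Γᵐᵒᵖ M] :
    letI := Module.compHom (ThetaExt θ)ᵐᵒᵖ (inl θ).op
    Module.Finite Γᵐᵒᵖ (ThetaExt θ)ᵐᵒᵖ := by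
  let _ := Module.compHom (ThetaExt θ)ᵐᵒᵖ (inl θ).op
  let f : (Γ × M) →ₗ[Γᵐᵒᵖ] (ThetaExt θ)ᵐᵒᵖ :=
    { toFun x := op (show ThetaExt θ from x)
      map_add' _ _ := rfl
      map_smul' γ x := by
        apply unop_injective
        change (γ • x : Γ × M) = ((show ThetaExt θ from x) * inl θ γ.unop : ThetaExt θ)
        apply ThetaExt.ext
        · rfl
        · change γ • x.2 = x.1 • (0 : M) + op γ.unop • x.2 + θ.mul x.2 0
          simp [θ.mul_zero] }
  have : Module.Finite Γᵐᵒᵖ Γ :=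
    let g : Γᵐᵒᵖ →ₗ[Γᵐᵒᵖ] Γ :=
      { toFun := unop, map_add' := fun _ _ => rfl, map_smul' := fun _ _ => rfl }
    Module.Finite.of_surjective g unop_surjective
  exact Module.Finite.of_surjective f fun y => ⟨y.unop, rfl⟩

instance [IsNoetherianRing Γᵐᵒᵖ] [Module.Finite Γᵐᵒᵖ M] : IsNoetherianRing (ThetaExt θ)ᵐᵒᵖ := by
  let _ := Module.compHom (ThetaExt θ)ᵐᵒᵖ (inl θ).op
  have := finite_op θ
  have : IsScalarTower Γᵐᵒᵖ (ThetaExt θ)ᵐᵒᵖ (ThetaExt θ)ᵐᵒᵖ := ⟨fun x y z => mul_assoc _ _ _⟩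
  exact isNoetherian_of_tower Γᵐᵒᵖ inferInstance

end ThetaExt

end ThetaExtension

lemma isNoetherianRing_op_of_finite (k : Type w) (Γ : Type u) [Field k] [Ring Γ] [Algebra k Γ]
    [Module.Finite k Γ] : IsNoetherianRing Γᵐᵒᵖ :=
  isNoetherian_of_tower k (inferInstance : IsNoetherian k Γᵐᵒᵖ)

section Restriction

section

variable {A B : Type u} [Ring A] [Ring B] (f : A →+* B)

lemma exact_restrictScalars : PreservesFiniteLimits (ModuleCat.restrictScalars.{u} f) ∧
    PreservesFiniteColimits (ModuleCat.restrictScalars.{u} f) :=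
  ((Functor.exact_tfae (ModuleCat.restrictScalars.{u} f)).out 1 3).mp fun S h => by
    rw [ShortComplex.ShortExact.moduleCat_exact_iff_function_exact] at h ⊢
    exact h

lemma finite_restrictScalars (hf : letI := Module.compHom B f; Module.Finite A B)
    (X : ModuleCat.{u} B) [Module.Finite B X] :
    Module.Finite A ((ModuleCat.restrictScalars f).obj X) := by
  let _ : Module A B := Module.compHom B f
  let _ : Module A X := Module.compHom X f
  have : IsScalarTower A B X := ⟨fun x y z => mul_smul (f x) y z⟩
  exact (Module.Finite.trans B X : Module.Finite A X)

variable (hf : letI := Module.compHom B f; Module.Finite A B)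

/-- Restriction of scalars of finitely generated modules along `f : A → B`, when `B` is finitely
generated over `A`. -/
def restrictFG : FGModuleCat.{u} B ⥤ FGModuleCat.{u} A :=
  ObjectProperty.lift _ (ObjectProperty.ι _ ⋙ ModuleCat.restrictScalars f) (fun X =>
    have : Module.Finite B X.obj := X.property
    finite_restrictScalars f hf X.obj)

instance : (restrictFG f hf).Additive where
  map_add := rfl

variable [IsNoetherianRing A] [IsNoetherianRing B]

instance : PreservesFiniteLimits (restrictFG f hf) where
  preservesFiniteLimits J _ _ := by
    have : PreservesLimitsOfShape J (ModuleCat.isFG B).ι :=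
      inferInstanceAs (PreservesLimitsOfShape J (forget₂ (FGModuleCat.{u} B) (ModuleCat.{u} B)))
    have : PreservesLimitsOfShape J (ModuleCat.restrictScalars.{u} f) :=
      (exact_restrictScalars f).1.preservesFiniteLimits J
    have : PreservesLimitsOfShape J (restrictFG f hf ⋙ (ModuleCat.isFG A).ι) :=
      inferInstanceAs (PreservesLimitsOfShape J ((ModuleCat.isFG B).ι ⋙
        ModuleCat.restrictScalars.{u} f))
    exact preservesLimitsOfShape_of_reflects_of_preserves _ (ModuleCat.isFG A).ι

instance : PreservesFiniteColimits (restrictFG f hf) where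
  preservesFiniteColimits J _ _ := by
    have : PreservesColimitsOfShape J (ModuleCat.isFG B).ι :=
      inferInstanceAs (PreservesColimitsOfShape J (forget₂ (FGModuleCat.{u} B) (ModuleCat.{u} B)))
    have : PreservesColimitsOfShape J (ModuleCat.restrictScalars.{u} f) :=
      (exact_restrictScalars f).2.preservesFiniteColimits J
    have : PreservesColimitsOfShape J (restrictFG f hf ⋙ (ModuleCat.isFG A).ι) :=
      inferInstanceAs (PreservesColimitsOfShape J ((ModuleCat.isFG B).ι ⋙
        ModuleCat.restrictScalars.{u} f))
    exact preservesColimitsOfShape_of_reflects_of_preserves _ (ModuleCat.isFG A).ι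

end

/-- `mod R`: finitely generated right modules over `R`. -/
abbrev FGRightMod (R : Type u) [Ring R] := FGModuleCat.{u} Rᵐᵒᵖ

variable {Γ : Type u} [Ring Γ] {M : Type u} [AddCommGroup M] [Module Γ M] [Module Γᵐᵒᵖ M]
  [SMulCommClass Γ Γᵐᵒᵖ M] [Module.Finite Γᵐᵒᵖ M] (θ : ThetaMap Γ M)

/-- The functor `e : mod (Γ ⋉_θ M) ⥤ mod Γ`, restriction of scalars along `Γ → Γ ⋉_θ M`. -/
abbrev ThetaExt.restriction : FGRightMod (ThetaExt θ) ⥤ FGRightMod Γ :=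
  restrictFG (inl θ).op (finite_op θ)

end Restriction

end

noncomputable section

namespace CategoryTheory

/-! ### Gorenstein projective objects and objects of finite projective dimension. -/

section Gorenstein

variable {C : Type u} [Category.{v} C] [Abelian C]

/-! Write `F = - ⊗_Γ M`, let `l = - ⊗_Γ Λ` be the left adjoint of `e`, let `q = - ⊗_Λ Γ` be
extension of scalars along the projection `Λ → Γ`, whose kernel is the ideal `M`, and let `i` be the
right adjoint of `q` (inflation). Then `q l = id` and `e i = id`. The kernel `κ Y` of the counit `l
e Y → Y` satisfies `e κ = F e`, so nilpotency of `M` makes some power of `κ` vanish. Applying `q` to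
the counit sequence gives a natural right exact sequence `q κ Y → e Y → q Y → 0` with maps `σ` and
`ρ`.

The stable equivalence is realised by `q`; `e` itself is never shown to preserve Gorenstein
projectives. For Gorenstein projective `Y` the sequence above is short exact and `q κ Y` has finite
projective dimension, so `ρ` becomes invertible in the singularity category and `q` agrees there
with the functor induced by `e` (`PreservesGProj.inducesStableTriangleEquivalence`). Both facts come
by descending induction along the powers of `κ`, from corresponding facts about `e κ^n = F^n e`.

The heart is `exists_isIso_adjunct`: every Gorenstein projective `Y` is isomorphic to `l q Y`. Since
`Ext¹` from a Gorenstein projective to an object of finite projective dimension vanishes, `ρ : e Y →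
q Y` has a section `s`. Its adjunct `l q Y → Y` becomes invertible under `q`, and a Nakayama lemma,
which is where nilpotency is used again, makes it invertible. Fullness and faithfulness of `q` on
stable categories follow by transporting maps through these isomorphisms, and essential surjectivity
from `q l = id`, once `l` is known to preserve Gorenstein projectives.

The other hypotheses enter through a bimodule resolution of `M`. Finite projective dimension over
`Γᵉ` gives finitely many short exact sequences `0 → Ω (i+1) → R i → Ω i → 0` with `Ω 0 = M`, such
that `V ⊗ R i`, and `V ⊗ Ω n` for the last syzygy, are projective for every finitely generated `V`.
The vanishing of Tor keeps these sequences exact after tensoring with `V ⊗ M^{⊗ j}`, when `V` is a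
summand of a power of `Γ ⊕ M`; restrictions of projective `Λ`-modules are of this kind. The passage
from projectives to Gorenstein projectives is `ExactOnGProj.cokernel`: a Gorenstein projective
embeds in a projective with Gorenstein projective cokernel, so injectivity on projectives descends
to it. -/

lemma shift_negOnePow_d (P : CochainComplex C ℤ) (n i j : ℤ) :
    (((CategoryTheory.shiftFunctor (CochainComplex C ℤ) n).obj P).d i j =
      (P.d (i + n) (j + n) : P.X (i + n) ⟶ P.X (j + n))) ∨
    (((CategoryTheory.shiftFunctor (CochainComplex C ℤ) n).obj P).d i j =
      (-P.d (i + n) (j + n) : P.X (i + n) ⟶ P.X (j + n))) := by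
  rcases Int.even_or_odd n with h | h
  · left
    simp [CochainComplex.shiftFunctor_obj_d', Int.negOnePow_even n h]
  · right
    simp [CochainComplex.shiftFunctor_obj_d', Int.negOnePow_odd n h]

lemma IsTotallyAcyclic.shift_int {P : CochainComplex C ℤ} (h : IsTotallyAcyclic P) (m : ℤ) :
    IsTotallyAcyclic ((CategoryTheory.shiftFunctor (CochainComplex C ℤ) m).obj P) where
  projective n := h.projective (n + m)
  acyclic := by
    intro n
    have := h.acyclic (n + m)
    rw [HomologicalComplex.exactAt_iff_isZero_homology] at this ⊢
    exact this.of_iso (ShortComplex.homologyMapIso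
      ((CochainComplex.shiftShortComplexFunctorIso C m n (n + m) (by lia)).app P))
  hom_exact Q _ n f hf := by
    have hf' : P.d (n - 1 + m) (n + m) ≫ f = 0 := by
      rcases shift_negOnePow_d P m (n - 1) n with e | e
      · rw [e] at hf; exact hf
      · rw [e] at hf; exact neg_eq_zero.1 ((Preadditive.neg_comp _ _).symm.trans hf)
    obtain ⟨g, hg⟩ := h.hom_exact' Q (n - 1 + m) (n + m) (n + 1 + m) (by lia) (by lia) f hf'
    rcases shift_negOnePow_d P m n (n + 1) with e | e
    · exact ⟨g, by rw [e]; exact hg⟩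
    · exact ⟨(-g : P.X (n + 1 + m) ⟶ Q), by
        rw [e]; exact (Preadditive.neg_comp_neg _ _).trans hg⟩

/-- The definition only looks at degrees `-1` and `0`; any other differential is moved there by a
shift, whose sign does not change the image. -/
lemma IsTotallyAcyclic.gorensteinProjective_image {P : CochainComplex C ℤ}
    (h : IsTotallyAcyclic P) (i j : ℤ) (hij : i + 1 = j) :
    gorensteinProjective C (image (P.d i j)) := by
  obtain ⟨k, rfl⟩ : ∃ k, i = -1 + k := ⟨i + 1, by lia⟩
  obtain rfl : j = 0 + k := by lia
  refine ⟨_, h.shift_int k, ?_⟩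
  rcases shift_negOnePow_d P k (-1) 0 with e | e
  · have : ∀ f g : P.X (-1 + k) ⟶ P.X (0 + k), f = g → Nonempty (image f ≅ image g) := by
      rintro f _ rfl
      exact ⟨Iso.refl _⟩
    exact this _ _ e.symm
  · exact nonempty_image_iso_of_eq_neg (P.d (-1 + k) (0 + k)) _ e

lemma HomologicalComplex_image_ι_comp_factorThruImage (P : CochainComplex C ℤ) (i j k : ℤ) :
    image.ι (P.d i j) ≫ factorThruImage (P.d j k) = 0 := by
  rw [← cancel_epi (factorThruImage (P.d i j)), ← cancel_mono (image.ι (P.d j k))]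
  simp

/-- The short complex `im dⁱ ⟶ Pʲ ⟶ im dʲ`. -/
abbrev imageShortComplex (P : CochainComplex C ℤ) (i j k : ℤ) : ShortComplex C :=
  ShortComplex.mk _ _ (HomologicalComplex_image_ι_comp_factorThruImage P i j k)

lemma imageShortComplex_shortExact {P : CochainComplex C ℤ} {i j k : ℤ} (hij : i + 1 = j)
    (hjk : j + 1 = k) (h : P.ExactAt j) : (imageShortComplex P i j k).ShortExact := by
  have hex : (ShortComplex.mk (P.d i j) (P.d j k) (by simp)).Exact :=
    (P.exactAt_iff' i j k (by simp; lia) (by simp [hjk])).1 h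
  have w : P.d i j ≫ factorThruImage (P.d j k) = 0 := by
    rw [← cancel_mono (image.ι (P.d j k))]; simp
  let φ : ShortComplex.mk (P.d i j) (factorThruImage (P.d j k)) w ⟶
      ShortComplex.mk (P.d i j) (P.d j k) (by simp) :=
    { τ₁ := 𝟙 _, τ₂ := 𝟙 _, τ₃ := image.ι _ }
  let ψ : ShortComplex.mk (P.d i j) (factorThruImage (P.d j k)) w ⟶ imageShortComplex P i j k :=
    { τ₁ := factorThruImage _, τ₂ := 𝟙 _, τ₃ := 𝟙 _ }
  have h₁ := (ShortComplex.exact_iff_of_epi_of_isIso_of_mono φ).2 hex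
  have : Epi ψ.τ₁ := by dsimp [ψ]; infer_instance
  exact { exact := (ShortComplex.exact_iff_of_epi_of_isIso_of_mono ψ).1 h₁
          mono_f := by dsimp; infer_instance
          epi_g := by dsimp; infer_instance }

lemma IsTotallyAcyclic.extend_image {P : CochainComplex C ℤ} (h : IsTotallyAcyclic P)
    (i j : ℤ) (hij : i + 1 = j) (Q : C) [Projective Q] (f : image (P.d i j) ⟶ Q) :
    ∃ g : P.X j ⟶ Q, image.ι (P.d i j) ≫ g = f := by
  obtain ⟨g, hg⟩ := h.hom_exact' Q (i - 1) i j (by lia) hij (factorThruImage (P.d i j) ≫ f) (by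
    have : P.d (i - 1) i ≫ factorThruImage (P.d i j) = 0 := by
      rw [← cancel_mono (image.ι (P.d i j))]; simp
    rw [reassoc_of% this, zero_comp])
  refine ⟨g, ?_⟩
  rw [← cancel_epi (factorThruImage (P.d i j)), ← hg]
  simp

/-- Every Gorenstein projective object is the cokernel of a cosyzygy sequence. -/
lemma exists_syzygy {Y : C} (hY : gorensteinProjective C Y) :
    ∃ S : ShortComplex C, S.ShortExact ∧ gorensteinProjective C S.X₁ ∧ Projective S.X₂ ∧
      (∀ (Q : C) [Projective Q] (f : S.X₁ ⟶ Q), ∃ g, S.f ≫ g = f) ∧ Nonempty (S.X₃ ≅ Y) := by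
  obtain ⟨P, hP, ⟨e⟩⟩ := hY
  exact ⟨imageShortComplex P (-2) (-1) 0,
    imageShortComplex_shortExact (by lia) (by lia) (hP.acyclic _),
    hP.gorensteinProjective_image _ _ (by lia), hP.projective _,
    fun Q _ f => hP.extend_image _ _ (by lia) Q f, ⟨e.symm⟩⟩

lemma exists_cosyzygy {Y : C} (hY : gorensteinProjective C Y) :
    ∃ (P Z : C) (f : Y ⟶ P) (g : P ⟶ Z) (w : f ≫ g = 0), (ShortComplex.mk f g w).ShortExact ∧
      Projective P ∧ gorensteinProjective C Z := by
  obtain ⟨c⟩ : Nonempty (Cosyzygy (⟨Y, hY⟩ : GProj C)) := inferInstance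
  exact ⟨c.I, c.S.obj, c.ι, c.π, c.zero, c.shortExact, c.projective, c.S.property⟩

/-- The smallest class of objects that contains the projective objects and the cokernels of
monomorphisms between its members. -/
inductive FinProjDim : C → Prop
  | of_projective (P : C) (h : Projective P) : FinProjDim P
  | of_shortExact (S : ShortComplex C) (hS : S.ShortExact) (h₁ : FinProjDim S.X₁)
      (h₂ : FinProjDim S.X₂) : FinProjDim S.X₃

/-- The sequence `0 → 0 → X → Y → 0` presents `Y` as a cokernel, so closure under isomorphism need
not be a constructor. -/
lemma FinProjDim.of_iso {X Y : C} (e : X ≅ Y) (h : FinProjDim X) : FinProjDim Y :=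
  FinProjDim.of_shortExact (ShortComplex.mk (0 : 0 ⟶ X) e.hom zero_comp)
    { exact := (ShortComplex.exact_iff_mono _ rfl).2 (by dsimp; infer_instance)
      mono_f := by dsimp; infer_instance
      epi_g := by dsimp; infer_instance } (.of_projective _ inferInstance) h

-- Dimension shifting along syzygies. In degree one, a class is the connecting image of a map from
-- the syzygy to `Q`; that map extends to the projective middle term by total acyclicity, so the
-- class is zero.
open Abelian in
lemma ext_eq_zero_of_projective [HasExt.{w} C] (Q : C) [Projective Q] (n : ℕ) :
    ∀ (Y : C) (_ : gorensteinProjective C Y) (x : Ext Y Q (n + 1)), x = 0 := by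
  induction n with
  | zero =>
    intro Y hY x
    obtain ⟨S, hS, -, hP, hext, ⟨e⟩⟩ := exists_syzygy hY
    suffices (Ext.mk₀ e.hom).comp x (zero_add _) = 0 by
      rw [← Ext.mk₀_id_comp x, ← e.inv_hom_id, ← Ext.mk₀_comp_mk₀_assoc, this, Ext.comp_zero]
    obtain ⟨y, hy⟩ := Ext.contravariant_sequence_exact₃ hS Q
      ((Ext.mk₀ e.hom).comp x (zero_add _)) (Ext.eq_zero_of_projective _) (n₀ := 0) rfl
    obtain ⟨f, rfl⟩ := (Ext.mk₀_bijective _ _).surjective y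
    obtain ⟨g, rfl⟩ := hext Q f
    rw [← hy, ← Ext.mk₀_comp_mk₀,
      ← Ext.comp_assoc _ _ _ (add_zero 1) (zero_add 0) (by lia),
      ShortComplex.ShortExact.extClass_comp, Ext.zero_comp]
  | succ n ih =>
    intro Y hY x
    obtain ⟨S, hS, h₁, hP, -, ⟨e⟩⟩ := exists_syzygy hY
    suffices (Ext.mk₀ e.hom).comp x (zero_add _) = 0 by
      rw [← Ext.mk₀_id_comp x, ← e.inv_hom_id, ← Ext.mk₀_comp_mk₀_assoc, this, Ext.comp_zero]
    obtain ⟨y, hy⟩ := Ext.contravariant_sequence_exact₃ hS Q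
      ((Ext.mk₀ e.hom).comp x (zero_add _)) (Ext.eq_zero_of_projective _) (n₀ := n + 1)
        (add_comm _ _)
    rw [← hy, ih _ h₁ y, Ext.comp_zero]

-- For a cokernel `X₃` of `X₁ → X₂`, the group `Ext^{n+1}(Y, X₃)` lies between `Ext^{n+1}(Y, X₂)`
-- and `Ext^{n+2}(Y, X₁)`. The induction is therefore over all degrees at once.
open Abelian in
lemma FinProjDim.ext_eq_zero [HasExt.{w} C] {R : C} (h : FinProjDim R) :
    ∀ (n : ℕ) (Y : C) (_ : gorensteinProjective C Y) (x : Ext Y R (n + 1)), x = 0 := by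
  induction h with
  | of_projective P h => exact fun n => ext_eq_zero_of_projective P n
  | of_shortExact S hS _ _ h₁ h₂ =>
    intro n Y hY x
    obtain ⟨y, rfl⟩ := Ext.covariant_sequence_exact₃ Y hS x rfl (h₁ _ Y hY _)
    rw [h₂ _ Y hY y, Ext.zero_comp]

/-- Morphisms to an object of finite projective dimension extend along a monomorphism with
Gorenstein projective cokernel. -/
lemma FinProjDim.exists_extension {R : C} (h : FinProjDim R) {S : ShortComplex C}
    (hS : S.ShortExact) (h₃ : gorensteinProjective C S.X₃) (f : S.X₁ ⟶ R) :
    ∃ g : S.X₂ ⟶ R, S.f ≫ g = f := by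
  let _ : HasExt.{max u v} C := HasExt.standard C
  obtain ⟨x, hx⟩ := Abelian.Ext.contravariant_sequence_exact₁ hS R (Abelian.Ext.mk₀ f)
    (n₁ := 1) rfl (h.ext_eq_zero 0 _ h₃ _)
  obtain ⟨g, rfl⟩ := (Abelian.Ext.mk₀_bijective _ _).surjective x
  rw [Abelian.Ext.mk₀_comp_mk₀] at hx
  exact ⟨g, (Abelian.Ext.mk₀_bijective _ _).injective hx⟩

/-- Morphisms from a Gorenstein projective object lift along an epimorphism whose kernel has finite
projective dimension. -/
lemma FinProjDim.exists_lift {S : ShortComplex C} (hS : S.ShortExact) (h₁ : FinProjDim S.X₁)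
    {Y : C} (hY : gorensteinProjective C Y) (f : Y ⟶ S.X₃) : ∃ g : Y ⟶ S.X₂, g ≫ S.g = f := by
  let _ : HasExt.{max u v} C := HasExt.standard C
  obtain ⟨x, hx⟩ := Abelian.Ext.covariant_sequence_exact₃ Y hS (Abelian.Ext.mk₀ f)
    (n₁ := 1) rfl (h₁.ext_eq_zero 0 _ hY _)
  obtain ⟨g, rfl⟩ := (Abelian.Ext.mk₀_bijective _ _).surjective x
  rw [Abelian.Ext.mk₀_comp_mk₀] at hx
  exact ⟨g, (Abelian.Ext.mk₀_bijective _ _).injective hx⟩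

/-- `Y` embeds in a projective with Gorenstein projective cokernel, and the map to `R` extends along
this embedding. This is what makes maps into such `R` stably trivial. -/
lemma FinProjDim.exists_factor {R : C} (h : FinProjDim R) {Y : C}
    (hY : gorensteinProjective C Y) (f : Y ⟶ R) :
    ∃ (Q : C) (_ : Projective Q) (a : Y ⟶ Q) (b : Q ⟶ R), a ≫ b = f := by
  obtain ⟨P, Z, i, p, w, hS, hP, hZ⟩ := exists_cosyzygy hY
  obtain ⟨g, hg⟩ := h.exists_extension hS hZ f
  exact ⟨P, hP, i, g, hg⟩

end Gorenstein

section Balance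

variable {C : Type u} [Category.{v} C] [Abelian C]

/-- In a diagram with exact rows `Aᵢ ⟶ Bᵢ ⟶ Cᵢ` and exact columns, a monomorphism criterion for the
map between the cokernels of the rows. -/
lemma mono_of_ladder {A₁ A₂ A₃ B₁ B₂ B₃ C₁ C₂ : C} {a : A₁ ⟶ A₂} {a' : A₂ ⟶ A₃} {b : B₁ ⟶ B₂}
    {b' : B₂ ⟶ B₃} {c : C₁ ⟶ C₂} {f₁ : A₁ ⟶ B₁} {f₂ : A₂ ⟶ B₂} {f₃ : A₃ ⟶ B₃} {g₁ : B₁ ⟶ C₁}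
    {g₂ : B₂ ⟶ C₂} (wa : a ≫ a' = 0) (wb : b ≫ b' = 0) (w₁ : f₁ ≫ g₁ = 0) (w₂ : f₂ ≫ g₂ = 0)
    [Epi a'] (hb : (ShortComplex.mk b b' wb).Exact) (h₁ : (ShortComplex.mk f₁ g₁ w₁).Exact)
    [Mono f₂] [Mono c] (e₁ : a ≫ f₂ = f₁ ≫ b) (e₂ : a' ≫ f₃ = f₂ ≫ b') (e₃ : b ≫ g₂ = g₁ ≫ c) :
    Mono f₃ := by
  rw [Preadditive.mono_iff_cancel_zero]
  intro T x hx
  obtain ⟨T₁, p₁, _, y, hy⟩ := surjective_up_to_refinements_of_epi a' x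
  obtain ⟨T₂, p₂, _, z, hz⟩ := hb.exact_up_to_refinements (y ≫ f₂) (by
    dsimp
    rw [Category.assoc, ← e₂, ← reassoc_of% hy, hx, comp_zero])
  dsimp at hz
  obtain ⟨T₃, p₃, _, t, ht⟩ := h₁.exact_up_to_refinements z (by
    dsimp
    rw [← cancel_mono c, Category.assoc, ← e₃, ← reassoc_of% hz, w₂]
    simp)
  dsimp at ht
  have key : p₃ ≫ p₂ ≫ y = t ≫ a := by
    rw [← cancel_mono f₂]
    simp only [Category.assoc, hz, e₁, reassoc_of% ht]
  rw [← cancel_epi p₁, ← cancel_epi p₂, ← cancel_epi p₃, hy, reassoc_of% key, wa]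
  simp

end Balance

end CategoryTheory

end

noncomputable section

namespace CategoryTheory

/-! ### Right exact functors that are exact on sequences with Gorenstein projective cokernel. -/

section ExactOnGProj

variable {C : Type u} [Category.{v} C] [Abelian C] {D : Type u'} [Category.{v'} D] [Abelian D]

/-- `T` sends monomorphisms with Gorenstein projective cokernel to monomorphisms. -/
def ExactOnGProj (T : C ⥤ D) : Prop :=
  ∀ S : ShortComplex C, S.ShortExact → gorensteinProjective C S.X₃ → Mono (T.map S.f)

namespace ExactOnGProj

lemma of_preservesMonomorphisms (T : C ⥤ D) [T.PreservesMonomorphisms] : ExactOnGProj T :=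
  fun S hS _ => by
    have := hS.mono_f
    infer_instance

lemma of_iso {T T' : C ⥤ D} (e : T ≅ T') (h : ExactOnGProj T) : ExactOnGProj T' :=
  fun S hS h₃ => by
    have := h S hS h₃
    rw [← NatIso.naturality_1 e S.f]
    infer_instance

lemma of_isZero {T : C ⥤ D} (h : ∀ X, IsZero (T.obj X)) : ExactOnGProj T :=
  fun S _ _ => ⟨fun _ _ _ => (h S.X₁).eq_of_tgt _ _⟩

lemma comp {E : Type*} [Category E] [Abelian E] {T : C ⥤ D} (h : ExactOnGProj T) (T' : D ⥤ E)
    [T'.PreservesMonomorphisms] : ExactOnGProj (T ⋙ T') :=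
  fun S hS h₃ => by
    have := h S hS h₃
    dsimp
    infer_instance

/-- Embed `Y` in a projective `P` with Gorenstein projective cokernel. The composite `T₁ Y → T₁ P →
T₂ P` is a monomorphism and factors through `a.app Y`. -/
lemma mono_app {T₁ T₂ : C ⥤ D} (h₁ : ExactOnGProj T₁) (a : T₁ ⟶ T₂)
    (hP : ∀ (P : C) [Projective P], Mono (a.app P)) {Y : C} (hY : gorensteinProjective C Y) :
    Mono (a.app Y) := by
  obtain ⟨P, Z, f, g, w, hS, _, hZ⟩ := exists_cosyzygy hY
  have : Mono (T₁.map f) := h₁ _ hS hZ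
  have := hP P
  have : Mono (a.app Y ≫ T₂.map f) := by
    rw [← a.naturality]
    infer_instance
  exact mono_of_mono _ (T₂.map f)

/-- The induction step of all later descending inductions, playing the role of a long exact Tor
sequence. By `mono_app` the map `T₁ → T₂` is injective at the Gorenstein projective `S.X₃`, which is
what the ladder of the three images of `S` requires. -/
lemma cokernel {T₁ T₂ T₃ : C ⥤ D} [T₁.Additive] [PreservesFiniteColimits T₁]
    (h₁ : ExactOnGProj T₁) (h₂ : ExactOnGProj T₂) [T₂.PreservesZeroMorphisms]
    (a : T₁ ⟶ T₂) (b : T₂ ⟶ T₃) (w : ∀ X, a.app X ≫ b.app X = 0)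
    (hex : ∀ X, (ShortComplex.mk _ _ (w X)).Exact) (hepi : ∀ X, Epi (b.app X))
    (hP : ∀ (P : C) [Projective P], Mono (a.app P)) : ExactOnGProj T₃ := by
  intro S hS h₃
  have := h₂ S hS h₃
  have := h₁.mono_app a hP h₃
  have := hepi S.X₁
  exact mono_of_ladder (w _) (w _) (f₁ := T₁.map S.f) (g₁ := T₁.map S.g) (f₂ := T₂.map S.f)
    (g₂ := T₂.map S.g) (c := a.app S.X₃) (by rw [← T₁.map_comp, S.zero, T₁.map_zero])
    (by rw [← T₂.map_comp, S.zero, T₂.map_zero]) (hex S.X₂)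
    ((Functor.preservesFiniteColimits_iff_forall_exact_map_and_epi T₁).1 inferInstance S hS).1
    (a.naturality _).symm (b.naturality _).symm (a.naturality _).symm

lemma map_shortExact {T : C ⥤ D} [T.Additive] [PreservesFiniteColimits T] (h : ExactOnGProj T)
    {S : ShortComplex C} (hS : S.ShortExact) (h₃ : gorensteinProjective C S.X₃) :
    (S.map T).ShortExact := by
  have := (Functor.preservesFiniteColimits_iff_forall_exact_map_and_epi T).1 inferInstance S hS
  exact { exact := this.1, mono_f := h S hS h₃, epi_g := this.2 }

end ExactOnGProj

/-- A cocycle factors through the image of the differential out of `P.X n`, and extends from there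
because the next image is Gorenstein projective. This widens the targets in total acyclicity from
projectives to finite projective dimension. -/
lemma FinProjDim.hom_exact {R : C} (hR : FinProjDim R) {P : CochainComplex C ℤ}
    (hP : IsTotallyAcyclic P) (n : ℤ) (f : P.X n ⟶ R) (hf : P.d (n - 1) n ≫ f = 0) :
    ∃ g : P.X (n + 1) ⟶ R, P.d n (n + 1) ≫ g = f := by
  have hS := imageShortComplex_shortExact (i := n - 1) (k := n + 1) (by lia) rfl (hP.acyclic n)
  have : Epi (imageShortComplex P (n - 1) n (n + 1)).g := hS.epi_g
  have w : image.ι (P.d (n - 1) n) ≫ f = 0 := by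
    rw [← cancel_epi (factorThruImage (P.d (n - 1) n))]
    simpa using hf
  have h₁ := hS.exact.g_desc f w
  obtain ⟨g, hg⟩ := hR.exists_extension
    (imageShortComplex_shortExact (i := n) (k := n + 1 + 1) rfl rfl (hP.acyclic (n + 1)))
    (hP.gorensteinProjective_image _ _ rfl) (hS.exact.desc f w)
  refine ⟨g, ?_⟩
  dsimp at hg h₁
  rw [← image.fac (P.d n (n + 1)), Category.assoc, hg, h₁]

variable {T : C ⥤ D} [T.Additive]

lemma FinProjDim.map_hom_exact {R : D ⥤ C} (adj : T ⊣ R) {Q : D} (hR : FinProjDim (R.obj Q))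
    {P : CochainComplex C ℤ} (hP : IsTotallyAcyclic P) (n : ℤ) (f : T.obj (P.X n) ⟶ Q)
    (hf : T.map (P.d (n - 1) n) ≫ f = 0) :
    ∃ g : T.obj (P.X (n + 1)) ⟶ Q, T.map (P.d n (n + 1)) ≫ g = f := by
  have := adj.right_adjoint_additive
  obtain ⟨g, hg⟩ := hR.hom_exact hP n (adj.homEquiv _ _ f) (by
    rw [← adj.homEquiv_naturality_left, hf, adj.homEquiv_unit, Functor.map_zero, comp_zero])
  exact ⟨(adj.homEquiv _ _).symm g, by
    rw [← adj.homEquiv_naturality_left_symm, hg, Equiv.symm_apply_apply]⟩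

namespace ExactOnGProj

variable (hT : ExactOnGProj T)
include hT

lemma mono_map_image_ι {P : CochainComplex C ℤ} (hP : IsTotallyAcyclic P) (i j : ℤ)
    (hij : i + 1 = j) : Mono (T.map (image.ι (P.d i j))) :=
  hT _ (imageShortComplex_shortExact (k := j + 1) hij rfl (hP.acyclic j))
    (hP.gorensteinProjective_image _ _ rfl)

variable [PreservesFiniteColimits T]

/-- `T` keeps each factorisation of a differential as an epimorphism followed by a monomorphism, so
the short exact sequences of images splice back together after `T`. -/
lemma map_d_exact {P : CochainComplex C ℤ} (hP : IsTotallyAcyclic P) (i j k : ℤ)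
    (hij : i + 1 = j) (hjk : j + 1 = k) (w : T.map (P.d i j) ≫ T.map (P.d j k) = 0) :
    (ShortComplex.mk _ _ w).Exact := by
  have h₁ : (ShortComplex.mk (T.map (image.ι (P.d i j))) (T.map (factorThruImage (P.d j k))) (by
      rw [← T.map_comp, HomologicalComplex_image_ι_comp_factorThruImage, T.map_zero])).Exact :=
    (hT.map_shortExact (imageShortComplex_shortExact hij hjk (hP.acyclic j))
      (hP.gorensteinProjective_image _ _ hjk)).exact
  have := hT.mono_map_image_ι hP j k hjk
  rw [ShortComplex.exact_iff_exact_up_to_refinements] at h₁ ⊢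
  intro A x hx
  dsimp at x hx h₁
  obtain ⟨A₁, p, _, y, hy⟩ := h₁ x (by
    rw [← cancel_mono (T.map (image.ι (P.d j k))), Category.assoc, ← T.map_comp, image.fac, hx,
      zero_comp])
  obtain ⟨A₂, p', _, z, hz⟩ := surjective_up_to_refinements_of_epi
    (T.map (factorThruImage (P.d i j))) y
  refine ⟨A₂, p' ≫ p, inferInstance, z, ?_⟩
  dsimp
  rw [Category.assoc, hy, reassoc_of% hz, ← T.map_comp, image.fac]

/-- The `Hom` condition is the only one not about `T` alone: `Hom(T P, Q) = Hom(P, R Q)`, which is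
exact since `R Q` has finite projective dimension. -/
lemma isTotallyAcyclic_map (hproj : ∀ (P : C) [Projective P], Projective (T.obj P))
    {R : D ⥤ C} (adj : T ⊣ R) (hR : ∀ (Q : D) [Projective Q], FinProjDim (R.obj Q))
    {P : CochainComplex C ℤ} (hP : IsTotallyAcyclic P) :
    IsTotallyAcyclic ((T.mapHomologicalComplex (ComplexShape.up ℤ)).obj P) where
  projective n := by
    have := hP.projective n
    exact hproj _
  acyclic j := by
    rw [HomologicalComplex.exactAt_iff' _ (j - 1) j (j + 1) (by simp) (by simp)]
    exact hT.map_d_exact hP (j - 1) j (j + 1) (by lia) rfl _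
  hom_exact Q _ n f hf := (hR Q).map_hom_exact adj hP n f hf

lemma gorensteinProjective_map (hproj : ∀ (P : C) [Projective P], Projective (T.obj P))
    {R : D ⥤ C} (adj : T ⊣ R) (hR : ∀ (Q : D) [Projective Q], FinProjDim (R.obj Q)) {Y : C}
    (hY : gorensteinProjective C Y) : gorensteinProjective D (T.obj Y) := by
  obtain ⟨P, hP, ⟨e⟩⟩ := hY
  have := hT.mono_map_image_ι hP (-1) 0 (by lia)
  have : Epi (T.map (factorThruImage (P.d (-1) 0))) := inferInstance
  have := strongEpi_of_epi (T.map (factorThruImage (P.d (-1) 0)))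
  exact ⟨_, hT.isTotallyAcyclic_map hproj adj hR hP, ⟨T.mapIso e ≪≫
    image.isoStrongEpiMono (T.map (factorThruImage (P.d (-1) 0))) (T.map (image.ι _))
      (f := T.map (P.d (-1) 0)) (by rw [← T.map_comp, image.fac])⟩⟩

end ExactOnGProj

end ExactOnGProj

/-! ### Triangle functors between stable categories induced by additive functors. -/

section StableFunctor

variable {C : Type u} [Category.{v} C] [Abelian C] {D : Type u'} [Category.{v'} D] [Abelian D]

lemma StableGProj.proj_map_eq {X Y : GProj C} {f g : X ⟶ Y} (h : stableRel C f g) :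
    (StableGProj.proj C).map f = (StableGProj.proj C).map g :=
  Quotient.sound _ h

lemma StableGProj.stableRel_of_map_eq {X Y : GProj C} {f g : X ⟶ Y}
    (h : (StableGProj.proj C).map f = (StableGProj.proj C).map g) : stableRel C f g :=
  (Quotient.functor_map_eq_iff _ f g).1 h

lemma stableRel_refl {X Y : GProj C} (f : X ⟶ Y) : stableRel C f f :=
  Congruence.equivalence.refl f

namespace Cosyzygy

variable {X Y Z : GProj C}

/-- The morphism in the stable category between cosyzygies of `X` and `Y` induced by `X ⟶ Y`. -/
def mapStable (c : Cosyzygy X) (c' : Cosyzygy Y) (f : X ⟶ Y) :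
    (StableGProj.proj C).obj c.S ⟶ (StableGProj.proj C).obj c'.S :=
  (StableGProj.proj C).map (c.exists_map c' f).choose_spec.choose

/-- The chosen lift in `mapStable` is irrelevant: any lift, of any stably equal map, computes it. -/
lemma mapStable_eq (c : Cosyzygy X) (c' : Cosyzygy Y) {f f' : X ⟶ Y} (hf : stableRel C f f')
    {g : c.I ⟶ c'.I} {s : c.S ⟶ c'.S} (hg : c.ι ≫ g = f'.hom ≫ c'.ι)
    (hs : c.π ≫ s.hom = g ≫ c'.π) : c.mapStable c' f = (StableGProj.proj C).map s :=
  have h := (c.exists_map c' f).choose_spec.choose_spec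
  StableGProj.proj_map_eq (c.map_unique c' hf h.1 hg h.2 hs)

lemma exists_mapStable_eq (c : Cosyzygy X) (c' : Cosyzygy Y) (f : X ⟶ Y) :
    ∃ (g : c.I ⟶ c'.I) (s : c.S ⟶ c'.S), c.ι ≫ g = f.hom ≫ c'.ι ∧ c.π ≫ s.hom = g ≫ c'.π ∧
      c.mapStable c' f = (StableGProj.proj C).map s :=
  have h := (c.exists_map c' f).choose_spec.choose_spec
  ⟨_, _, h.1, h.2, rfl⟩

lemma mapStable_comp (c : Cosyzygy X) (c' : Cosyzygy Y) (c'' : Cosyzygy Z) (f : X ⟶ Y)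
    (g : Y ⟶ Z) : c.mapStable c' f ≫ c'.mapStable c'' g = c.mapStable c'' (f ≫ g) := by
  obtain ⟨a, s, ha, hs, h⟩ := c.exists_mapStable_eq c' f
  obtain ⟨a', s', ha', hs', h'⟩ := c'.exists_mapStable_eq c'' g
  rw [h, h', ← Functor.map_comp]
  refine (c.mapStable_eq c'' (stableRel_refl _) (g := a ≫ a') ?_ ?_).symm
  · rw [reassoc_of% ha, ha']; simp
  · rw [ObjectProperty.FullSubcategory.comp_hom, reassoc_of% hs, hs', Category.assoc]

lemma mapStable_id (c : Cosyzygy X) : c.mapStable c (𝟙 X) = 𝟙 _ := by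
  rw [c.mapStable_eq c (stableRel_refl _) (g := 𝟙 _) (s := 𝟙 _) (by simp) (by simp)]
  exact (StableGProj.proj C).map_id _

/-- Cosyzygies of isomorphic objects are isomorphic in the stable category. -/
@[simps]
def mapStableIso (c : Cosyzygy X) (c' : Cosyzygy Y) (f : X ≅ Y) :
    (StableGProj.proj C).obj c.S ≅ (StableGProj.proj C).obj c'.S where
  hom := c.mapStable c' f.hom
  inv := c'.mapStable c f.inv
  hom_inv_id := by rw [mapStable_comp, f.hom_inv_id, mapStable_id]
  inv_hom_id := by rw [mapStable_comp, f.inv_hom_id, mapStable_id]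

end Cosyzygy

variable (T : C ⥤ D) [T.Additive]

/-- `T` preserves Gorenstein projective objects, projective objects, and short exact sequences with
Gorenstein projective cokernel. -/
structure PreservesGProj : Prop where
  gorenstein {Y : C} (hY : gorensteinProjective C Y) : gorensteinProjective D (T.obj Y)
  projective (P : C) [Projective P] : Projective (T.obj P)
  shortExact {S : ShortComplex C} (hS : S.ShortExact) (h₃ : gorensteinProjective C S.X₃) :
    (S.map T).ShortExact

namespace PreservesGProj

variable {T} (h : PreservesGProj T)
include h

/-- The functor between categories of Gorenstein projectives induced by `T`. -/
abbrev functorGProj : GProj C ⥤ GProj D :=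
  ObjectProperty.lift _ (ObjectProperty.ι _ ⋙ T) (fun X => h.gorenstein X.property)

lemma stableRel_map {X Y : GProj C} {f g : X ⟶ Y} (hfg : stableRel C f g) :
    stableRel D (h.functorGProj.map f) (h.functorGProj.map g) := by
  obtain ⟨Q, _, a, b, e⟩ := hfg
  exact ⟨T.obj Q, h.projective Q, T.map a, T.map b,
    (T.map_sub (f := f.hom) (g := g.hom)).symm.trans ((congrArg T.map e).trans (T.map_comp a b))⟩

/-- The functor between stable categories induced by `T`. -/
abbrev functor : StableGProj C ⥤ StableGProj D :=
  Quotient.lift _ (h.functorGProj ⋙ StableGProj.proj D)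
    (fun _ _ _ _ hfg => StableGProj.proj_map_eq (h.stableRel_map hfg))

lemma functor_map_proj_map {X Y : GProj C} (f : X ⟶ Y) :
    h.functor.map ((StableGProj.proj C).map f) =
      (StableGProj.proj D).map (h.functorGProj.map f) := rfl

lemma functor_additive : h.functor.Additive where
  map_add {X Y f g} := by
    obtain ⟨f, rfl⟩ := (StableGProj.proj C).map_surjective f
    obtain ⟨g, rfl⟩ := (StableGProj.proj C).map_surjective g
    change (StableGProj.proj D).map (h.functorGProj.map (f + g)) =
      (StableGProj.proj D).map (h.functorGProj.map f + h.functorGProj.map g)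
    congr 1
    ext
    exact T.map_add

/-- The image under `T` of a cosyzygy sequence. -/
abbrev mapCosyzygy {X : GProj C} (c : Cosyzygy X) : Cosyzygy (h.functorGProj.obj X) where
  I := T.obj c.I
  S := h.functorGProj.obj c.S
  ι := T.map c.ι
  π := T.map c.π
  zero := (T.map_comp c.ι c.π).symm.trans ((congrArg T.map c.zero).trans (T.map_zero _ _))
  shortExact := h.shortExact c.shortExact c.S.property
  projective := by
    have := c.projective
    exact h.projective c.I
  -- The cokernel is again Gorenstein projective, so its `Ext¹` into the projective `Q` vanishes and
  -- maps to `Q` extend; no further condition on `T` is needed here.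
  extend Q _ f := (FinProjDim.of_projective Q ‹_›).exists_extension
    (h.shortExact c.shortExact c.S.property) (h.functorGProj.obj c.S).property f

lemma functor_map_mapStable {X Y : GProj C} (c : Cosyzygy X) (c' : Cosyzygy Y) (f : X ⟶ Y) :
    h.functor.map (c.mapStable c' f) =
      (h.mapCosyzygy c).mapStable (h.mapCosyzygy c') (h.functorGProj.map f) := by
  obtain ⟨a, s, ha, hs, e⟩ := c.exists_mapStable_eq c' f
  rw [e, functor_map_proj_map]
  refine (Cosyzygy.mapStable_eq (h.mapCosyzygy c) (h.mapCosyzygy c') (stableRel_refl _)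
    (g := T.map a) ?_ ?_).symm
  · exact (T.map_comp _ _).symm.trans ((congrArg T.map ha).trans (T.map_comp _ _))
  · exact (T.map_comp _ _).symm.trans ((congrArg T.map hs).trans (T.map_comp _ _))

/-- The comparison of `T` of a cosyzygy with a cosyzygy of the image under `T`. -/
def suspIso : StableGProj.susp C ⋙ h.functor ≅ h.functor ⋙ StableGProj.susp D :=
  NatIso.ofComponents (fun X => (h.mapCosyzygy X.as.cosyzygy).mapStableIso
      (h.functorGProj.obj X.as).cosyzygy (Iso.refl _)) (by
    intro X Y f
    obtain ⟨f, rfl⟩ := (StableGProj.proj C).map_surjective f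
    refine (congrArg (fun z => z ≫ (h.mapCosyzygy Y.as.cosyzygy).mapStable
      (h.functorGProj.obj Y.as).cosyzygy (𝟙 _))
      (h.functor_map_mapStable X.as.cosyzygy Y.as.cosyzygy f)).trans ?_
    refine (Cosyzygy.mapStable_comp _ _ _ _ _).trans (Eq.trans ?_
      (Cosyzygy.mapStable_comp _ _ _ _ (h.functorGProj.map f)).symm)
    simp)

lemma map_comp_suspIso_hom_app {A B X Z : StableGProj C} (p : B ⟶ (StableGProj.susp C).obj A)
    (a : A ≅ X) (c : B ≅ Z) (k : Z ⟶ (StableGProj.susp C).obj X)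
    (e : p ≫ (StableGProj.susp C).map a.hom = c.hom ≫ k) :
    (h.functor.map p ≫ h.suspIso.hom.app A) ≫ (StableGProj.susp D).map (h.functor.map a.hom) =
      h.functor.map c.hom ≫ h.functor.map k ≫ h.suspIso.hom.app X := by
  have hnat := h.suspIso.hom.naturality a.hom
  dsimp only [Functor.comp_map, Functor.comp_obj] at hnat ⊢
  rw [Category.assoc, ← hnat, ← Functor.map_comp_assoc, e, Functor.map_comp_assoc]

/-- The image of a standard triangle is built on the image under `T` of the chosen cosyzygy
sequence; composing with the comparison to the chosen cosyzygy of the image object makes it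
standard, and that comparison is exactly `suspIso`. -/
lemma map_distinguished {X Y Z : StableGProj C} (f : X ⟶ Y) (g : Y ⟶ Z)
    (k : Z ⟶ (StableGProj.susp C).obj X) (hd : StableGProj.IsDistinguished f g k) :
    StableGProj.IsDistinguished (h.functor.map f) (h.functor.map g)
      (h.functor.map k ≫ h.suspIso.hom.app X) := by
  obtain ⟨A, B, D', u, v, zero, hS, t, w, ht, hw, a, b, c, h₁, h₂, h₃⟩ := hd
  have hS' := h.shortExact hS D'.property
  -- `r` and `s` compare `T` of the cosyzygy sequence of `A` with the chosen cosyzygy sequence of `T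
  -- A`; the witnesses below are `t` and `w` corrected by them.
  obtain ⟨r, s, hr, hs, e⟩ := (h.mapCosyzygy A.cosyzygy).exists_mapStable_eq
    (h.functorGProj.obj A).cosyzygy (𝟙 _)
  refine ⟨_, _, _, h.functorGProj.map u, h.functorGProj.map v, _, hS', T.map t ≫ r,
    h.functorGProj.map w ≫ s, ?_, ?_, h.functor.mapIso a, h.functor.mapIso b,
    h.functor.mapIso c, ?_, ?_, ?_⟩
  · change T.map u.hom ≫ T.map t ≫ r = _
    rw [← Functor.map_comp_assoc, ht]
    exact hr.trans (Category.id_comp _)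
  · change T.map v.hom ≫ T.map w.hom ≫ s.hom = _
    rw [← Functor.map_comp_assoc, hw, Functor.map_comp, Category.assoc, Category.assoc]
    exact congrArg (T.map t ≫ ·) hs
  · rw [← functor_map_proj_map, Functor.mapIso_hom, Functor.mapIso_hom, ← Functor.map_comp, h₁,
      Functor.map_comp]
  · rw [← functor_map_proj_map, Functor.mapIso_hom, Functor.mapIso_hom, ← Functor.map_comp, h₂,
      Functor.map_comp]
  · have hw' : (StableGProj.proj D).map (h.functorGProj.map w ≫ s) =
        h.functor.map ((StableGProj.proj C).map w) ≫
          h.suspIso.hom.app ((StableGProj.proj C).obj A) :=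
      ((StableGProj.proj D).map_comp _ _).trans
        (congrArg (h.functor.map ((StableGProj.proj C).map w) ≫ ·) e.symm)
    refine (congrArg (· ≫ _) hw').trans ?_
    exact h.map_comp_suspIso_hom_app _ a c k h₃

/-- The triangle functor between stable categories induced by `T`. -/
@[simps functor suspIso]
def stableTriangleFunctor : StableTriangleFunctor C D where
  functor := h.functor
  additive := h.functor_additive
  suspIso := h.suspIso
  map_distinguished := h.map_distinguished

end PreservesGProj

end StableFunctor

end CategoryTheory

end

noncomputable section

namespace CategoryTheory

/-! ### Perfect complexes and finite projective dimension. -/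

section Perfect

variable {C : Type u} [Category.{v} C] [Abelian C]

instance : (perfectObjects C).IsClosedUnderIsomorphisms := by
  unfold perfectObjects; infer_instance

/-- A short exact sequence gives a distinguished triangle, and perfect objects are closed under the
third vertex. -/
lemma FinProjDim.perfectObjects_single {X : C} (h : FinProjDim X) :
    perfectObjects C ((Db.single C).obj X) := by
  induction h with
  | of_projective P h => exact CategoryTheory.perfectObjects_single P
  | of_shortExact S hS _ _ h₁ h₂ =>
    exact (KbProjToDerived C).essImage.ext_of_isTriangulatedClosed₃ _
      hS.singleTriangle_distinguished h₁ h₂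

open _root_.DerivedCategory in
/-- A triangulated property of objects of the derived category which holds for projective objects
holds for bounded complexes of projective objects. -/
lemma prop_Q_obj_of_bounded_projective (P : ObjectProperty (DerivedCategory C)) [P.IsTriangulated]
    [P.IsClosedUnderIsomorphisms] (hP : ∀ (A : C) [Projective A], P ((singleFunctor C 0).obj A))
    (n : ℕ) : ∀ (K : CochainComplex C ℤ) (a : ℤ) (_ : K.IsStrictlyGE a)
      (_ : K.IsStrictlyLE (a + n - 1)) (_ : ∀ i, Projective (K.X i)), P (Q.obj K) := by
  induction n with
  | zero =>
    intro K a _ _ _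
    have : IsZero K := by
      rw [IsZero.iff_id_eq_zero]
      ext i
      obtain hi | hi := lt_or_ge i a
      -- The parameter `n` counts degrees: for `n = 0` the upper bound is `a - 1`, so `K` is zero.
      · exact (K.isZero_of_isStrictlyGE a i hi).eq_of_src _ _
      · exact (K.isZero_of_isStrictlyLE (a + (0 : ℕ) - 1) i (by lia)).eq_of_src _ _
    exact P.prop_of_isZero (Q.map_isZero this)
  | succ n ih =>
    intro K a _ _ hK
    have hw (i : ℤ) (hi : (ComplexShape.up ℤ).Rel i a) : K.d i a ≫ 𝟙 (K.X a) = 0 :=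
      (K.isZero_of_isStrictlyGE a i (by simp at hi; lia)).eq_of_src _ _
    -- Brutal truncation: nothing enters the lowest degree `a`, so projecting to that term is a map
    -- of complexes, and its kernel lives in the remaining `n` degrees.
    let p : K ⟶ (HomologicalComplex.single C (ComplexShape.up ℤ) a).obj (K.X a) :=
      HomologicalComplex.mkHomToSingle (𝟙 _) hw
    have hpa : IsIso (p.f a) := by
      have : p.f a = _ := HomologicalComplex.mkHomToSingle_f (𝟙 _) hw
      rw [this]
      infer_instance
    have hpi (i : ℤ) (hi : i ≠ a) := HomologicalComplex.isZero_single_obj_X (ComplexShape.up ℤ) a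
      (K.X a) i hi
    have : Epi p := by
      have (i : ℤ) : Epi (p.f i) := by
        by_cases hi : i = a
        · subst hi; infer_instance
        · exact ⟨fun _ _ _ => (hpi i hi).eq_of_src _ _⟩
      exact HomologicalComplex.epi_of_epi_f p this
    have hS : (ShortComplex.mk (kernel.ι p) p (kernel.condition p)).ShortExact :=
      { exact := ShortComplex.exact_kernel p }
    have hSi (i : ℤ) := hS.map_of_exact (HomologicalComplex.eval C (ComplexShape.up ℤ) i)
    have hm (i : ℤ) : Mono ((kernel.ι p).f i) := (hSi i).mono_f
    have hka : IsZero ((kernel p).X a) := by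
      rw [IsZero.iff_id_eq_zero, ← cancel_mono ((kernel.ι p).f a), ← cancel_mono (p.f a)]
      simp [← HomologicalComplex.comp_f]
    have hki (i : ℤ) (hi : i ≠ a) : IsIso ((kernel.ι p).f i) := by
      have : Epi ((kernel.ι p).f i) := (hSi i).exact.epi_f ((hpi i hi).eq_of_tgt _ _)
      exact isIso_of_mono_of_epi _
    have hz (i : ℤ) (hi : IsZero (K.X i)) : IsZero ((kernel p).X i) :=
      IsZero.of_mono ((kernel.ι p).f i) hi
    have h₁ : P (Q.obj (kernel p)) := by
      refine ih _ (a + 1) ?_ ?_ fun i => ?_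
      · rw [CochainComplex.isStrictlyGE_iff]
        intro i hi
        by_cases h : i = a
        · subst h; exact hka
        · exact hz i (K.isZero_of_isStrictlyGE a i (by lia))
      · rw [CochainComplex.isStrictlyLE_iff]
        intro i hi
        exact hz i (K.isZero_of_isStrictlyLE (a + (n + 1 : ℕ) - 1) i (by push_cast; lia))
      · by_cases h : i = a
        · subst h; exact Projective.of_iso hka.isoZero.symm inferInstance
        · have := hki i h
          exact Projective.of_iso (asIso ((kernel.ι p).f i)).symm (hK i)
    have h₃ : P (Q.obj ((HomologicalComplex.single C (ComplexShape.up ℤ) a).obj (K.X a))) := by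
      have e := ((singleFunctors C).shiftIso a 0 a (by lia)).app (K.X a)
      have h := P.prop_of_iso ((singleFunctorIsoCompQ C a).app (K.X a))
        ((P.prop_shift_iff_of_isStableUnderShift _ a).1 (P.prop_of_iso e.symm (hP (K.X a))))
      exact h
    exact P.ext_of_isTriangulatedClosed₂ _ (triangleOfSES_distinguished hS) h₁ h₃

end Perfect

/-! ### The functor between singularity categories and its connecting morphisms. -/

section Singularity

variable {C : Type u} [Category.{v} C] [Abelian C] {D : Type u'} [Category.{v'} D] [Abelian D]
  (F : C ⥤ D) [F.Additive] [PreservesFiniteLimits F] [PreservesFiniteColimits F]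

/-- The comparison of `F` with its extension to the bounded derived categories. -/
def Db.singleMapIso : Db.single C ⋙ Db.map F ≅ F ⋙ Db.single D :=
  NatIso.ofComponents
    (fun X => ObjectProperty.isoMk _ ((F.mapDerivedCategorySingleFunctor 0).app X)) (fun f => by
    ext
    exact (F.mapDerivedCategorySingleFunctor 0).hom.naturality f)

/-- The objects that `F` sends to perfect ones form a triangulated class, so by dévissage of bounded
complexes only single projectives need checking. -/
lemma perfectObjects_le_inverseImage (hF : ∀ (P : C) [Projective P], FinProjDim (F.obj P)) :
    perfectObjects C ≤ (perfectObjects D).inverseImage (Db.map F) := by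
  rintro X ⟨⟨⟨K⟩, a, b, h₁, h₂, h₃⟩, ⟨e⟩⟩
  let P := (KbProjToDerived D).essImage.inverseImage F.mapDerivedCategory
  change P X.obj
  have e' : DerivedCategory.Q.obj K ≅ X.obj := (DerivedCategory.quotientCompQhIso C).symm.app K ≪≫ e
  -- `(b - a + 1).toNat` is the number of degrees in `[a, b]`, read as zero when the interval is
  -- empty.
  refine P.prop_of_iso e' (prop_Q_obj_of_bounded_projective P (fun A _ => ?_) (b - a + 1).toNat
    K a h₁ ?_ h₃)
  · exact (KbProjToDerived D).essImage.prop_of_iso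
      ((F.mapDerivedCategorySingleFunctor 0).symm.app A) (hF A).perfectObjects_single
  · have h₂ : CochainComplex.IsStrictlyLE K b := h₂
    exact CochainComplex.isStrictlyLE_of_le K b _ (by lia)

lemma Db.map_isInvertedBy (hF : ∀ (P : C) [Projective P], FinProjDim (F.obj P)) :
    (perfectObjects C).trW.IsInvertedBy (Db.map F ⋙ Dsg.Q D) :=
  fun _ _ f hf => (perfectObjects D).inverseImage_trW_isInverted (Db.map F) (Dsg.Q D) f
    (ObjectProperty.trW_monotone (perfectObjects_le_inverseImage F hF) f hf)

end Singularity

section Singularity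

variable {C : Type u} [Category.{v} C] [Abelian C] {D : Type u'} [Category.{v'} D] [Abelian D]

/-- The connecting morphism `X₃ ⟶ X₁⟦1⟧` in the bounded derived category of a short exact
sequence. -/
abbrev Db.δ {S : ShortComplex C} (hS : S.ShortExact) :
    (Db.single C).obj S.X₃ ⟶ ((Db.single C).obj S.X₁)⟦(1 : ℤ)⟧ :=
  ObjectProperty.homMk
    (hS.singleδ ≫ ((ObjectProperty.ι _).commShiftIso (1 : ℤ)).inv.app ((Db.single C).obj S.X₁))

lemma Db.δ_hom_comp {S : ShortComplex C} (hS : S.ShortExact) :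
    (ObjectProperty.ι _).map (Db.δ hS) ≫
      ((ObjectProperty.ι _).commShiftIso (1 : ℤ)).hom.app ((Db.single C).obj S.X₁) =
        hS.singleδ := by
  change (hS.singleδ ≫ _) ≫ _ = _
  rw [Category.assoc, Iso.inv_hom_id_app]
  exact Category.comp_id _

/-- Reduces identities between maps into a shift in `Dᵇ` to the unbounded derived category, the
inclusion being faithful. -/
lemma Db.ι_map_comp_commShiftIso_hom_injective {X Y : Db C} {f g : X ⟶ Y⟦(1 : ℤ)⟧}
    (h : (ObjectProperty.ι _).map f ≫ ((ObjectProperty.ι _).commShiftIso (1 : ℤ)).hom.app Y =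
      (ObjectProperty.ι _).map g ≫ ((ObjectProperty.ι _).commShiftIso (1 : ℤ)).hom.app Y) :
    f = g := by
  rw [cancel_mono] at h
  exact (ObjectProperty.ι _).map_injective h

/-- After inclusion in the derived category this is the third square of the morphism of triangles
induced by `f`. -/
lemma Db.δ_naturality {S₁ S₂ : ShortComplex C} (h₁ : S₁.ShortExact) (h₂ : S₂.ShortExact)
    (f : S₁ ⟶ S₂) : Db.δ h₁ ≫ ((Db.single C).map f.τ₁)⟦(1 : ℤ)⟧' =
      (Db.single C).map f.τ₃ ≫ Db.δ h₂ := by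
  apply Db.ι_map_comp_commShiftIso_hom_injective
  rw [Functor.map_comp, Functor.map_comp, Category.assoc, Category.assoc, Db.δ_hom_comp,
    Functor.commShiftIso_hom_naturality]
  have := Db.δ_hom_comp h₁
  refine (Category.assoc _ _ _).symm.trans ?_
  refine (congrArg (fun z => z ≫ _) this).trans ?_
  exact (ShortComplex.ShortExact.singleTriangle.map h₁ h₂ f).comm₃

lemma Dsg.δ_naturality {S₁ S₂ : ShortComplex C} (h₁ : S₁.ShortExact) (h₂ : S₂.ShortExact)
    (f : S₁ ⟶ S₂) : Dsg.δ h₁ ≫ ((Dsg.Q C).map ((Db.single C).map f.τ₁))⟦(1 : ℤ)⟧' =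
      (Dsg.Q C).map ((Db.single C).map f.τ₃) ≫ Dsg.δ h₂ := by
  change ((Dsg.Q C).map (Db.δ h₁) ≫ _) ≫ _ = _ ≫ (Dsg.Q C).map (Db.δ h₂) ≫ _
  rw [Category.assoc, ← Functor.commShiftIso_hom_naturality, ← Functor.map_comp_assoc,
    Db.δ_naturality h₁ h₂ f, Functor.map_comp_assoc]

variable (F : C ⥤ D) [F.Additive] [PreservesFiniteLimits F] [PreservesFiniteColimits F]

lemma Db.ι_map_map_commShiftIso_hom_app (X : Db C) :
    (ObjectProperty.ι _).map (((Db.map F).commShiftIso (1 : ℤ)).hom.app X) ≫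
      ((ObjectProperty.ι _).commShiftIso (1 : ℤ)).hom.app ((Db.map F).obj X) =
    F.mapDerivedCategory.map (((ObjectProperty.ι _).commShiftIso (1 : ℤ)).hom.app X) ≫
      (F.mapDerivedCategory.commShiftIso (1 : ℤ)).hom.app X.obj := by
  have := NatTrans.shift_app_comm (ObjectProperty.liftCompιIso
    (DerivedCategory.TStructure.t (C := D)).bounded (ObjectProperty.ι _ ⋙ F.mapDerivedCategory)
    (bounded_mapDerivedCategory F)).hom (1 : ℤ) X
  rw [Functor.commShiftIso_comp_hom_app, Functor.commShiftIso_comp_hom_app] at this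
  refine Eq.trans ?_ (this.trans (Category.id_comp _))
  refine (Category.comp_id _).symm.trans ?_
  congr 1
  exact (Functor.map_id _ _).symm

/-- The comparison of `F` on objects with its extension to the bounded derived categories. -/
def Db.singleMapAppIso (X : C) :
    (Db.map F).obj ((Db.single C).obj X) ≅ (Db.single D).obj (F.obj X) :=
  (Db.singleMapIso F).app X

/-- The connecting morphism of the image under `F` of a short exact sequence. -/
def Db.mapδ {S : ShortComplex C} (hS : S.ShortExact) :
    (Db.single D).obj (F.obj S.X₃) ⟶ ((Db.single D).obj (F.obj S.X₁))⟦(1 : ℤ)⟧ :=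
  Db.δ (hS.map_of_exact F)

/-- An exact functor commutes with connecting morphisms. The known statement for
`mapDerivedCategory` is carried to bounded objects by comparing the two shift isomorphisms. -/
lemma Db.map_δ {S : ShortComplex C} (hS : S.ShortExact) :
    (Db.map F).map (Db.δ hS) ≫ ((Db.map F).commShiftIso (1 : ℤ)).hom.app _ ≫
      (Db.singleMapAppIso F S.X₁).hom⟦(1 : ℤ)⟧' =
    (Db.singleMapAppIso F S.X₃).hom ≫ Db.mapδ F hS := by
  apply Db.ι_map_comp_commShiftIso_hom_injective
  rw [Functor.map_comp, Functor.map_comp, Functor.map_comp, Category.assoc, Category.assoc,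
    Category.assoc, Functor.commShiftIso_hom_naturality]
  refine (congrArg ((ObjectProperty.ι _).map ((Db.map F).map (Db.δ hS)) ≫ ·)
    ((Category.assoc _ _ _).symm.trans
      (congrArg (· ≫ ((F.mapDerivedCategorySingleFunctor 0).hom.app S.X₁)⟦(1 : ℤ)⟧')
        (Db.ι_map_map_commShiftIso_hom_app F _)))).trans ?_
  have h₁ := (Iso.inv_comp_eq ((F.mapDerivedCategorySingleFunctor 0).app S.X₃)).1
    (hS.mapShiftedHom_singleδ' F)
  rw [ShiftedHom.map] at h₁
  have h₂ := congrArg F.mapDerivedCategory.map (Db.δ_hom_comp hS)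
  rw [Functor.map_comp] at h₂
  refine (?_ : _ = (F.mapDerivedCategory.map hS.singleδ ≫
    (F.mapDerivedCategory.commShiftIso (1 : ℤ)).hom.app _) ≫
      ((F.mapDerivedCategorySingleFunctor 0).hom.app S.X₁)⟦(1 : ℤ)⟧').trans ?_
  · rw [← h₂, Category.assoc, Category.assoc, Category.assoc]
    rfl
  · exact h₁.trans (congrArg ((F.mapDerivedCategorySingleFunctor 0).hom.app S.X₃ ≫ ·)
      (Db.δ_hom_comp (hS.map_of_exact F)).symm)

variable (hF : ∀ (P : C) [Projective P], FinProjDim (F.obj P))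

/-- The functor between singularity categories induced by an exact functor which sends projective
objects to objects of finite projective dimension. -/
abbrev Dsg.map : Dsg C ⥤ Dsg D :=
  Localization.lift (Db.map F ⋙ Dsg.Q D) (Db.map_isInvertedBy F hF) (Dsg.Q C)

/-- The isomorphism expressing that `Dsg.map` is induced by `F`. -/
abbrev Dsg.QMapIso : Dsg.Q C ⋙ Dsg.map F hF ≅ Db.map F ⋙ Dsg.Q D :=
  Localization.Lifting.iso (Dsg.Q C) (perfectObjects C).trW (Db.map F ⋙ Dsg.Q D) (Dsg.map F hF)

instance : (Dsg.map F hF).CommShift ℤ :=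
  Functor.commShiftOfLocalization (Dsg.Q C) (perfectObjects C).trW ℤ (Db.map F ⋙ Dsg.Q D)
    (Dsg.map F hF)

instance : NatTrans.CommShift (Dsg.QMapIso F hF).hom ℤ :=
  NatTrans.commShift_iso_hom_of_localization (Dsg.Q C) (perfectObjects C).trW ℤ
    (Db.map F ⋙ Dsg.Q D) (Dsg.map F hF)

instance : (Dsg.map F hF).IsTriangulated :=
  have := Localization.essSurj_mapArrow (Dsg.Q C) (perfectObjects C).trW
  Functor.isTriangulated_of_precomp_iso (Dsg.QMapIso F hF)

/-- The comparison of `F` on objects with the induced functor between singularity categories. -/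
def Dsg.singleMapAppIso (X : C) :
    (Dsg.map F hF).obj ((Dsg.Q C).obj ((Db.single C).obj X)) ≅
      (Dsg.Q D).obj ((Db.single D).obj (F.obj X)) :=
  (Dsg.QMapIso F hF).app ((Db.single C).obj X) ≪≫ (Dsg.Q D).mapIso (Db.singleMapAppIso F X)

lemma Dsg.singleMapAppIso_hom (X : C) : (Dsg.singleMapAppIso F hF X).hom =
    (Dsg.QMapIso F hF).hom.app ((Db.single C).obj X) ≫
      (Dsg.Q D).map (Db.singleMapAppIso F X).hom := rfl

lemma Dsg.singleMapAppIso_naturality {X Y : C} (f : X ⟶ Y) :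
    (Dsg.map F hF).map ((Dsg.Q C).map ((Db.single C).map f)) ≫
      (Dsg.singleMapAppIso F hF Y).hom =
    (Dsg.singleMapAppIso F hF X).hom ≫ (Dsg.Q D).map ((Db.single D).map (F.map f)) := by
  have h₁ := (Dsg.QMapIso F hF).hom.naturality ((Db.single C).map f)
  have h₂ : (Db.map F).map ((Db.single C).map f) ≫ (Db.singleMapAppIso F Y).hom =
    (Db.singleMapAppIso F X).hom ≫ (Db.single D).map (F.map f) :=
    (Db.singleMapIso F).hom.naturality f
  dsimp only [Functor.comp_map, Functor.comp_obj] at h₁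
  rw [singleMapAppIso_hom, singleMapAppIso_hom, reassoc_of% h₁, Category.assoc,
    ← Functor.map_comp, ← Functor.map_comp, h₂]

/-- The connecting morphism in the singularity category of the image under `F` of a short exact
sequence. -/
def Dsg.mapδ {S : ShortComplex C} (hS : S.ShortExact) :
    (Dsg.Q D).obj ((Db.single D).obj (F.obj S.X₃)) ⟶
      ((Dsg.Q D).obj ((Db.single D).obj (F.obj S.X₁)))⟦(1 : ℤ)⟧ :=
  (Dsg.Q D).map (Db.mapδ F hS) ≫ ((Dsg.Q D).commShiftIso (1 : ℤ)).hom.app _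

/-- Pastes `Db.map_δ` with the compatibility of `Dsg.QMapIso` with shifts; this is where the chosen
shift structure on `Dsg.map` meets the connecting morphisms. -/
lemma Dsg.map_δ {S : ShortComplex C} (hS : S.ShortExact) :
    (Dsg.map F hF).map (Dsg.δ hS) ≫ ((Dsg.map F hF).commShiftIso (1 : ℤ)).hom.app _ ≫
      (Dsg.singleMapAppIso F hF S.X₁).hom⟦(1 : ℤ)⟧' =
    (Dsg.singleMapAppIso F hF S.X₃).hom ≫ Dsg.mapδ F hS := by
  have hc := NatTrans.shift_app_comm (Dsg.QMapIso F hF).hom (1 : ℤ) ((Db.single C).obj S.X₁)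
  rw [Functor.commShiftIso_comp_hom_app, Functor.commShiftIso_comp_hom_app] at hc
  have h₁ := congrArg (Dsg.Q D).map (Db.map_δ F hS)
  rw [Functor.map_comp, Functor.map_comp, Functor.map_comp] at h₁
  have hn := (Dsg.QMapIso F hF).hom.naturality (Db.δ hS)
  dsimp only [Functor.comp_map, Functor.comp_obj] at hn hc
  rw [Dsg.singleMapAppIso_hom, Dsg.singleMapAppIso_hom, Functor.map_comp, Dsg.mapδ]
  change (Dsg.map F hF).map ((Dsg.Q C).map (Db.δ hS) ≫ _) ≫ _ = _
  rw [Functor.map_comp, Category.assoc, Category.assoc] at *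
  rw [reassoc_of% hc, reassoc_of% hn, ← Functor.commShiftIso_hom_naturality, reassoc_of% h₁]

end Singularity

end CategoryTheory

end

noncomputable section

namespace CategoryTheory

/-! ### A criterion: an exact functor `F`, a functor `T` on Gorenstein projectives, and a map `F ⟶
T` invertible up to perfect complexes. -/

section Induces

variable {C : Type u} [Category.{v} C] [Abelian C] {D : Type u'} [Category.{v'} D] [Abelian D]

open Pretriangulated in
lemma Db.triangle_distinguished {S : ShortComplex C} (hS : S.ShortExact) :
    Triangle.mk ((Db.single C).map S.f) ((Db.single C).map S.g) (Db.δ hS) ∈ distTriang (Db C) := by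
  have h := hS.singleTriangle_distinguished
  have e : (ObjectProperty.ι _).mapTriangle.obj (Triangle.mk ((Db.single C).map S.f)
      ((Db.single C).map S.g) (Db.δ hS)) = hS.singleTriangle := by
    dsimp only [Functor.mapTriangle, ShortComplex.ShortExact.singleTriangle]
    congr 1
    exact Db.δ_hom_comp hS
  change (ObjectProperty.ι _).mapTriangle.obj _ ∈ distTriang (DerivedCategory C)
  rw [e]
  exact h

lemma isIso_Dsg_map_of_shortExact {S : ShortComplex C} (hS : S.ShortExact)
    (h₁ : FinProjDim S.X₁) : IsIso ((Dsg.Q C).map ((Db.single C).map S.g)) :=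
  Localization.inverts (Dsg.Q C) (perfectObjects C).trW _
    (ObjectProperty.trW.mk' _ (Db.triangle_distinguished hS) h₁.perfectObjects_single)

/-- The comparison of two cosyzygies of `X` comes from a morphism of short exact sequences that is
the identity on `X`, so naturality of connecting morphisms applies. -/
lemma StableGProj.toDsg_map_mapStable_comp_δ {X : GProj C} (c c' : Cosyzygy X) :
    (toDsg C).map (c.mapStable c' (𝟙 X)) ≫ Dsg.δ c'.shortExact = Dsg.δ c.shortExact := by
  obtain ⟨g, s, hg, hs, e⟩ := c.exists_mapStable_eq c' (𝟙 X)
  let φ : ShortComplex.mk c.ι c.π c.zero ⟶ ShortComplex.mk c'.ι c'.π c'.zero :=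
    { τ₁ := 𝟙 _, τ₂ := g, τ₃ := s.hom, comm₁₂ := hg.symm, comm₂₃ := hs.symm }
  have := Dsg.δ_naturality c.shortExact c'.shortExact φ
  rw [e]
  refine this.symm.trans ?_
  have h : ((Dsg.Q C).map ((Db.single C).map φ.τ₁))⟦(1 : ℤ)⟧' = 𝟙 _ := by
    change ((Dsg.Q C).map ((Db.single C).map (𝟙 X.obj)))⟦(1 : ℤ)⟧' = 𝟙 _
    rw [Functor.map_id, Functor.map_id, Functor.map_id]
  exact (congrArg (_ ≫ ·) h).trans (Category.comp_id _)

variable {F : C ⥤ D} [F.Additive] [PreservesFiniteLimits F] [PreservesFiniteColimits F]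
  (hF : ∀ (P : C) [Projective P], FinProjDim (F.obj P)) {T : C ⥤ D} [T.Additive]
  (h : PreservesGProj T) (ρ : F ⟶ T)

namespace PreservesGProj

lemma isIso_Dsg_map_app (hρ : ∀ Y, gorensteinProjective C Y → Epi (ρ.app Y))
    (hρ' : ∀ Y, gorensteinProjective C Y → FinProjDim (kernel (ρ.app Y)))
    {Y : C} (hY : gorensteinProjective C Y) :
    IsIso ((Dsg.Q D).map ((Db.single D).map (ρ.app Y))) :=
  have := hρ Y hY
  isIso_Dsg_map_of_shortExact (S := ShortComplex.mk (kernel.ι (ρ.app Y)) (ρ.app Y)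
    (kernel.condition _)) { exact := ShortComplex.exact_kernel _ } (hρ' Y hY)

lemma mapδ_comp {S : ShortComplex C} (hS : S.ShortExact) (h₃ : gorensteinProjective C S.X₃) :
    Dsg.mapδ F hS ≫ ((Dsg.Q D).map ((Db.single D).map (ρ.app S.X₁)))⟦(1 : ℤ)⟧' =
      (Dsg.Q D).map ((Db.single D).map (ρ.app S.X₃)) ≫ Dsg.δ (h.shortExact hS h₃) :=
  Dsg.δ_naturality (hS.map_of_exact F) (h.shortExact hS h₃) (S.mapNatTrans ρ)

variable (hρ : ∀ Y, gorensteinProjective C Y → Epi (ρ.app Y))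
    (hρ' : ∀ Y, gorensteinProjective C Y → FinProjDim (kernel (ρ.app Y)))

/-- The isomorphism in the singularity category induced by `ρ`. -/
def toDsgAppIso (X : GProj C) : (StableGProj.toDsg D).obj (h.functor.obj ⟨X⟩) ≅
    (Dsg.map F hF).obj ((StableGProj.toDsg C).obj ⟨X⟩) :=
  have := isIso_Dsg_map_app ρ hρ hρ' X.property
  (asIso ((Dsg.Q D).map ((Db.single D).map (ρ.app X.obj)))).symm ≪≫
    (Dsg.singleMapAppIso F hF X.obj).symm

/-- `ρ` induces a comparison of the stable functor given by `T` with the functor between singularity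
categories given by `F`. -/
def toDsgIso : h.functor ⋙ StableGProj.toDsg D ≅ StableGProj.toDsg C ⋙ Dsg.map F hF :=
  NatIso.ofComponents (fun X => toDsgAppIso hF h ρ hρ hρ' X.as) (by
    intro X Y f
    obtain ⟨f, rfl⟩ := (StableGProj.proj C).map_surjective f
    have := isIso_Dsg_map_app ρ hρ hρ' X.as.property
    have := isIso_Dsg_map_app ρ hρ hρ' Y.as.property
    change (Dsg.Q D).map ((Db.single D).map (T.map f.hom)) ≫
      inv ((Dsg.Q D).map ((Db.single D).map (ρ.app Y.as.obj))) ≫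
        (Dsg.singleMapAppIso F hF Y.as.obj).inv =
      (inv ((Dsg.Q D).map ((Db.single D).map (ρ.app X.as.obj))) ≫
        (Dsg.singleMapAppIso F hF X.as.obj).inv) ≫
        (Dsg.map F hF).map ((Dsg.Q C).map ((Db.single C).map f.hom))
    have h₁ := Dsg.singleMapAppIso_naturality F hF f.hom
    have h₂ : (Dsg.Q D).map ((Db.single D).map (ρ.app X.as.obj)) ≫
        (Dsg.Q D).map ((Db.single D).map (T.map f.hom)) =
        (Dsg.Q D).map ((Db.single D).map (F.map f.hom)) ≫
          (Dsg.Q D).map ((Db.single D).map (ρ.app Y.as.obj)) := by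
      rw [← Functor.map_comp, ← Functor.map_comp, ← ρ.naturality, Functor.map_comp,
        Functor.map_comp]
    rw [Category.assoc, IsIso.eq_inv_comp, Iso.eq_inv_comp, reassoc_of% h₂,
      IsIso.hom_inv_id_assoc, ← reassoc_of% h₁, Iso.hom_inv_id, Category.comp_id])

/-- Two commuting squares with invertible sides are pasted and inverted. The maps `d`, `d'`, `e`
stand for the connecting morphisms of `T`, of `F`, and of the functor on singularity categories. -/
lemma toDsgAppIso_shift (X Y : C) [IsIso ((Dsg.Q D).map ((Db.single D).map (ρ.app X)))]
    [IsIso ((Dsg.Q D).map ((Db.single D).map (ρ.app Y)))]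
    (d : (Dsg.Q D).obj ((Db.single D).obj (T.obj Y)) ⟶
      ((Dsg.Q D).obj ((Db.single D).obj (T.obj X)))⟦(1 : ℤ)⟧)
    (d' : (Dsg.Q D).obj ((Db.single D).obj (F.obj Y)) ⟶
      ((Dsg.Q D).obj ((Db.single D).obj (F.obj X)))⟦(1 : ℤ)⟧)
    (e : (Dsg.map F hF).obj ((Dsg.Q C).obj ((Db.single C).obj Y)) ⟶
      ((Dsg.map F hF).obj ((Dsg.Q C).obj ((Db.single C).obj X)))⟦(1 : ℤ)⟧)
    (h₁ : d' ≫ ((Dsg.Q D).map ((Db.single D).map (ρ.app X)))⟦(1 : ℤ)⟧' =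
      (Dsg.Q D).map ((Db.single D).map (ρ.app Y)) ≫ d)
    (h₂ : e ≫ (Dsg.singleMapAppIso F hF X).hom⟦(1 : ℤ)⟧' =
      (Dsg.singleMapAppIso F hF Y).hom ≫ d') :
    d ≫ (inv ((Dsg.Q D).map ((Db.single D).map (ρ.app X))) ≫
      (Dsg.singleMapAppIso F hF X).inv)⟦(1 : ℤ)⟧' =
    (inv ((Dsg.Q D).map ((Db.single D).map (ρ.app Y))) ≫
      (Dsg.singleMapAppIso F hF Y).inv) ≫ e := by
  rw [Category.assoc, IsIso.eq_inv_comp, Iso.eq_inv_comp, ← reassoc_of% h₁, ← Functor.map_comp,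
    IsIso.hom_inv_id_assoc, ← reassoc_of% h₂, ← Functor.map_comp, Iso.hom_inv_id, Functor.map_id,
    Category.comp_id]

include hF ρ hρ hρ' in
/-- A criterion for an exact functor to induce a triangle equivalence between the stable categories
of Gorenstein projectives. -/
theorem inducesStableTriangleEquivalence (he : h.functor.IsEquivalence) :
    InducesStableTriangleEquivalence F := by
  refine ⟨Dsg.map F hF, inferInstance, inferInstance, Dsg.QMapIso F hF, inferInstance,
    h.stableTriangleFunctor, toDsgIso hF h ρ hρ hρ', he, fun X => ?_⟩
  have := isIso_Dsg_map_app ρ hρ hρ' X.as.property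
  have := isIso_Dsg_map_app ρ hρ hρ' X.as.cosyzygy.S.property
  -- Compatibility with suspensions is three naturality statements for connecting morphisms: along
  -- `ρ`, along the change of cosyzygy of `T X`, and along `F`.
  have h₁ := h.mapδ_comp ρ X.as.cosyzygy.shortExact X.as.cosyzygy.S.property
  have h₂ := StableGProj.toDsg_map_mapStable_comp_δ (h.mapCosyzygy X.as.cosyzygy)
    (h.functorGProj.obj X.as).cosyzygy
  have h₃ := Dsg.map_δ F hF X.as.cosyzygy.shortExact
  refine (Category.assoc _ _ _).symm.trans ((congrArg (· ≫ _) h₂).trans ?_)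
  exact toDsgAppIso_shift hF ρ X.as.obj X.as.cosyzygy.S.obj _ _ _ h₁
    ((Category.assoc _ _ _).trans h₃)

end PreservesGProj

end Induces

end CategoryTheory

end

noncomputable section

namespace CategoryTheory

/-! ### The formalism of a ring extension with a retraction. -/

section

variable {C : Type u} [Category.{v} C] [Abelian C] {D : Type u'} [Category.{v'} D] [Abelian D]

/-- The iterates of an endofunctor. -/
abbrev Functor.iter (F : C ⥤ C) : ℕ → (C ⥤ C)
  | 0 => 𝟭 C
  | n + 1 => F.iter n ⋙ F

instance (F : C ⥤ C) [F.Additive] (n : ℕ) : (F.iter n).Additive := by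
  induction n with
  | zero => dsimp only [Functor.iter]; infer_instance
  | succ n ih => dsimp only [Functor.iter]; infer_instance

instance (F : C ⥤ C) [PreservesFiniteColimits F] (n : ℕ) :
    PreservesFiniteColimits (F.iter n) := by
  induction n with
  | zero => dsimp only [Functor.iter]; infer_instance
  | succ n ih => dsimp only [Functor.iter]; exact comp_preservesFiniteColimits _ _

variable (C D) in
/-- Functors relating the modules over a ring with those over an extension of it: restriction `e`
along the extension with its left adjoint `l`, restriction `i` along a retraction of the extension
with its left adjoint `q`, and an endofunctor `F` with natural exact sequences
`0 ⟶ F e Y ⟶ e l e Y ⟶ e Y ⟶ 0`. -/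
structure ExtensionData where
  e : C ⥤ D
  l : D ⥤ C
  q : C ⥤ D
  i : D ⥤ C
  F : D ⥤ D
  adj : l ⊣ e
  adj' : q ⊣ i
  retraction : i ⋙ e ≅ 𝟭 D
  faithful : e.Faithful
  additive_e : e.Additive
  preservesFiniteLimits_e : PreservesFiniteLimits e
  preservesFiniteColimits_e : PreservesFiniteColimits e
  preservesFiniteLimits_i : PreservesFiniteLimits i
  preservesFiniteColimits_i : PreservesFiniteColimits i
  additive_F : F.Additive
  preservesFiniteColimits_F : PreservesFiniteColimits F
  j (Y : C) : F.obj (e.obj Y) ⟶ e.obj (l.obj (e.obj Y))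
  j_naturality {Y Z : C} (f : Y ⟶ Z) : F.map (e.map f) ≫ j Z = j Y ≫ e.map (l.map (e.map f))
  zero (Y : C) : j Y ≫ e.map (adj.counit.app Y) = 0
  exact (Y : C) : (ShortComplex.mk _ _ (zero Y)).Exact
  mono_j (Y : C) : Mono (j Y)

namespace ExtensionData

attribute [instance] faithful additive_e preservesFiniteLimits_e preservesFiniteColimits_e
  preservesFiniteLimits_i preservesFiniteColimits_i additive_F preservesFiniteColimits_F mono_j

variable (E : ExtensionData C D)

instance : E.l.Additive := E.adj.left_adjoint_additive
instance : E.i.Additive := Functor.additive_of_preserves_binary_products _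
instance : E.q.Additive := E.adj'.left_adjoint_additive
instance : PreservesFiniteColimits E.l :=
  have := E.adj.leftAdjoint_preservesColimits
  PreservesColimits.preservesFiniteColimits _
instance : PreservesFiniteColimits E.q :=
  have := E.adj'.leftAdjoint_preservesColimits
  PreservesColimits.preservesFiniteColimits _

instance (Y : C) : Epi (E.adj.counit.app Y) := inferInstance

/-- The composition `q l` is the identity. -/
def ω : E.l ⋙ E.q ≅ 𝟭 D :=
  -- `l ⋙ q` is left adjoint to `i ⋙ e`, which is the identity, so both are left adjoints of the
  -- same functor.
  (E.adj.comp E.adj').leftAdjointUniq (Adjunction.id.ofNatIsoRight E.retraction.symm)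

/-- The kernel of the counit `l e Y ⟶ Y`. -/
def κ : C ⥤ C := kernel E.adj.counit

/-- The inclusion of the kernel of the counit. -/
def ι (Y : C) : E.κ.obj Y ⟶ E.l.obj (E.e.obj Y) := (kernel.ι E.adj.counit).app Y

lemma ι_naturality {Y Z : C} (f : Y ⟶ Z) : E.κ.map f ≫ E.ι Z = E.ι Y ≫ E.l.map (E.e.map f) :=
  (kernel.ι E.adj.counit).naturality f

lemma ι_counit (Y : C) : E.ι Y ≫ E.adj.counit.app Y = 0 :=
  NatTrans.congr_app (kernel.condition E.adj.counit) Y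

lemma shortExact (Y : C) : (ShortComplex.mk _ _ (E.ι_counit Y)).ShortExact := by
  have h : (ShortComplex.mk _ E.adj.counit (kernel.condition _)).ShortExact :=
    { exact := ShortComplex.exact_kernel _
      mono_f := inferInstanceAs (Mono (kernel.ι _))
      epi_g := NatTrans.epi_of_epi_app _ }
  exact h.map_of_exact ((evaluation C C).obj Y)

lemma exact_e (Y : C) : (ShortComplex.mk (E.e.map (E.ι Y)) (E.e.map (E.adj.counit.app Y))
    (by rw [← E.e.map_comp, ι_counit, E.e.map_zero])).Exact :=
  ((E.shortExact Y).map_of_exact E.e).exact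

instance (Y : C) : Mono (E.ι Y) := (E.shortExact Y).mono_f

/-- The kernel of the counit in terms of `F`, on objects. -/
def κeApp (Y : C) : E.e.obj (E.κ.obj Y) ≅ E.F.obj (E.e.obj Y) :=
  (E.exact_e Y).fIsKernel.conePointUniqueUpToIso (E.exact Y).fIsKernel

lemma κeApp_hom_comp (Y : C) : (E.κeApp Y).hom ≫ E.j Y = E.e.map (E.ι Y) :=
  IsLimit.conePointUniqueUpToIso_hom_comp _ (E.exact Y).fIsKernel WalkingParallelPair.zero

/-- The kernel of the counit in terms of `F`. -/
def κe : E.κ ⋙ E.e ≅ E.e ⋙ E.F :=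
  NatIso.ofComponents E.κeApp (fun {Y Z} f => by
    change E.e.map (E.κ.map f) ≫ (E.κeApp Z).hom = (E.κeApp Y).hom ≫ E.F.map (E.e.map f)
    rw [← cancel_mono (E.j Z), Category.assoc, Category.assoc, E.j_naturality, E.κeApp_hom_comp,
      ← Category.assoc, E.κeApp_hom_comp, ← E.e.map_comp, ← E.e.map_comp, ι_naturality])

instance : E.κ.Additive where
  map_add {X Y f g} := by
    apply E.e.map_injective
    rw [← cancel_mono (E.e.map (E.ι Y))]
    simp only [← E.e.map_comp, Preadditive.add_comp, ι_naturality, Functor.map_add,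
      Preadditive.comp_add]

/-- A kernel of right exact functors need not be right exact; here `κ ⋙ e` is `e ⋙ F`, and `e`
reflects colimits. -/
instance : PreservesFiniteColimits E.κ where
  preservesFiniteColimits J _ _ := by
    have : PreservesColimitsOfShape J (E.κ ⋙ E.e) := by
      have : PreservesFiniteColimits (E.e ⋙ E.F) := comp_preservesFiniteColimits _ _
      exact preservesColimitsOfShape_of_natIso E.κe.symm
    have : ReflectsColimitsOfShape J E.e := reflectsColimitsOfShape_of_reflectsIsomorphisms
    exact preservesColimitsOfShape_of_reflects_of_preserves _ E.e

lemma q_map_adjunct {A : D} {Z : C} (g : A ⟶ E.e.obj Z) :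
    E.q.map (E.l.map g ≫ E.adj.counit.app Z) =
      E.ω.hom.app A ≫ g ≫ E.ω.inv.app (E.e.obj Z) ≫ E.q.map (E.adj.counit.app Z) := by
  have h := NatIso.naturality_1 E.ω.symm g
  dsimp only [Functor.comp_map, Iso.symm_inv, Iso.symm_hom, Functor.comp_obj, Functor.id_map] at h
  rw [Functor.map_comp, ← h, Category.assoc, Category.assoc]

/-- The projection `e Y ⟶ q Y`. -/
def ρ : E.e ⟶ E.q where
  app Y := E.ω.inv.app (E.e.obj Y) ≫ E.q.map (E.adj.counit.app Y)
  naturality Y Z f := by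
    have h := E.ω.inv.naturality (E.e.map f)
    have h' := E.q.congr_map (E.adj.counit.naturality f)
    dsimp only [Functor.comp_map, Functor.comp_obj, Functor.id_map, Functor.id_obj] at h h'
    rw [reassoc_of% h, Category.assoc, ← Functor.map_comp, ← Functor.map_comp, h']

lemma ρ_app (Y : C) :
    E.ρ.app Y = E.ω.inv.app (E.e.obj Y) ≫ E.q.map (E.adj.counit.app Y) := rfl

/-- If `g` is a section of `ρ`, this says that `q` of its adjunct is the isomorphism `ω`. -/
lemma q_map_adjunct' {A : D} {Z : C} (g : A ⟶ E.e.obj Z) :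
    E.q.map (E.l.map g ≫ E.adj.counit.app Z) = E.ω.hom.app A ≫ g ≫ E.ρ.app Z :=
  E.q_map_adjunct g

instance (Y : C) : Epi (E.ρ.app Y) := by
  rw [ρ_app]
  exact epi_comp _ _

/-- The morphism `q κ Y ⟶ e Y` whose cokernel is `q Y`. -/
def σ : E.κ ⋙ E.q ⟶ E.e where
  app Y := E.q.map (E.ι Y) ≫ E.ω.hom.app (E.e.obj Y)
  naturality Y Z f := by
    have h := E.ω.hom.naturality (E.e.map f)
    have h' := E.q.congr_map (E.ι_naturality f)
    dsimp only [Functor.comp_map, Functor.comp_obj, Functor.id_map, Functor.id_obj] at h h' ⊢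
    rw [Category.assoc, ← h, ← Functor.map_comp_assoc, h', Functor.map_comp_assoc]

lemma σ_app (Y : C) : E.σ.app Y = E.q.map (E.ι Y) ≫ E.ω.hom.app (E.e.obj Y) := rfl

lemma σ_ρ (Y : C) : E.σ.app Y ≫ E.ρ.app Y = 0 := by
  rw [σ_app, ρ_app, Category.assoc, Iso.hom_inv_id_app_assoc, ← E.q.map_comp, ι_counit,
    E.q.map_zero]

lemma σ_ρ_exact (Y : C) : (ShortComplex.mk _ _ (E.σ_ρ Y)).Exact := by
  have h := ((Functor.preservesFiniteColimits_iff_forall_exact_map_and_epi E.q).1 inferInstance _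
    (E.shortExact Y)).1
  refine ShortComplex.exact_of_iso (ShortComplex.isoMk (S₁ := (ShortComplex.mk _ _ (E.ι_counit Y)).map E.q)
    (S₂ := ShortComplex.mk _ _ (E.σ_ρ Y)) (Iso.refl _) (E.ω.app (E.e.obj Y)) (Iso.refl _)
    (Category.id_comp _) ?_) h
  refine Eq.trans ?_ (Category.comp_id _).symm
  exact Iso.hom_inv_id_app_assoc E.ω (E.e.obj Y) (E.q.map (E.adj.counit.app Y))

/-- Objects such that the counit splits. -/
def RelProj (Y : C) : Prop := ∃ s : Y ⟶ E.l.obj (E.e.obj Y), s ≫ E.adj.counit.app Y = 𝟙 Y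

variable {E}

lemma RelProj.of_projective (P : C) [Projective P] : E.RelProj P :=
  ⟨Projective.factorThru (𝟙 P) (E.adj.counit.app P), Projective.factorThru_comp _ _⟩

/-- On `l X` the unit gives a section of the counit; it passes to retracts by naturality. -/
lemma RelProj.of_retract {Y : C} {X : D} (a : Y ⟶ E.l.obj X) (b : E.l.obj X ⟶ Y)
    (h : a ≫ b = 𝟙 Y) : E.RelProj Y := by
  refine ⟨a ≫ E.l.map (E.adj.unit.app X) ≫ E.l.map (E.e.map b), ?_⟩
  have := E.adj.counit.naturality b
  dsimp only [Functor.comp_map, Functor.comp_obj, Functor.id_map, Functor.id_obj] at this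
  rw [Category.assoc, Category.assoc, this, Adjunction.left_triangle_components_assoc, h]

lemma RelProj.exists_retraction {Y : C} (h : E.RelProj Y) :
    ∃ r : E.l.obj (E.e.obj Y) ⟶ E.κ.obj Y, E.ι Y ≫ r = 𝟙 _ := by
  obtain ⟨s, hs⟩ := h
  have hS := E.shortExact Y
  have := hS.mono_f
  exact ⟨_, (ShortComplex.Splitting.ofExactOfSection _ hS.exact s hs this).f_r⟩

/-- A section of the counit splits the whole sequence, so `κ Y` is a retract of `l e Y`. Hence all
iterates of `κ` on a projective stay in this class. -/
lemma RelProj.κ {Y : C} (h : E.RelProj Y) : E.RelProj (E.κ.obj Y) := by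
  obtain ⟨r, hr⟩ := h.exists_retraction
  exact .of_retract _ r hr

lemma RelProj.κ_iter {Y : C} (h : E.RelProj Y) (n : ℕ) : E.RelProj ((E.κ.iter n).obj Y) := by
  induction n with
  | zero => exact h
  | succ n ih => exact ih.κ

/-- The inclusion of `κ Y` splits and a split monomorphism survives `q`, although `q` is only right
exact. -/
lemma RelProj.mono_σ {Y : C} (h : E.RelProj Y) : Mono (E.σ.app Y) := by
  obtain ⟨r, hr⟩ := h.exists_retraction
  have : Mono (E.q.map (E.ι Y)) := by
    have : IsSplitMono (E.q.map (E.ι Y)) := ⟨⟨⟨E.q.map r, by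
      rw [← E.q.map_comp, hr, E.q.map_id]⟩⟩⟩
    infer_instance
  rw [σ_app]
  exact mono_comp _ _

variable (E)

/-- The iterates of `κ` in terms of those of `F`. -/
def κIterE : ∀ n : ℕ, E.κ.iter n ⋙ E.e ≅ E.e ⋙ E.F.iter n
  | 0 => Iso.refl _
  | n + 1 => Functor.associator _ _ _ ≪≫ Functor.isoWhiskerLeft (E.κ.iter n) E.κe ≪≫
      (Functor.associator _ _ _).symm ≪≫ Functor.isoWhiskerRight (κIterE n) E.F

lemma isZero_of_e {Y : C} (h : IsZero (E.e.obj Y)) : IsZero Y := by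
  rw [IsZero.iff_id_eq_zero]
  exact E.e.map_injective (h.eq_of_src _ _)

/-- Nakayama's lemma: `q Y = 0` implies `Y = 0`. -/
lemma isZero_of_q {n : ℕ} (hF : ∀ X, IsZero ((E.F.iter n).obj X)) {Y : C}
    (h : IsZero (E.q.obj Y)) : IsZero Y := by
  have : Epi (E.σ.app Y) := (E.σ_ρ_exact Y).epi_f (h.eq_of_tgt _ _)
  -- If `q Y = 0` then `σ` is an epimorphism, and so is `F e Y = e κ Y → q κ Y → e Y`. Iterating
  -- gives an epimorphism from `F^n e Y`, which is zero.
  let f : E.F.obj (E.e.obj Y) ⟶ E.e.obj Y := (E.κeApp Y).inv ≫ E.ρ.app (E.κ.obj Y) ≫ E.σ.app Y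
  have hf : Epi f := epi_comp' inferInstance (epi_comp' inferInstance this)
  have key (m : ℕ) : ∃ g : (E.F.iter m).obj (E.e.obj Y) ⟶ E.e.obj Y, Epi g := by
    induction m with
    | zero => exact ⟨𝟙 _, inferInstance⟩
    | succ m ih =>
      obtain ⟨g, hg⟩ := ih
      exact ⟨E.F.map g ≫ f, epi_comp' inferInstance hf⟩
  obtain ⟨g, hg⟩ := key n
  exact E.isZero_of_e (IsZero.of_epi g (hF _))

/-- `e l X` is an extension of `X` by `F X`, so injectivity of `f` and of `F f` gives it for `e l
f`. As the extension is only given for objects `e Y`, `f` is first written as `e (i f)`. -/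
lemma mono_l_map {A B : D} (f : A ⟶ B) [Mono f] [Mono (E.F.map f)] : Mono (E.l.map f) := by
  have h₁ : Mono (E.e.map (E.i.map f)) := by
    have := NatIso.naturality_2 E.retraction f
    dsimp only [Functor.comp_map, Functor.id_map] at this
    rw [← this]
    infer_instance
  have h₂ : Mono (E.F.map (E.e.map (E.i.map f))) := by
    have := NatIso.naturality_2 (Functor.isoWhiskerRight E.retraction E.F) f
    dsimp only [Functor.comp_map, Functor.id_map] at this
    rw [← this]
    infer_instance
  have h₃ : Mono (E.e.map (E.l.map (E.e.map (E.i.map f)))) := by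
    have hn := E.adj.counit.naturality (E.i.map f)
    dsimp only [Functor.comp_map, Functor.comp_obj, Functor.id_map, Functor.id_obj] at hn
    rw [Preadditive.mono_iff_cancel_zero]
    intro T x hx
    have hx' : x ≫ E.e.map (E.adj.counit.app (E.i.obj A)) = 0 := by
      rw [← cancel_mono (E.e.map (E.i.map f)), Category.assoc]
      refine (congrArg (x ≫ ·) (E.e.map_comp _ _).symm).trans ?_
      rw [← hn, E.e.map_comp, reassoc_of% hx, zero_comp, zero_comp]
    have := E.mono_j (E.i.obj A)
    have hy := (E.exact (E.i.obj A)).lift_f x hx'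
    dsimp at hy
    rw [← hy]
    convert zero_comp
    have := E.mono_j (E.i.obj B)
    rw [← cancel_mono (E.F.map (E.e.map (E.i.map f))), ← cancel_mono (E.j (E.i.obj B)),
      Category.assoc, E.j_naturality]
    refine (Category.assoc _ _ _).symm.trans ((congrArg (· ≫ _) hy).trans ?_)
    rw [hx, zero_comp, zero_comp]
  have h₄ : Mono (E.l.map (E.e.map (E.i.map f))) := E.e.mono_of_mono_map h₃
  have := NatIso.naturality_1 (Functor.isoWhiskerRight E.retraction E.l) f
  dsimp only [Functor.comp_map, Functor.id_map] at this
  rw [← this]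
  infer_instance

end ExtensionData

end

section

variable {C : Type u} [Category.{v} C] [Abelian C]

/-- If `X₃` is the cokernel of `X₁ → X₂`, then `X₃ ⊞ P` is the cokernel of `X₁ → X₂ ⊞ P`. -/
lemma FinProjDim.biprod {A : C} (hA : FinProjDim A) (P : C) [Projective P] :
    FinProjDim (A ⊞ P) := by
  induction hA with
  | of_projective Q _ => exact .of_projective _ inferInstance
  | of_shortExact S hS h₁ _ _ ih =>
    have := hS.mono_f
    have := hS.epi_g
    refine .of_shortExact (ShortComplex.mk (S.f ≫ biprod.inl) (biprod.map S.g (𝟙 P)) (by simp))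
      { exact := ?_, mono_f := mono_comp _ _, epi_g := by dsimp; infer_instance } h₁ ih
    rw [ShortComplex.exact_iff_exact_up_to_refinements]
    intro T x hx
    dsimp at x hx
    have h₁ : x ≫ biprod.snd = 0 := by simpa using hx =≫ biprod.snd
    have h₂ : (x ≫ biprod.fst) ≫ S.g = 0 := by simpa using hx =≫ biprod.fst
    refine ⟨T, 𝟙 T, inferInstance, hS.exact.lift _ h₂, ?_⟩
    apply biprod.hom_ext
    · simp
    · simp [h₁]

end

/-! ### Descending induction along the powers of the kernel functor `κ`. -/

section

variable {C : Type u} [Category.{v} C] [Abelian C] {D : Type u'} [Category.{v'} D] [Abelian D]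

namespace ExtensionData

/-- The sequence `0 → F P → e l P → P → 0` splits as `P` is projective. It is applied to `i P`,
since `P = e (i P)`. -/
lemma finProjDim_e_l (E : ExtensionData C D) (P : D) [Projective P]
    (h : FinProjDim (E.F.obj P)) : FinProjDim (E.e.obj (E.l.obj P)) := by
  let r := E.retraction.app P
  have : Projective (E.e.obj (E.i.obj P)) := Projective.of_iso r.symm inferInstance
  have := E.mono_j (E.i.obj P)
  have : Epi (E.e.map (E.adj.counit.app (E.i.obj P))) := inferInstance
  have hS : (ShortComplex.mk _ _ (E.zero (E.i.obj P))).ShortExact :=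
    { exact := E.exact _, mono_f := ‹_›, epi_g := ‹_› }
  have : Projective (ShortComplex.mk _ _ (E.zero (E.i.obj P))).X₃ := ‹Projective (E.e.obj _)›
  have hs := hS.splittingOfProjective
  exact ((h.of_iso (E.F.mapIso r.symm)).biprod (E.e.obj (E.i.obj P))).of_iso
    (hs.isoBinaryBiproduct.symm ≪≫ E.e.mapIso (E.l.mapIso r))

/-- The conditions on `F` under which `e` induces an equivalence between stable categories. -/
structure GorensteinConditions (E : ExtensionData C D) : Prop where
  nilpotent : ∃ n, ∀ X, IsZero ((E.F.iter n).obj X)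
  exactOnGProj_e (n : ℕ) : ExactOnGProj (E.e ⋙ E.F.iter n)
  exactOnGProj_F : ExactOnGProj E.F
  finProjDim_e (n : ℕ) {Y : C} (hY : gorensteinProjective C Y) :
    FinProjDim ((E.F.iter (n + 1)).obj (E.e.obj Y))
  finProjDim_F (P : D) [Projective P] : FinProjDim (E.F.obj P)
  finProjDim_l (n : ℕ) (P : D) [Projective P] : FinProjDim (E.l.obj ((E.F.iter n).obj P))

namespace GorensteinConditions

variable {E : ExtensionData C D} (h : E.GorensteinConditions)
include h

lemma exists_isZero_κ_iter : ∃ N, ∀ n, N ≤ n → ∀ Y, IsZero ((E.κ.iter n).obj Y) := by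
  obtain ⟨N, hN⟩ := h.nilpotent
  refine ⟨N, fun n hn Y => ?_⟩
  obtain ⟨m, rfl⟩ := Nat.exists_eq_add_of_le hn
  induction m with
  | zero => exact E.isZero_of_e ((hN _).of_iso ((E.κIterE N).app Y))
  | succ m ih => exact Functor.map_isZero E.κ (ih (by lia))

lemma exactOnGProj_κ_iter_e (n : ℕ) : ExactOnGProj (E.κ.iter n ⋙ E.e) :=
  .of_iso (E.κIterE n).symm (h.exactOnGProj_e n)

/-- Descending induction on `n` by `ExactOnGProj.cokernel`, applied to `q κ^{n+1} → e κ^n → q κ^n →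
0`. It starts where the power of `κ` vanishes; on projectives `σ` is split, hence injective. -/
lemma exactOnGProj_κ_iter_q (n : ℕ) : ExactOnGProj (E.κ.iter n ⋙ E.q) := by
  obtain ⟨N, hN⟩ := h.exists_isZero_κ_iter
  obtain hn | hn := le_total N n
  · exact .of_isZero fun Y => E.q.map_isZero (hN n hn Y)
  · induction hn using Nat.decreasingInduction with
    | self => exact .of_isZero fun Y => E.q.map_isZero (hN N le_rfl Y)
    | of_succ n _ ih =>
      have : PreservesFiniteColimits (E.κ.iter n ⋙ E.κ ⋙ E.q) :=
        have : PreservesFiniteColimits (E.κ ⋙ E.q) := comp_preservesFiniteColimits _ _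
        comp_preservesFiniteColimits _ _
      exact .cokernel (T₁ := E.κ.iter n ⋙ E.κ ⋙ E.q) (T₂ := E.κ.iter n ⋙ E.e) ih
        (h.exactOnGProj_κ_iter_e n) (Functor.whiskerLeft _ E.σ) (Functor.whiskerLeft _ E.ρ)
        (fun X => E.σ_ρ _) (fun X => E.σ_ρ_exact _)
        (fun X => inferInstanceAs (Epi (E.ρ.app ((E.κ.iter n).obj X))))
        (fun P _ => ((RelProj.of_projective P).κ_iter n).mono_σ)

lemma exactOnGProj_q : ExactOnGProj E.q := h.exactOnGProj_κ_iter_q 0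

lemma shortExact_σ_ρ (n : ℕ) {Y : C} (hY : gorensteinProjective C Y) :
    (ShortComplex.mk _ _ (E.σ_ρ ((E.κ.iter n).obj Y))).ShortExact :=
  { exact := E.σ_ρ_exact _
    mono_f := ExactOnGProj.mono_app (T₁ := E.κ.iter n ⋙ E.κ ⋙ E.q)
      (h.exactOnGProj_κ_iter_q (n + 1)) (Functor.whiskerLeft _ E.σ)
      (fun P _ => ((RelProj.of_projective P).κ_iter n).mono_σ) hY
    epi_g := inferInstanceAs (Epi (E.ρ.app _)) }

/-- In `0 → q κ^{n+2} Y → e κ^{n+1} Y → q κ^{n+1} Y → 0` the middle term is `F^{n+1} e Y`, of finite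
projective dimension. The power `n + 1` is needed: nothing of the sort holds for `q Y` itself. -/
lemma finProjDim_q_κ {Y : C} (hY : gorensteinProjective C Y) (n : ℕ) :
    FinProjDim (E.q.obj ((E.κ.iter (n + 1)).obj Y)) := by
  obtain ⟨N, hN⟩ := h.exists_isZero_κ_iter
  have h0 (Z : C) (hZ : IsZero Z) : FinProjDim (E.q.obj Z) :=
    .of_projective _ (Projective.of_iso (E.q.map_isZero hZ).isoZero.symm inferInstance)
  obtain hn | hn := le_total N n
  · exact h0 _ (hN _ (by lia) Y)
  · induction hn using Nat.decreasingInduction with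
    | self => exact h0 _ (hN _ (by lia) Y)
    | of_succ n _ ih =>
      exact .of_shortExact _ (h.shortExact_σ_ρ (n + 1) hY) ih
        ((h.finProjDim_e n hY).of_iso ((E.κIterE (n + 1)).symm.app Y))

lemma finProjDim_kernel_ρ {Y : C} (hY : gorensteinProjective C Y) :
    FinProjDim (kernel (E.ρ.app Y)) :=
  (h.finProjDim_q_κ hY 0).of_iso
    ((h.shortExact_σ_ρ 0 hY).fIsKernel.conePointUniqueUpToIso (limit.isLimit _))

/-- Iterating the counit sequence resolves `i P` by the objects `l e κ^n (i P) = l F^n P`, and the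
resolution stops by nilpotency. -/
lemma finProjDim_i (P : D) [Projective P] : FinProjDim (E.i.obj P) := by
  obtain ⟨N, hN⟩ := h.exists_isZero_κ_iter
  suffices ∀ n ≤ N, FinProjDim ((E.κ.iter n).obj (E.i.obj P)) from this 0 (Nat.zero_le _)
  intro n hn
  induction hn using Nat.decreasingInduction with
  | self => exact .of_projective _ (Projective.of_iso (hN N le_rfl _).isoZero.symm inferInstance)
  | of_succ n _ ih =>
    exact .of_shortExact _ (E.shortExact _) ih ((h.finProjDim_l n P).of_iso
      (E.l.mapIso ((E.κIterE n).app (E.i.obj P) ≪≫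
        (E.F.iter n).mapIso (E.retraction.app P)).symm))

lemma exactOnGProj_l : ExactOnGProj E.l := fun S hS h₃ =>
  have := hS.mono_f
  have := h.exactOnGProj_F S hS h₃
  E.mono_l_map S.f

end GorensteinConditions

end ExtensionData

end

end CategoryTheory

end

/-! ### The stable equivalence given by `q`. -/

noncomputable section

namespace CategoryTheory

variable {C : Type u} [Category.{v} C] [Abelian C] {D : Type u'} [Category.{v'} D] [Abelian D]

namespace ExtensionData

variable {E : ExtensionData C D}

/-- The adjunct of `s` is invertible under `q`. By Nakayama its cokernel vanishes; then `hq` keeps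
the kernel inclusion injective under `q`, so `q` of the kernel is zero and Nakayama applies again.
-/
lemma isIso_adjunct {n : ℕ} (hF : ∀ X, IsZero ((E.F.iter n).obj X)) {Y : C}
    (hq : ∀ S : ShortComplex C, S.ShortExact → ∀ (_ : S.X₃ = Y), Mono (E.q.map S.f))
    (s : E.q.obj Y ⟶ E.e.obj Y) (hs : s ≫ E.ρ.app Y = 𝟙 _) :
    IsIso (E.l.map s ≫ E.adj.counit.app Y) := by
  set φ := E.l.map s ≫ E.adj.counit.app Y with hφ
  have hqφ : IsIso (E.q.map φ) := by
    have : E.q.map φ = (E.ω.app (E.q.obj Y)).hom := by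
      rw [hφ, q_map_adjunct', hs]
      exact Category.comp_id _
    rw [this]
    infer_instance
  have hepi : Epi φ := by
    have : IsZero (cokernel φ) := by
      refine E.isZero_of_q hF ?_
      rw [IsZero.iff_id_eq_zero, ← cancel_epi (E.q.map (cokernel.π φ)), ← cancel_epi (E.q.map φ)]
      simp [← Functor.map_comp]
    exact Preadditive.epi_of_cokernel_zero (this.eq_of_tgt _ _)
  have hmono : Mono φ := by
    have hm : Mono (E.q.map (kernel.ι φ)) := hq (ShortComplex.mk (kernel.ι φ) φ
      (kernel.condition φ)) { exact := ShortComplex.exact_kernel φ } rfl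
    have : IsZero (kernel φ) := by
      refine E.isZero_of_q hF ?_
      rw [IsZero.iff_id_eq_zero, ← cancel_mono (E.q.map (kernel.ι φ)), ← cancel_mono (E.q.map φ)]
      simp [← Functor.map_comp]
    exact Preadditive.mono_of_kernel_zero (this.eq_of_src _ _)
  exact isIso_of_mono_of_epi φ

instance (P : C) [Projective P] : Projective (E.q.obj P) := E.adj'.map_projective P inferInstance

instance (P : D) [Projective P] : Projective (E.l.obj P) := E.adj.map_projective P inferInstance

namespace GorensteinConditions

variable (h : E.GorensteinConditions)
include h

/-- The condition on the right adjoint of `q` is that inflations of projectives have finite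
projective dimension. -/
lemma preservesGProj_q : PreservesGProj E.q where
  gorenstein hY := h.exactOnGProj_q.gorensteinProjective_map (fun _ _ => inferInstance) E.adj'
    (fun Q _ => h.finProjDim_i Q) hY
  projective P _ := inferInstance
  shortExact hS h₃ := h.exactOnGProj_q.map_shortExact hS h₃

/-- `q Y` is Gorenstein projective and the kernel of `ρ` has finite projective dimension, so the
identity of `q Y` lifts. -/
lemma exists_section {Y : C} (hY : gorensteinProjective C Y) :
    ∃ s : E.q.obj Y ⟶ E.e.obj Y, s ≫ E.ρ.app Y = 𝟙 _ :=
  FinProjDim.exists_lift (S := ShortComplex.mk _ _ (kernel.condition (E.ρ.app Y)))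
    { exact := ShortComplex.exact_kernel _, epi_g := inferInstanceAs (Epi (E.ρ.app Y)) }
    (h.finProjDim_kernel_ρ hY) (h.preservesGProj_q.gorenstein hY) (𝟙 _)

lemma exists_isIso_adjunct {Y : C} (hY : gorensteinProjective C Y) :
    ∃ s : E.q.obj Y ⟶ E.e.obj Y, s ≫ E.ρ.app Y = 𝟙 _ ∧
      IsIso (E.l.map s ≫ E.adj.counit.app Y) := by
  obtain ⟨n, hn⟩ := h.nilpotent
  obtain ⟨s, hs⟩ := h.exists_section hY
  exact ⟨s, hs, isIso_adjunct hn (fun S hS e => h.exactOnGProj_q S hS (by rwa [e])) s hs⟩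

/-- `P ≅ l q P`, so `e P ≅ e l (q P)`, with `q P` projective. -/
lemma finProjDim_e_obj (P : C) [Projective P] : FinProjDim (E.e.obj P) := by
  obtain ⟨n, hn⟩ := h.nilpotent
  let s := Projective.factorThru (𝟙 (E.q.obj P)) (E.ρ.app P)
  -- For a projective end term the exact sequence splits, so injectivity under `q` needs no
  -- Gorenstein argument.
  have := isIso_adjunct hn (fun S hS e => by
    subst e
    have : Projective S.X₃ := ‹_›
    have := hS.splittingOfProjective
    have : IsSplitMono (E.q.map S.f) := ⟨⟨⟨E.q.map this.r, by
      rw [← E.q.map_comp, this.f_r, E.q.map_id]⟩⟩⟩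
    infer_instance) s (Projective.factorThru_comp _ _)
  exact (E.finProjDim_e_l (E.q.obj P) (h.finProjDim_F _)).of_iso (E.e.mapIso (asIso
    (E.l.map s ≫ E.adj.counit.app P)))

lemma gorensteinProjective_l {X : D} (hX : gorensteinProjective D X) :
    gorensteinProjective C (E.l.obj X) :=
  h.exactOnGProj_l.gorensteinProjective_map (fun _ _ => inferInstance) E.adj
    (fun Q _ => h.finProjDim_e_obj Q) hX

/-- Faithfulness. The map `g = s ≫ e d` lifts `q d` along `ρ`, and differs from a map through `P` by
one into the kernel of `ρ`; that one factors through a projective `Q`. So `g` factors through `P ⊞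
Q`, and `d`, recovered from `l g` by `Y ≅ l q Y`, factors through `l (P ⊞ Q)`. -/
lemma factors {Y Z : C} (hY : gorensteinProjective C Y) (hZ : gorensteinProjective C Z)
    (d : Y ⟶ Z) {P : D} [Projective P] (u : E.q.obj Y ⟶ P) (v : P ⟶ E.q.obj Z)
    (huv : E.q.map d = u ≫ v) : ∃ (Q : C) (_ : Projective Q) (a : Y ⟶ Q) (b : Q ⟶ Z),
      d = a ≫ b := by
  obtain ⟨s, hs, _⟩ := h.exists_isIso_adjunct hY
  let v' := Projective.factorThru v (E.ρ.app Z)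
  have hv' : v' ≫ E.ρ.app Z = v := Projective.factorThru_comp _ _
  let g := s ≫ E.e.map d
  have hg : (g - u ≫ v') ≫ E.ρ.app Z = 0 := by
    rw [Preadditive.sub_comp, Category.assoc, Category.assoc, hv', E.ρ.naturality,
      reassoc_of% hs, huv, sub_self]
  obtain ⟨Q, _, a, b, hab⟩ := (h.finProjDim_kernel_ρ hZ).exists_factor
    (h.preservesGProj_q.gorenstein hY) (kernel.lift _ _ hg)
  have hg' : g = biprod.lift u a ≫ biprod.desc v' (b ≫ kernel.ι (E.ρ.app Z)) := by
    rw [biprod.lift_desc, reassoc_of% hab, kernel.lift_ι]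
    abel
  refine ⟨E.l.obj (P ⊞ Q), inferInstance, inv (E.l.map s ≫ E.adj.counit.app Y) ≫
    E.l.map (biprod.lift u a), E.l.map (biprod.desc v' (b ≫ kernel.ι (E.ρ.app Z))) ≫
      E.adj.counit.app Z, ?_⟩
  rw [Category.assoc, IsIso.eq_inv_comp, ← Functor.map_comp_assoc, ← hg', Category.assoc,
    Functor.map_comp_assoc]
  exact congrArg (E.l.map s ≫ ·) (E.adj.counit.naturality d).symm

/-- Fullness holds before stabilising: conjugate `l g` by the isomorphisms `l q Y ≅ Y` and `l q Z ≅
Z`. -/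
lemma exists_preimage {Y Z : C} (hY : gorensteinProjective C Y) (hZ : gorensteinProjective C Z)
    (g : E.q.obj Y ⟶ E.q.obj Z) : ∃ f : Y ⟶ Z, E.q.map f = g := by
  obtain ⟨s, hs, _⟩ := h.exists_isIso_adjunct hY
  obtain ⟨t, ht, _⟩ := h.exists_isIso_adjunct hZ
  refine ⟨inv (E.l.map s ≫ E.adj.counit.app Y) ≫ E.l.map g ≫ E.l.map t ≫ E.adj.counit.app Z, ?_⟩
  rw [Functor.map_comp, Functor.map_inv, IsIso.inv_comp_eq, E.q_map_adjunct', hs,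
    ← Functor.map_comp_assoc, E.q_map_adjunct', Category.assoc, ht]
  exact (congrArg (E.ω.hom.app (E.q.obj Y) ≫ ·) (Category.comp_id g)).trans
    (congrArg (· ≫ g) (Category.comp_id (E.ω.hom.app (E.q.obj Y)))).symm

lemma isEquivalence_functor_q : h.preservesGProj_q.functor.IsEquivalence where
  faithful := ⟨by
    intro X Y f f' hff'
    obtain ⟨f, rfl⟩ := (StableGProj.proj C).map_surjective f
    obtain ⟨f', rfl⟩ := (StableGProj.proj C).map_surjective f'
    obtain ⟨P, _, u, v, huv⟩ := StableGProj.stableRel_of_map_eq hff'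
    exact StableGProj.proj_map_eq (h.factors X.as.property Y.as.property (f.hom - f'.hom) u v
      (E.q.map_sub.trans huv))⟩
  full := ⟨by
    intro X Y g
    obtain ⟨g, rfl⟩ := (StableGProj.proj D).map_surjective g
    obtain ⟨f, hf⟩ := h.exists_preimage X.as.property Y.as.property g.hom
    refine ⟨(StableGProj.proj C).map (ObjectProperty.homMk f), ?_⟩
    rw [PreservesGProj.functor_map_proj_map]
    congr 1
    ext
    exact hf⟩
  essSurj := ⟨fun X => ⟨⟨⟨E.l.obj X.as.obj, h.gorensteinProjective_l X.as.property⟩⟩,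
    ⟨(StableGProj.proj D).mapIso (ObjectProperty.isoMk _ (E.ω.app X.as.obj))⟩⟩⟩

/-- Under the given conditions, `e` induces an equivalence between stable categories of Gorenstein
projectives. -/
theorem inducesStableTriangleEquivalence : InducesStableTriangleEquivalence E.e :=
  h.preservesGProj_q.inducesStableTriangleEquivalence (fun P _ => h.finProjDim_e_obj P) E.ρ
    (fun _ _ => inferInstance) (fun _ hY => h.finProjDim_kernel_ρ hY) h.isEquivalence_functor_q

end GorensteinConditions

end ExtensionData

end CategoryTheory

end

noncomputable section

/-! ### Direct summands of finite powers. -/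

section FinRetract

variable (R : Type u) [Ring R]

/-- `X` is a direct summand of a finite direct sum of copies of `Z`. -/
def FinRetract (Z : Type v) (X : Type w) [AddCommGroup Z] [Module R Z] [AddCommGroup X]
    [Module R X] : Prop :=
  ∃ (n : ℕ) (φ : Fin n → X →ₗ[R] Z) (s : Fin n → Z →ₗ[R] X), ∀ x, ∑ i, s i (φ i x) = x

variable {R} {Z : Type v} {X : Type w} [AddCommGroup Z] [Module R Z] [AddCommGroup X]
    [Module R X] 

lemma FinRetract.of_fintype {ι : Type*} [Fintype ι] (φ : ι → X →ₗ[R] Z) (s : ι → Z →ₗ[R] X)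
    (h : ∀ x, ∑ i, s i (φ i x) = x) : FinRetract R Z X := by
  refine ⟨Fintype.card ι, fun a => φ ((Fintype.equivFin ι).symm a),
    fun a => s ((Fintype.equivFin ι).symm a), fun x => ?_⟩
  conv_rhs => rw [← h x]
  exact Equiv.sum_comp (Fintype.equivFin ι).symm (fun i => s i (φ i x))

lemma FinRetract.trans {Y : Type v'} [AddCommGroup Y] [Module R Y] (h : FinRetract R Z X)
    (h' : FinRetract R X Y) : FinRetract R Z Y := by
  obtain ⟨n, φ, s, h⟩ := h
  obtain ⟨m, φ', s', h'⟩ := h'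
  refine .of_fintype (ι := Fin n × Fin m) (fun a => φ a.1 ∘ₗ φ' a.2) (fun a => s' a.2 ∘ₗ s a.1)
    fun x => ?_
  rw [Fintype.sum_prod_type_right]
  conv_rhs => rw [← h' x]
  refine Finset.sum_congr rfl fun j _ => ?_
  conv_rhs => rw [← h (φ' j x), map_sum]
  rfl

lemma FinRetract.pi (n : ℕ) : FinRetract R Z (Fin n → Z) :=
  ⟨n, LinearMap.proj, LinearMap.single R (fun _ => Z), fun x => by
    simp [Finset.univ_sum_single]⟩

lemma FinRetract.of_retract (φ : X →ₗ[R] Z) (s : Z →ₗ[R] X) (h : ∀ x, s (φ x) = x) :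
    FinRetract R Z X :=
  ⟨1, fun _ => φ, fun _ => s, by simpa using h⟩

lemma FinRetract.of_finite_projective [Module.Finite R X] [Module.Projective R X] :
    FinRetract R R X := by
  obtain ⟨n, f, hf⟩ := Module.Finite.exists_fin' R X
  obtain ⟨g, hg⟩ := Module.projective_lifting_property f LinearMap.id hf
  exact (FinRetract.pi n).trans (.of_retract g f (fun x => congr($hg x)))

end FinRetract

/-! ### Tensor products over a noncommutative ring: right exactness, units, associativity. -/

namespace NCTensor

variable {Γ : Type u} [Ring Γ]

section

variable {X : Type u} [AddCommGroup X] [Module Γᵐᵒᵖ X] {N : Type u} [AddCommGroup N] [Module Γ N]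

@[elab_as_elim]
lemma induction_on {P : NCTensor Γ X N → Prop} (t : NCTensor Γ X N) (zero : P 0)
    (tmul : ∀ x n, P (tmul Γ x n)) (add : ∀ a b, P a → P b → P (a + b)) : P t := by
  obtain ⟨t, rfl⟩ := QuotientAddGroup.mk_surjective t
  induction t with
  | zero => exact zero
  | tmul x n => exact tmul x n
  | add a b ha hb => exact add _ _ ha hb

lemma zero_tmul (n : N) : tmul Γ (0 : X) n = 0 := by simp [tmul]

lemma tmul_zero (x : X) : tmul Γ x (0 : N) = 0 := by simp [tmul]

variable (Γ X N) in
/-- The biadditive map `(x, n) ↦ x ⊗ n`. -/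
def tmulHom : X →+ N →+ NCTensor Γ X N where
  toFun x := { toFun := tmul Γ x, map_zero' := tmul_zero x, map_add' := tmul_add Γ x }
  map_zero' := by ext n; exact zero_tmul n
  map_add' x y := by ext n; exact add_tmul Γ x y n

@[simp] lemma tmulHom_apply (x : X) (n : N) : tmulHom Γ X N x n = tmul Γ x n := rfl

variable {A : Type*} [AddCommGroup A]

/-- The universal property of the tensor product. -/
def lift (f : X →+ N →+ A) (h : ∀ x (γ : Γ) n, f (op γ • x) n = f x (γ • n)) :
    NCTensor Γ X N →+ A :=
  QuotientAddGroup.lift _ (TensorProduct.liftAddHom f (fun r x n => by simp)) (by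
    rw [balancedSubgroup, AddSubgroup.closure_le]
    rintro _ ⟨x, γ, n, rfl⟩
    simp [AddMonoidHom.mem_ker, h])

@[simp] lemma lift_tmul (f : X →+ N →+ A) (h : ∀ x (γ : Γ) n, f (op γ • x) n = f x (γ • n))
    (x : X) (n : N) : lift f h (tmul Γ x n) = f x n := rfl

end

section Map

variable {X X' X'' : Type u} [AddCommGroup X] [Module Γᵐᵒᵖ X] [AddCommGroup X'] [Module Γᵐᵒᵖ X']
  [AddCommGroup X''] [Module Γᵐᵒᵖ X''] {N N' N'' : Type u} [AddCommGroup N] [Module Γ N]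
  [AddCommGroup N'] [Module Γ N'] [AddCommGroup N''] [Module Γ N'']

lemma map_map (f : X →ₗ[Γᵐᵒᵖ] X') (f' : X' →ₗ[Γᵐᵒᵖ] X'') (g : N →ₗ[Γ] N') (g' : N' →ₗ[Γ] N'')
    (t : NCTensor Γ X N) : map f' g' (map f g t) = map (f' ∘ₗ f) (g' ∘ₗ g) t :=
  DFunLike.congr_fun (hom_ext (f := (map f' g').comp (map f g)) (g := map (f' ∘ₗ f) (g' ∘ₗ g))
    fun _ _ => rfl) t

lemma map_id (t : NCTensor Γ X N) : map LinearMap.id LinearMap.id t = t :=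
  DFunLike.congr_fun (hom_ext (f := map (LinearMap.id : X →ₗ[Γᵐᵒᵖ] X) (LinearMap.id : N →ₗ[Γ] N))
    (g := AddMonoidHom.id _) fun _ _ => rfl) t

lemma map_comm (f : X →ₗ[Γᵐᵒᵖ] X') (g : N →ₗ[Γ] N') (t : NCTensor Γ X N) :
    map LinearMap.id g (map f LinearMap.id t) = map f LinearMap.id (map LinearMap.id g t) := by
  rw [map_map, map_map]; rfl

lemma map_add_left (f f' : X →ₗ[Γᵐᵒᵖ] X') (g : N →ₗ[Γ] N') (t : NCTensor Γ X N) :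
    map (f + f') g t = map f g t + map f' g t :=
  DFunLike.congr_fun (hom_ext (f := map (f + f') g) (g := map f g + map f' g)
    fun _ _ => add_tmul Γ _ _ _) t

lemma map_add_right (f : X →ₗ[Γᵐᵒᵖ] X') (g g' : N →ₗ[Γ] N') (t : NCTensor Γ X N) :
    map f (g + g') t = map f g t + map f g' t :=
  DFunLike.congr_fun (hom_ext (f := map f (g + g')) (g := map f g + map f g')
    fun _ _ => tmul_add Γ _ _ _) t

lemma map_zero_left (g : N →ₗ[Γ] N') (t : NCTensor Γ X N) :
    map (0 : X →ₗ[Γᵐᵒᵖ] X') g t = 0 :=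
  DFunLike.congr_fun (hom_ext (f := map (0 : X →ₗ[Γᵐᵒᵖ] X') g) (g := 0)
    fun _ _ => zero_tmul _) t

lemma map_zero_right (f : X →ₗ[Γᵐᵒᵖ] X') (t : NCTensor Γ X N) :
    map f (0 : N →ₗ[Γ] N') t = 0 :=
  DFunLike.congr_fun (hom_ext (f := map f (0 : N →ₗ[Γ] N')) (g := 0)
    fun _ _ => tmul_zero _) t

lemma map_sum_left {ι : Type*} (s : Finset ι) (f : ι → X →ₗ[Γᵐᵒᵖ] X') (g : N →ₗ[Γ] N')
    (t : NCTensor Γ X N) : map (∑ i ∈ s, f i) g t = ∑ i ∈ s, map (f i) g t := by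
  classical
  induction s using Finset.induction_on with
  | empty => simpa using map_zero_left g t
  | insert a s ha ih => rw [Finset.sum_insert ha, Finset.sum_insert ha, map_add_left, ih]

lemma map_sum_right {ι : Type*} (s : Finset ι) (f : X →ₗ[Γᵐᵒᵖ] X') (g : ι → N →ₗ[Γ] N')
    (t : NCTensor Γ X N) : map f (∑ i ∈ s, g i) t = ∑ i ∈ s, map f (g i) t := by
  classical
  induction s using Finset.induction_on with
  | empty => simpa using map_zero_right f t
  | insert a s ha ih => rw [Finset.sum_insert ha, Finset.sum_insert ha, map_add_right, ih]

lemma map_surjective (f : X →ₗ[Γᵐᵒᵖ] X') (g : N →ₗ[Γ] N') (hf : Function.Surjective f)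
    (hg : Function.Surjective g) : Function.Surjective (map f g) := fun t => by
  induction t using induction_on with
  | zero => exact ⟨0, map_zero _⟩
  | tmul x n =>
    obtain ⟨x, rfl⟩ := hf x
    obtain ⟨n, rfl⟩ := hg n
    exact ⟨tmul Γ x n, rfl⟩
  | add a b ha hb =>
    obtain ⟨a, rfl⟩ := ha
    obtain ⟨b, rfl⟩ := hb
    exact ⟨a + b, map_add _ _ _⟩

-- The quotient map to `(X' ⊗ N) / im (f ⊗ N)` factors through `g ⊗ N`: it descends along the
-- surjection `g` in the first variable and stays balanced. So the kernel of `g ⊗ N` is in the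
-- image.
variable (N) in
lemma exact_map_left (f : X →ₗ[Γᵐᵒᵖ] X') (g : X' →ₗ[Γᵐᵒᵖ] X'') (h : Function.Exact f g)
    (hg : Function.Surjective g) : Function.Exact (map f (LinearMap.id : N →ₗ[Γ] N))
      (map g (LinearMap.id : N →ₗ[Γ] N)) := by
  intro t
  constructor
  · intro ht
    let π := QuotientAddGroup.mk' (map f (LinearMap.id : N →ₗ[Γ] N)).range
    let φ : X' →+ N →+ NCTensor Γ X' N ⧸ (map f (LinearMap.id : N →ₗ[Γ] N)).range :=
      (AddMonoidHom.compHom π).comp (tmulHom Γ X' N)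
    have hφ : g.toAddMonoidHom.ker ≤ φ.ker := fun x hx => by
      obtain ⟨y, rfl⟩ := (h x).1 hx
      ext n
      exact (QuotientAddGroup.eq_zero_iff _).2 ⟨tmul Γ y n, rfl⟩
    let ψ := g.toAddMonoidHom.liftOfRightInverse _ (Function.rightInverse_surjInv hg) ⟨φ, hφ⟩
    have hψ (x : X') : ψ (g x) = φ x := AddMonoidHom.liftOfRightInverse_comp_apply _ _ _ ⟨φ, hφ⟩ x
    let Ψ := lift ψ (fun x γ n => by
      obtain ⟨x, rfl⟩ := hg x
      rw [← map_smul, hψ, hψ]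
      exact congrArg π (smul_tmul Γ x γ n))
    have : Ψ.comp (map g LinearMap.id) = π := hom_ext fun x n => DFunLike.congr_fun (hψ x) n
    have h0 : π t = 0 := by
      rw [← this, AddMonoidHom.comp_apply, ht, _root_.map_zero]
    exact (QuotientAddGroup.eq_zero_iff _).1 h0
  · rintro ⟨t, rfl⟩
    have : g ∘ₗ f = 0 := LinearMap.ext fun x => h.apply_apply_eq_zero x
    rw [map_map, this, map_zero_left]

variable (X) in
lemma exact_map_right (f : N →ₗ[Γ] N') (g : N' →ₗ[Γ] N'') (h : Function.Exact f g)
    (hg : Function.Surjective g) : Function.Exact (map (LinearMap.id : X →ₗ[Γᵐᵒᵖ] X) f)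
      (map (LinearMap.id : X →ₗ[Γᵐᵒᵖ] X) g) := by
  intro t
  constructor
  · intro ht
    let π := QuotientAddGroup.mk' (map (LinearMap.id : X →ₗ[Γᵐᵒᵖ] X) f).range
    let φ : N' →+ X →+ NCTensor Γ X N' ⧸ (map (LinearMap.id : X →ₗ[Γᵐᵒᵖ] X) f).range :=
      (AddMonoidHom.compHom π).comp (tmulHom Γ X N').flip
    have hφ : g.toAddMonoidHom.ker ≤ φ.ker := fun x hx => by
      obtain ⟨y, rfl⟩ := (h x).1 hx
      ext n
      exact (QuotientAddGroup.eq_zero_iff _).2 ⟨tmul Γ n y, rfl⟩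
    let ψ := g.toAddMonoidHom.liftOfRightInverse _ (Function.rightInverse_surjInv hg) ⟨φ, hφ⟩
    have hψ (x : N') : ψ (g x) = φ x := AddMonoidHom.liftOfRightInverse_comp_apply _ _ _ ⟨φ, hφ⟩ x
    let Ψ := lift ψ.flip (fun x γ n => by
      obtain ⟨n, rfl⟩ := hg n
      rw [← map_smul, AddMonoidHom.flip_apply, AddMonoidHom.flip_apply, hψ, hψ]
      exact congrArg π (smul_tmul Γ x γ n))
    have : Ψ.comp (map LinearMap.id g) = π := hom_ext fun x n => DFunLike.congr_fun (hψ n) x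
    have h0 : π t = 0 := by
      rw [← this, AddMonoidHom.comp_apply, ht, _root_.map_zero]
    exact (QuotientAddGroup.eq_zero_iff _).1 h0
  · rintro ⟨t, rfl⟩
    have : g ∘ₗ f = 0 := LinearMap.ext fun x => h.apply_apply_eq_zero x
    rw [map_map, this, map_zero_right]

end Map

section Unit

/-- `X ⊗_Γ Γ = X`. -/
def rid (X : Type u) [AddCommGroup X] [Module Γᵐᵒᵖ X] : NCTensor Γ X Γ ≃+ X :=
  AddMonoidHom.toAddEquiv
    (lift (AddMonoidHom.mk' (fun x => AddMonoidHom.mk' (fun γ => op γ • x)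
      (fun a b => by rw [MulOpposite.op_add, add_smul])) (fun x y => by ext; simp))
      (fun x γ n => by simp [mul_smul]))
    ((tmulHom Γ X Γ).flip 1)
    (hom_ext fun x γ => (smul_tmul Γ x γ 1).trans (congrArg (tmul Γ x) (mul_one γ)))
    (by ext x; simp)

/-- `Γ ⊗_Γ N = N`. -/
def lid (N : Type u) [AddCommGroup N] [Module Γ N] : NCTensor Γ Γ N ≃+ N :=
  AddMonoidHom.toAddEquiv
    (lift (AddMonoidHom.mk' (fun γ => AddMonoidHom.mk' (fun n => γ • n)
      (fun a b => smul_add _ _ _)) (fun x y => by ext; simp [add_smul]))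
      (fun x γ n => by simp [mul_smul]))
    (tmulHom Γ Γ N 1)
    (hom_ext fun γ n => (smul_tmul Γ (1 : Γ) γ n).symm.trans (congrArg (tmul Γ · n) (one_mul γ)))
    (by ext x; simp)

@[simp] lemma rid_tmul {X : Type u} [AddCommGroup X] [Module Γᵐᵒᵖ X] (x : X) (γ : Γ) :
    rid X (tmul Γ x γ) = op γ • x := rfl

@[simp] lemma lid_tmul {N : Type u} [AddCommGroup N] [Module Γ N] (γ : Γ) (n : N) :
    lid N (tmul Γ γ n) = γ • n := rfl

variable {X X' : Type u} [AddCommGroup X] [Module Γᵐᵒᵖ X] [AddCommGroup X'] [Module Γᵐᵒᵖ X']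
  {N N' : Type u} [AddCommGroup N] [Module Γ N] [AddCommGroup N'] [Module Γ N']

lemma rid_map (f : X →ₗ[Γᵐᵒᵖ] X') (t : NCTensor Γ X Γ) :
    rid X' (map f LinearMap.id t) = f (rid X t) :=
  DFunLike.congr_fun (hom_ext (f := (rid X').toAddMonoidHom.comp (map f LinearMap.id))
    (g := f.toAddMonoidHom.comp (rid X).toAddMonoidHom) fun x γ => (map_smul f (op γ) x).symm) t

lemma lid_map (f : N →ₗ[Γ] N') (t : NCTensor Γ Γ N) :
    lid N' (map LinearMap.id f t) = f (lid N t) :=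
  DFunLike.congr_fun (hom_ext (f := (lid N').toAddMonoidHom.comp (map LinearMap.id f))
    (g := f.toAddMonoidHom.comp (lid N).toAddMonoidHom) fun γ n => (map_smul f γ n).symm) t

lemma map_left_injective_self (f : X →ₗ[Γᵐᵒᵖ] X') (hf : Function.Injective f) :
    Function.Injective (map f (LinearMap.id : Γ →ₗ[Γ] Γ)) := fun a b h =>
  (rid X).injective (hf (by rw [← rid_map, ← rid_map, h]))

lemma map_right_injective_self (f : N →ₗ[Γ] N') (hf : Function.Injective f) :
    Function.Injective (map (LinearMap.id : Γ →ₗ[Γᵐᵒᵖ] Γ) f) := fun a b h =>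
  (lid N).injective (hf (by rw [← lid_map, ← lid_map, h]))

end Unit

section Retract

variable {X X' : Type u} [AddCommGroup X] [Module Γᵐᵒᵖ X] [AddCommGroup X'] [Module Γᵐᵒᵖ X']
  {N N' : Type u} [AddCommGroup N] [Module Γ N] [AddCommGroup N'] [Module Γ N']

/-- The identity of `N'` is `∑ s i ∘ φ i`, and `N' → N` under each `φ i` sends an element killed by
`f ⊗ N'` to one killed by `f ⊗ N`. -/
lemma map_left_injective_of_finRetract {f : X →ₗ[Γᵐᵒᵖ] X'} (h : FinRetract Γ N N')
    (hf : Function.Injective (map f (LinearMap.id : N →ₗ[Γ] N))) :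
    Function.Injective (map f (LinearMap.id : N' →ₗ[Γ] N')) := by
  obtain ⟨n, φ, s, h⟩ := h
  rw [injective_iff_map_eq_zero]
  intro t ht
  have h1 : (LinearMap.id : N' →ₗ[Γ] N') = ∑ i, s i ∘ₗ φ i := by
    ext x
    simpa using (h x).symm
  have h3 : t = map LinearMap.id (∑ i, s i ∘ₗ φ i) t := by rw [← h1, map_id]
  rw [h3, map_sum_right]
  refine Finset.sum_eq_zero fun i _ => ?_
  have h2 : map LinearMap.id (φ i) t = 0 := by
    apply hf
    rw [← map_comm, ht, _root_.map_zero, _root_.map_zero]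
  have := map_map (LinearMap.id : X →ₗ[Γᵐᵒᵖ] X) LinearMap.id (φ i) (s i) t
  rw [h2, _root_.map_zero] at this
  exact this.symm

lemma map_right_injective_of_finRetract {f : N →ₗ[Γ] N'} (h : FinRetract Γᵐᵒᵖ X X')
    (hf : Function.Injective (map (LinearMap.id : X →ₗ[Γᵐᵒᵖ] X) f)) :
    Function.Injective (map (LinearMap.id : X' →ₗ[Γᵐᵒᵖ] X') f) := by
  obtain ⟨n, φ, s, h⟩ := h
  rw [injective_iff_map_eq_zero]
  intro t ht
  have h1 : (LinearMap.id : X' →ₗ[Γᵐᵒᵖ] X') = ∑ i, s i ∘ₗ φ i := by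
    ext x
    simpa using (h x).symm
  have h3 : t = map (∑ i, s i ∘ₗ φ i) LinearMap.id t := by rw [← h1, map_id]
  rw [h3, map_sum_left]
  refine Finset.sum_eq_zero fun i _ => ?_
  have h2 : map (φ i) LinearMap.id t = 0 := by
    apply hf
    rw [map_comm, ht, _root_.map_zero, _root_.map_zero]
  have := map_map (φ i) (s i) (LinearMap.id : N →ₗ[Γ] N) LinearMap.id t
  rw [h2, _root_.map_zero] at this
  exact this.symm

lemma map_right_injective_prod {f : N →ₗ[Γ] N'}
    (hf : Function.Injective (map (LinearMap.id : X →ₗ[Γᵐᵒᵖ] X) f))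
    (hf' : Function.Injective (map (LinearMap.id : X' →ₗ[Γᵐᵒᵖ] X') f)) :
    Function.Injective (map (LinearMap.id : X × X' →ₗ[Γᵐᵒᵖ] X × X') f) := by
  rw [injective_iff_map_eq_zero]
  intro t ht
  have h1 : (LinearMap.id : X × X' →ₗ[Γᵐᵒᵖ] X × X') =
      LinearMap.inl _ _ _ ∘ₗ LinearMap.fst _ _ _ + LinearMap.inr _ _ _ ∘ₗ LinearMap.snd _ _ _ := by
    ext <;> simp
  have h2 : map (LinearMap.fst Γᵐᵒᵖ X X') LinearMap.id t = 0 := by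
    apply hf
    rw [map_comm, ht, _root_.map_zero, _root_.map_zero]
  have h3 : map (LinearMap.snd Γᵐᵒᵖ X X') LinearMap.id t = 0 := by
    apply hf'
    rw [map_comm, ht, _root_.map_zero, _root_.map_zero]
  have h4 := map_map (LinearMap.fst Γᵐᵒᵖ X X') (LinearMap.inl Γᵐᵒᵖ X X')
    (LinearMap.id : N →ₗ[Γ] N) LinearMap.id t
  have h5 := map_map (LinearMap.snd Γᵐᵒᵖ X X') (LinearMap.inr Γᵐᵒᵖ X X')
    (LinearMap.id : N →ₗ[Γ] N) LinearMap.id t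
  rw [h2, _root_.map_zero] at h4
  rw [h3, _root_.map_zero] at h5
  rw [← map_id t, h1, map_add_left]
  exact (congr($h4.symm + $h5.symm)).trans (add_zero 0)

lemma map_left_injective {f : X →ₗ[Γᵐᵒᵖ] X'} (hf : Function.Injective f)
    (h : FinRetract Γ Γ N) : Function.Injective (map f (LinearMap.id : N →ₗ[Γ] N)) :=
  map_left_injective_of_finRetract h (map_left_injective_self f hf)

lemma map_right_injective {f : N →ₗ[Γ] N'} (hf : Function.Injective f)
    (h : FinRetract Γᵐᵒᵖ Γ X) : Function.Injective (map (LinearMap.id : X →ₗ[Γᵐᵒᵖ] X) f) :=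
  map_right_injective_of_finRetract h (map_right_injective_self f hf)

end Retract

section Assoc

variable {X X' : Type u} [AddCommGroup X] [Module Γᵐᵒᵖ X] [AddCommGroup X'] [Module Γᵐᵒᵖ X']
  {M M' : Type u} [AddCommGroup M] [Module Γ M] [Module Γᵐᵒᵖ M] [SMulCommClass Γ Γᵐᵒᵖ M]
  {N N' : Type u} [AddCommGroup N] [Module Γ N] [AddCommGroup N'] [Module Γ N']

variable (X M N) in
/-- The associativity isomorphism. -/
def assocHom : NCTensor Γ (NCTensor Γ X M) N →+ NCTensor Γ X (NCTensor Γ M N) :=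
  lift (lift (AddMonoidHom.mk' (fun x => (AddMonoidHom.compHom (tmulHom Γ X _ x)).comp
      (tmulHom Γ M N)) (fun x y => by ext m n; exact add_tmul Γ _ _ _))
      (fun x γ m => by ext n; exact smul_tmul Γ _ _ _))
    (fun t γ n => by
      induction t using induction_on with
      | zero => simp
      | tmul x m => exact congrArg (tmul Γ x) (smul_tmul Γ m γ n)
      | add a b ha hb => rw [smul_add, map_add, map_add, AddMonoidHom.add_apply,
          AddMonoidHom.add_apply, ha, hb])

variable (X M N) in
/-- The inverse of the associativity isomorphism. -/
def assocInv : NCTensor Γ X (NCTensor Γ M N) →+ NCTensor Γ (NCTensor Γ X M) N :=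
  lift (AddMonoidHom.flip (lift (AddMonoidHom.mk'
      (fun m => ((tmulHom Γ (NCTensor Γ X M) N).comp ((tmulHom Γ X M).flip m)).flip)
      (fun a b => by
        ext n x
        exact (congrArg (tmul Γ · n) (tmul_add Γ x a b)).trans (add_tmul Γ _ _ _)))
      (fun m γ n => by ext x; exact smul_tmul Γ (tmul Γ x m) γ n)))
    (fun x γ t => by
      induction t using induction_on with
      | zero => simp
      | tmul m n => exact congrArg (tmul Γ · n) (smul_tmul Γ x γ m)
      | add a b ha hb => rw [smul_add, map_add, map_add, ha, hb])

variable (X M N) in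
/-- The associativity isomorphism. -/
def assoc : NCTensor Γ (NCTensor Γ X M) N ≃+ NCTensor Γ X (NCTensor Γ M N) :=
  AddMonoidHom.toAddEquiv (assocHom X M N) (assocInv X M N)
    (hom_ext fun t n => by
      induction t using induction_on with
      | zero => simp [zero_tmul]
      | tmul x m => rfl
      | add a b ha hb => rw [add_tmul, map_add, map_add, ha, hb])
    (hom_ext fun x t => by
      induction t using induction_on with
      | zero => simp [tmul_zero]
      | tmul x m => rfl
      | add a b ha hb => rw [tmul_add, map_add, map_add, ha, hb])

/-- `M ⊗ g` as a map of left modules. -/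
def mapLeft (M : Type u) [AddCommGroup M] [Module Γ M] [Module Γᵐᵒᵖ M] [SMulCommClass Γ Γᵐᵒᵖ M]
    (g : N →ₗ[Γ] N') : NCTensor Γ M N →ₗ[Γ] NCTensor Γ M N' where
  toFun := map LinearMap.id g
  map_add' := map_add _
  map_smul' γ t := DFunLike.congr_fun (hom_ext (f := (map LinearMap.id g).comp
    (DistribSMul.toAddMonoidHom (NCTensor Γ M N) γ))
    (g := (DistribSMul.toAddMonoidHom (NCTensor Γ M N') γ).comp (map LinearMap.id g))
    fun _ _ => rfl) t

/-- `f ⊗ g` as a map of right modules. -/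
def mapRight [Module Γᵐᵒᵖ N] [SMulCommClass Γ Γᵐᵒᵖ N] [Module Γᵐᵒᵖ N'] [SMulCommClass Γ Γᵐᵒᵖ N']
    (f : X →ₗ[Γᵐᵒᵖ] X') (g : N →ₗ[Γ] N') (hg : ∀ (γ : Γᵐᵒᵖ) n, g (γ • n) = γ • g n) :
    NCTensor Γ X N →ₗ[Γᵐᵒᵖ] NCTensor Γ X' N' where
  toFun := map f g
  map_add' := map_add _
  map_smul' γ t := DFunLike.congr_fun (hom_ext (f := (map f g).comp
    (DistribSMul.toAddMonoidHom (NCTensor Γ X N) γ))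
    (g := (DistribSMul.toAddMonoidHom (NCTensor Γ X' N') γ).comp (map f g))
    fun x n => congrArg (tmul Γ (f x)) (hg γ n)) t

lemma map_assoc (g : N →ₗ[Γ] N') (t : NCTensor Γ (NCTensor Γ X M) N) :
    map LinearMap.id (mapLeft M g) (assoc X M N t) = assoc X M N' (map LinearMap.id g t) :=
  DFunLike.congr_fun (hom_ext (f := (map LinearMap.id (mapLeft M g)).comp
    (assoc X M N).toAddMonoidHom) (g := (assoc X M N').toAddMonoidHom.comp (map LinearMap.id g))
    (fun t n => by
      induction t using induction_on with
      | zero => simp [zero_tmul]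
      | tmul x m => rfl
      | add a b ha hb => rw [add_tmul, map_add, map_add, ha, hb])) t

/-- Associativity is natural in the last variable, so injectivity can be tested with either
bracketing. -/
lemma map_tensor_injective_iff (X M : Type u) [AddCommGroup X] [Module Γᵐᵒᵖ X] [AddCommGroup M]
    [Module Γ M] [Module Γᵐᵒᵖ M] [SMulCommClass Γ Γᵐᵒᵖ M] (g : N →ₗ[Γ] N') :
    Function.Injective (map (LinearMap.id : NCTensor Γ X M →ₗ[Γᵐᵒᵖ] NCTensor Γ X M) g) ↔
      Function.Injective (map (LinearMap.id : X →ₗ[Γᵐᵒᵖ] X) (mapLeft M g)) := by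
  have : (map LinearMap.id (mapLeft M g) : _ → _) ∘ assoc X M N =
      assoc X M N' ∘ map LinearMap.id g := funext (map_assoc g)
  rw [← (assoc X M N').injective.of_comp_iff, ← this]
  exact (assoc X M N).toEquiv.injective_comp _

end Assoc

end NCTensor

end

noncomputable section

lemma AddMonoidHom.injective_of_ladder {A₁ A₂ A₃ B₁ B₂ B₃ C₁ C₂ : Type*} [AddCommGroup A₁]
    [AddCommGroup A₂] [AddCommGroup A₃] [AddCommGroup B₁] [AddCommGroup B₂] [AddCommGroup B₃]
    [AddCommGroup C₁] [AddCommGroup C₂] {a : A₁ →+ A₂} {a' : A₂ →+ A₃} {b : B₁ →+ B₂}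
    {b' : B₂ →+ B₃} {c : C₁ →+ C₂} {f₁ : A₁ →+ B₁} {f₂ : A₂ →+ B₂} {f₃ : A₃ →+ B₃}
    {g₁ : B₁ →+ C₁} {g₂ : B₂ →+ C₂} (wa : ∀ x, a' (a x) = 0) (ha' : Function.Surjective a')
    (hb : Function.Exact b b') (h₁ : Function.Exact f₁ g₁) (w₂ : ∀ x, g₂ (f₂ x) = 0)
    (hf₂ : Function.Injective f₂) (hc : Function.Injective c) (e₁ : ∀ x, f₂ (a x) = b (f₁ x))
    (e₂ : ∀ x, f₃ (a' x) = b' (f₂ x)) (e₃ : ∀ x, g₂ (b x) = c (g₁ x)) :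
    Function.Injective f₃ := by
  rw [injective_iff_map_eq_zero]
  intro t ht
  obtain ⟨y, rfl⟩ := ha' t
  rw [e₂] at ht
  obtain ⟨z, hz⟩ := (hb _).1 ht
  have hz' : g₁ z = 0 := hc (by rw [← e₃, hz, w₂, map_zero])
  obtain ⟨w, rfl⟩ := (h₁ _).1 hz'
  obtain rfl : a w = y := hf₂ (by rw [e₁, hz])
  exact wa w

/-! ### Bimodule resolutions and Tor vanishing without derived functors. -/

open NCTensor

/-- A sequence of short exact sequences of bimodules `0 → Ω (i + 1) → R i → Ω i → 0`
with `R i`, and eventually `Ω i`, projective on either side. -/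
structure BimoduleResolution (Γ : Type u) [Ring Γ] where
  Ω : ℕ → BimoduleObj Γ
  R : ℕ → BimoduleObj Γ
  incl (i : ℕ) : (Ω (i + 1)).carrier →ₗ[Γ] (R i).carrier
  incl_smul (i : ℕ) (γ : Γᵐᵒᵖ) (x : (Ω (i + 1)).carrier) : incl i (γ • x) = γ • incl i x
  proj (i : ℕ) : (R i).carrier →ₗ[Γ] (Ω i).carrier
  proj_smul (i : ℕ) (γ : Γᵐᵒᵖ) (x : (R i).carrier) : proj i (γ • x) = γ • proj i x
  injective (i : ℕ) : Function.Injective (incl i)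
  exact (i : ℕ) : Function.Exact (incl i) (proj i)
  surjective (i : ℕ) : Function.Surjective (proj i)
  finite_Ω (i : ℕ) : Module.Finite Γᵐᵒᵖ (Ω i).carrier
  finite_R (i : ℕ) : Module.Finite Γᵐᵒᵖ (R i).carrier
  left_R (i : ℕ) : FinRetract Γ Γ (R i).carrier
  right_R (i : ℕ) : FinRetract Γᵐᵒᵖ Γ (R i).carrier
  tensor_R (i : ℕ) (V : Type u) [AddCommGroup V] [Module Γᵐᵒᵖ V] [Module.Finite Γᵐᵒᵖ V] :
    FinRetract Γᵐᵒᵖ Γ (NCTensor Γ V (R i).carrier)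
  length : ℕ
  left_Ω : FinRetract Γ Γ (Ω length).carrier
  tensor_Ω (V : Type u) [AddCommGroup V] [Module Γᵐᵒᵖ V] [Module.Finite Γᵐᵒᵖ V] :
    FinRetract Γᵐᵒᵖ Γ (NCTensor Γ V (Ω length).carrier)

namespace BimoduleResolution

variable {Γ : Type u} [Ring Γ] (D : BimoduleResolution Γ)

/-- The inclusion as a map of right modules. -/
def inclR (i : ℕ) : (D.Ω (i + 1)).carrier →ₗ[Γᵐᵒᵖ] (D.R i).carrier :=
  { (D.incl i).toAddMonoidHom with map_smul' := D.incl_smul i }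

/-- The projection as a map of right modules. -/
def projR (i : ℕ) : (D.R i).carrier →ₗ[Γᵐᵒᵖ] (D.Ω i).carrier :=
  { (D.proj i).toAddMonoidHom with map_smul' := D.proj_smul i }

lemma exactR (i : ℕ) : Function.Exact (D.inclR i) (D.projR i) := D.exact i

lemma surjectiveR (i : ℕ) : Function.Surjective (D.projR i) := D.surjective i

lemma injectiveR (i : ℕ) : Function.Injective (D.inclR i) := D.injective i

/-- The maps `Ω (i + 1) ⊗ N → R i ⊗ N` are injective. -/
def LeftVanishing (N : Type u) [AddCommGroup N] [Module Γ N] : Prop :=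
  ∀ i, Function.Injective (map (D.inclR i) (LinearMap.id : N →ₗ[Γ] N))

/-- The maps `X ⊗ Ω (i + 1) → X ⊗ R i` are injective. -/
def RightVanishing (X : Type u) [AddCommGroup X] [Module Γᵐᵒᵖ X] : Prop :=
  ∀ i, Function.Injective (map (LinearMap.id : X →ₗ[Γᵐᵒᵖ] X) (D.incl i))

variable {D}

section

variable {N' N'' N : Type u} [AddCommGroup N'] [Module Γ N'] [AddCommGroup N''] [Module Γ N'']
  [AddCommGroup N] [Module Γ N] {f : N' →ₗ[Γ] N''} {g : N'' →ₗ[Γ] N}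

lemma LeftVanishing.of_finRetract (h : D.LeftVanishing N') (h' : FinRetract Γ N' N) :
    D.LeftVanishing N := fun i => map_left_injective_of_finRetract h' (h i)

variable (D) in
lemma leftVanishing_self : D.LeftVanishing Γ := fun i =>
  map_left_injective_self _ (D.injectiveR i)

/-- Balance of `Tor₁`: the hypothesis is `Tor₁(Ω i, N) = 0` computed from the resolution, the
conclusion is its consequence for sequences ending in `N`. The ladder uses that `R i ⊗ -` preserves
injections, `R i` being projective on the right. -/
lemma LeftVanishing.injective_map (h : D.LeftVanishing N) (hf : Function.Injective f)
    (hfg : Function.Exact f g) (hg : Function.Surjective g) (i : ℕ) :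
    Function.Injective (map (LinearMap.id : (D.Ω i).carrier →ₗ[Γᵐᵒᵖ] (D.Ω i).carrier) f) :=
  AddMonoidHom.injective_of_ladder
    (a := map (D.inclR i) (LinearMap.id : N' →ₗ[Γ] N'))
    (a' := map (D.projR i) (LinearMap.id : N' →ₗ[Γ] N'))
    (b := map (D.inclR i) (LinearMap.id : N'' →ₗ[Γ] N''))
    (b' := map (D.projR i) (LinearMap.id : N'' →ₗ[Γ] N''))
    (c := map (D.inclR i) (LinearMap.id : N →ₗ[Γ] N))
    (f₁ := map LinearMap.id f) (f₂ := map LinearMap.id f)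
    (g₁ := map LinearMap.id g) (g₂ := map LinearMap.id g)
    (exact_map_left N' _ _ (D.exactR i) (D.surjectiveR i)).apply_apply_eq_zero
    (map_surjective _ _ (D.surjectiveR i) Function.surjective_id)
    (exact_map_left N'' _ _ (D.exactR i) (D.surjectiveR i))
    (exact_map_right _ _ _ hfg hg) (exact_map_right _ _ _ hfg hg).apply_apply_eq_zero
    (map_right_injective hf (D.right_R i)) (h i)
    (map_comm _ _) (map_comm _ _) (map_comm _ _)

/-- `Ω (i+1) ⊗ N' → Ω (i+1) ⊗ N'' → R i ⊗ N''` is injective by the two hypotheses, and it factors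
through the map in question. -/
lemma LeftVanishing.of_exact (h : D.LeftVanishing N) (h'' : D.LeftVanishing N'')
    (hf : Function.Injective f) (hfg : Function.Exact f g) (hg : Function.Surjective g) :
    D.LeftVanishing N' := fun i => by
  have : Function.Injective (map LinearMap.id f ∘ map (D.inclR i) (LinearMap.id : N' →ₗ[Γ] N')) :=
    fun a b hab => (h'' i).comp (h.injective_map hf hfg hg (i + 1)) (by
      simpa only [Function.comp_apply, map_comm] using hab)
  exact this.of_comp

end

section

variable {X' X'' X : Type u} [AddCommGroup X'] [Module Γᵐᵒᵖ X'] [AddCommGroup X'']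
  [Module Γᵐᵒᵖ X''] [AddCommGroup X] [Module Γᵐᵒᵖ X] {f : X' →ₗ[Γᵐᵒᵖ] X''} {g : X'' →ₗ[Γᵐᵒᵖ] X}

lemma RightVanishing.of_finRetract (h : D.RightVanishing X') (h' : FinRetract Γᵐᵒᵖ X' X) :
    D.RightVanishing X := fun i => map_right_injective_of_finRetract h' (h i)

variable (D) in
lemma rightVanishing_self : D.RightVanishing Γ := fun i =>
  map_right_injective_self _ (D.injective i)

/-- The mirror image, now using that `- ⊗ R i` preserves injections since `R i` is projective on the
left. -/
lemma RightVanishing.injective_map (h : D.RightVanishing X) (hf : Function.Injective f)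
    (hfg : Function.Exact f g) (hg : Function.Surjective g) (i : ℕ) :
    Function.Injective (map f (LinearMap.id : (D.Ω i).carrier →ₗ[Γ] (D.Ω i).carrier)) :=
  AddMonoidHom.injective_of_ladder
    (a := map (LinearMap.id : X' →ₗ[Γᵐᵒᵖ] X') (D.incl i))
    (a' := map (LinearMap.id : X' →ₗ[Γᵐᵒᵖ] X') (D.proj i))
    (b := map (LinearMap.id : X'' →ₗ[Γᵐᵒᵖ] X'') (D.incl i))
    (b' := map (LinearMap.id : X'' →ₗ[Γᵐᵒᵖ] X'') (D.proj i))
    (c := map (LinearMap.id : X →ₗ[Γᵐᵒᵖ] X) (D.incl i))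
    (f₁ := map f LinearMap.id) (f₂ := map f LinearMap.id)
    (g₁ := map g LinearMap.id) (g₂ := map g LinearMap.id)
    (exact_map_right X' _ _ (D.exact i) (D.surjective i)).apply_apply_eq_zero
    (map_surjective _ _ Function.surjective_id (D.surjective i))
    (exact_map_right X'' _ _ (D.exact i) (D.surjective i))
    (exact_map_left _ _ _ hfg hg) (exact_map_left _ _ _ hfg hg).apply_apply_eq_zero
    (map_left_injective hf (D.left_R i)) (h i)
    (fun x => (map_comm _ _ x).symm) (fun x => (map_comm _ _ x).symm)
    (fun x => (map_comm _ _ x).symm)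

lemma RightVanishing.of_exact (h : D.RightVanishing X) (h'' : D.RightVanishing X'')
    (hf : Function.Injective f) (hfg : Function.Exact f g) (hg : Function.Surjective g) :
    D.RightVanishing X' := fun i => by
  have : Function.Injective (map f LinearMap.id ∘
      map (LinearMap.id : X' →ₗ[Γᵐᵒᵖ] X') (D.incl i)) :=
    fun a b hab => (h'' i).comp (h.injective_map hf hfg hg (i + 1)) (by
      simpa only [Function.comp_apply, map_comm] using hab)
  exact this.of_comp

end

end BimoduleResolution

section TensorLeft

variable {Γ : Type u} [Ring Γ] (M : Type u) [AddCommGroup M] [Module Γ M] [Module Γᵐᵒᵖ M]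
  [SMulCommClass Γ Γᵐᵒᵖ M]

namespace NCTensor

/-- The functor `M ⊗_Γ -` on left modules. -/
def tensorLeft : ModuleCat.{u} Γ ⥤ ModuleCat.{u} Γ where
  obj N := ModuleCat.of Γ (NCTensor Γ M N)
  map f := ModuleCat.ofHom (mapLeft M f.hom)
  map_id N := by
    ext t
    exact map_id t
  map_comp f g := by
    ext t
    exact (map_map LinearMap.id LinearMap.id f.hom g.hom t).symm

/-- `iter` adds the new factor at the end; with this equality it can also be split off at the start.
-/
lemma _root_.CategoryTheory.Functor.comp_iter {C : Type*} [Category C] (F : C ⥤ C) (n : ℕ) :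
    F ⋙ F.iter n = F.iter n ⋙ F := by
  induction n with
  | zero => rfl
  | succ n ih => exact congrArg (· ⋙ F) ih

lemma finRetract_tensorLeft {N N' : Type u} [AddCommGroup N] [Module Γ N] [AddCommGroup N']
    [Module Γ N'] (h : FinRetract Γ N N') : FinRetract Γ (NCTensor Γ M N) (NCTensor Γ M N') := by
  obtain ⟨n, φ, s, h⟩ := h
  refine ⟨n, fun i => mapLeft M (φ i), fun i => mapLeft M (s i), fun t => ?_⟩
  have h1 : (LinearMap.id : N' →ₗ[Γ] N') = ∑ i, s i ∘ₗ φ i := by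
    ext x
    simpa using (h x).symm
  have h3 : t = map LinearMap.id (∑ i, s i ∘ₗ φ i) t := by rw [← h1, map_id]
  conv_rhs => rw [h3, map_sum_right]
  exact Finset.sum_congr rfl fun i _ => map_map _ _ _ _ t

lemma finRetract_tensorLeft_iter {N N' : ModuleCat.{u} Γ} (h : FinRetract Γ N N') (n : ℕ) :
    FinRetract Γ (((tensorLeft M).iter n).obj N) (((tensorLeft M).iter n).obj N') := by
  induction n with
  | zero => exact h
  | succ n ih => exact finRetract_tensorLeft M ih

lemma finRetract_tensorLeft_self : FinRetract Γ M ((tensorLeft M).obj (ModuleCat.of Γ Γ)) :=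
  .of_retract { (rid M).toAddMonoidHom with
      map_smul' := fun γ t => DFunLike.congr_fun (hom_ext
        (f := (rid M).toAddMonoidHom.comp (DistribSMul.toAddMonoidHom (NCTensor Γ M Γ) γ))
        (g := (DistribSMul.toAddMonoidHom M γ).comp (rid M).toAddMonoidHom)
        fun x γ' => (smul_comm γ (op γ') x).symm) t }
    { (rid M).symm.toAddMonoidHom with map_smul' := fun γ x => rfl }
    (rid M).symm_apply_apply

lemma tensorLeft_iter_obj (n : ℕ) : ((tensorLeft M).iter n).obj (ModuleCat.of Γ M) =
    ModuleCat.of Γ (bimodulePow Γ M (n + 1)).carrier := by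
  induction n with
  | zero => rfl
  | succ n ih => exact congrArg (tensorLeft M).obj ih

end NCTensor

end TensorLeft

namespace BimoduleResolution

variable {Γ : Type u} [Ring Γ] (D : BimoduleResolution Γ)

/-- The bimodule which is resolved. -/
abbrev M : Type u := (D.Ω 0).carrier

/-- Vanishing for all tensor powers. -/
def PowVanishing : Prop := ∀ j, D.LeftVanishing (bimodulePow Γ D.M (j + 1)).carrier

variable {D} (h : D.PowVanishing)
include h

lemma PowVanishing.iter_M (j : ℕ) :
    D.LeftVanishing (((tensorLeft D.M).iter j).obj (ModuleCat.of Γ D.M)) := by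
  rw [tensorLeft_iter_obj]
  exact h j

/-- `R i` is a summand of a power of `Γ`, so its tensor with `M^{⊗ j}` is a summand of a power of
`M^{⊗ j}`, or of `Γ` when `j = 0`. -/
lemma PowVanishing.iter_R (i j : ℕ) :
    D.LeftVanishing (((tensorLeft D.M).iter j).obj (ModuleCat.of Γ (D.R i).carrier)) := by
  cases j with
  | zero => exact D.leftVanishing_self.of_finRetract (D.left_R i)
  | succ j =>
    have h₁ := finRetract_tensorLeft_iter D.M (N := ModuleCat.of Γ D.M)
      (finRetract_tensorLeft_self D.M) j
    have h₂ : D.LeftVanishing ((tensorLeft D.M ⋙ (tensorLeft D.M).iter j).obj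
      (ModuleCat.of Γ Γ)) := (h.iter_M j).of_finRetract h₁
    rw [Functor.comp_iter] at h₂
    exact h₂.of_finRetract (finRetract_tensorLeft_iter D.M (N := ModuleCat.of Γ Γ)
      (N' := ModuleCat.of Γ (D.R i).carrier) (D.left_R i) (j + 1))

/-- The iterated tensor products of the given exact sequences are exact. -/
lemma PowVanishing.exact_iter (j : ℕ) : ∀ i,
    Function.Injective (((tensorLeft D.M).iter j).map (ModuleCat.ofHom (D.incl i))) ∧
    Function.Exact (((tensorLeft D.M).iter j).map (ModuleCat.ofHom (D.incl i)))
      (((tensorLeft D.M).iter j).map (ModuleCat.ofHom (D.proj i))) ∧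
    Function.Surjective (((tensorLeft D.M).iter j).map (ModuleCat.ofHom (D.proj i))) := by
  induction j with
  | zero => exact fun i => ⟨D.injective i, D.exact i, D.surjective i⟩
  | succ j ih =>
    -- For fixed `j`, vanishing spreads from `Ω 0 = M` to all syzygies, `M^{⊗ j} ⊗ Ω (i+1)` being
    -- the kernel of `M^{⊗ j} ⊗ R i → M^{⊗ j} ⊗ Ω i`. Tensoring once more with `M` is then exact.
    have key (i : ℕ) : D.LeftVanishing
        (((tensorLeft D.M).iter j).obj (ModuleCat.of Γ (D.Ω i).carrier)) := by
      induction i with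
      | zero => exact h.iter_M j
      | succ i ih' => exact ih'.of_exact (h.iter_R i j) (ih i).1 (ih i).2.1 (ih i).2.2
    exact fun i => ⟨(key i).injective_map (ih i).1 (ih i).2.1 (ih i).2.2 0,
      exact_map_right D.M _ _ (ih i).2.1 (ih i).2.2,
      map_surjective _ _ Function.surjective_id (ih i).2.2⟩

/-- The iterated tensor products remain exact after tensoring with a summand of a finite sum of
copies of `Γ ⊕ M`. -/
lemma PowVanishing.injective_iter (V : Type u) [AddCommGroup V] [Module Γᵐᵒᵖ V]
    (hV : FinRetract Γᵐᵒᵖ (Γ × D.M) V) (i j : ℕ) :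
    Function.Injective (map (LinearMap.id : V →ₗ[Γᵐᵒᵖ] V)
      (((tensorLeft D.M).iter j).map (ModuleCat.ofHom (D.incl i))).hom) :=
  map_right_injective_of_finRetract hV (map_right_injective_prod
    (map_right_injective_self _ (h.exact_iter j i).1) (h.exact_iter (j + 1) i).1)

end BimoduleResolution

end

/-! ### From vanishing of the derived functor Tor to injectivity along a spliced resolution. -/

noncomputable section

namespace CategoryTheory

section

variable {C : Type u} [Category.{v} C] [Abelian C] {Ω R : ℕ → C} (f : ∀ i, Ω (i + 1) ⟶ R i)
  (g : ∀ i, R i ⟶ Ω i) (w : ∀ i, f i ≫ g i = 0)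

include w in
lemma splice_comp (i : ℕ) : (g (i + 2) ≫ f (i + 1)) ≫ g (i + 1) ≫ f i = 0 := by
  simp [reassoc_of% (w (i + 1))]

/-- The complex obtained by splicing short exact sequences. -/
def spliceComplex : ChainComplex C ℕ :=
  ChainComplex.of R (fun i => g (i + 1) ≫ f i) (splice_comp f g w)

@[simp] lemma spliceComplex_X (i : ℕ) : (spliceComplex f g w).X i = R i := rfl

lemma spliceComplex_d (i : ℕ) :
    ((spliceComplex f g w).d (i + 1) i : R (i + 1) ⟶ R i) = g (i + 1) ≫ f i :=
  ChainComplex.of_d R (fun i => g (i + 1) ≫ f i) i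

variable (h : ∀ i, (ShortComplex.mk (f i) (g i) (w i)).ShortExact)

include h in
lemma spliceComplex_exact_zero : (ShortComplex.mk (g 1 ≫ f 0) (g 0) (by simp [w])).Exact := by
  have := (h 1).epi_g
  let φ : ShortComplex.mk (g 1 ≫ f 0) (g 0) (by simp [w]) ⟶ ShortComplex.mk (f 0) (g 0) (w 0) :=
    { τ₁ := g 1, τ₂ := 𝟙 _, τ₃ := 𝟙 _ }
  have : Epi φ.τ₁ := (h 1).epi_g
  exact (ShortComplex.exact_iff_of_epi_of_isIso_of_mono φ).2 (h 0).exact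

include h in
lemma spliceComplex_exact_succ (i : ℕ) : (ShortComplex.mk _ _ (splice_comp f g w i)).Exact := by
  let φ : ShortComplex.mk (g (i + 2) ≫ f (i + 1)) (g (i + 1)) (by simp [w]) ⟶
      ShortComplex.mk _ _ (splice_comp f g w i) :=
    { τ₁ := 𝟙 _, τ₂ := 𝟙 _, τ₃ := f i }
  have : Mono φ.τ₃ := (h i).mono_f
  exact (ShortComplex.exact_iff_of_epi_of_isIso_of_mono φ).1
    (spliceComplex_exact_zero (fun j => f (i + 1 + j)) (fun j => g (i + 1 + j))
      (fun j => w (i + 1 + j)) (fun j => h (i + 1 + j)))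

/-- The projective resolution obtained by splicing short exact sequences. -/
def spliceResolution [∀ i, Projective (R i)] : ProjectiveResolution (Ω 0) where
  complex := spliceComplex f g w
  projective n := inferInstanceAs (Projective (R n))
  π := (ChainComplex.toSingle₀Equiv _ _).symm ⟨g 0,
    (congrArg (· ≫ g 0) (spliceComplex_d f g w 0)).trans
      ((Category.assoc _ _ _).trans ((congrArg (g 1 ≫ ·) (w 0)).trans comp_zero))⟩
  quasiIso := ⟨fun n => by
    cases n with
    | zero =>
      rw [ChainComplex.quasiIsoAt₀_iff, ShortComplex.quasiIso_iff_of_zeros' _ rfl rfl rfl]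
      have := (h 0).epi_g
      refine (ShortComplex.exact_and_epi_g_iff_of_iso (S₂ := ShortComplex.mk (g 1 ≫ f 0) (g 0)
        (by simp [w])) ?_).2 ⟨spliceComplex_exact_zero f g w h, this⟩
      refine ShortComplex.isoMk (Iso.refl _) (Iso.refl _) (Iso.refl _) ?_ ?_
      · refine (Category.id_comp _).trans (Eq.trans ?_ (Category.comp_id _).symm)
        exact (spliceComplex_d f g w 0).symm
      · refine (Category.id_comp _).trans (Eq.trans ?_ (Category.comp_id _).symm)
        exact (ChainComplex.toSingle₀Equiv_symm_apply_f_zero (C := spliceComplex f g w) (g 0) _).symm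
    | succ n =>
      rw [quasiIsoAt_iff_exactAt']
      · rw [HomologicalComplex.exactAt_iff' _ (n + 1 + 1) (n + 1) n (by simp) (by simp)]
        simp only [HomologicalComplex.sc', HomologicalComplex.shortComplexFunctor', spliceComplex_d]
        exact spliceComplex_exact_succ f g w h n
      · exact ChainComplex.exactAt_succ_single_obj _ _⟩

include h in
lemma exact_map_splice_of_isZero_leftDerived [∀ i, Projective (R i)] [EnoughProjectives C]
    {D : Type u'} [Category.{v'} D] [Abelian D] (F : C ⥤ D) [F.Additive] (i : ℕ)
    (hF : IsZero ((F.leftDerived (i + 1)).obj (Ω 0))) :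
    ((ShortComplex.mk _ _ (splice_comp f g w i)).map F).Exact := by
  have := hF.of_iso ((spliceResolution f g w h).isoLeftDerivedObj F (i + 1)).symm
  change IsZero (HomologicalComplex.homology _ _) at this
  rw [← HomologicalComplex.exactAt_iff_isZero_homology,
    HomologicalComplex.exactAt_iff' _ (i + 1 + 1) (i + 1) i (by simp) (by simp)] at this
  have e : F.map ((spliceComplex f g w).d (i + 2) (i + 1)) = F.map (g (i + 2) ≫ f (i + 1)) :=
    congrArg F.map (spliceComplex_d f g w (i + 1))
  have e' : F.map ((spliceComplex f g w).d (i + 1) i) = F.map (g (i + 1) ≫ f i) :=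
    congrArg F.map (spliceComplex_d f g w i)
  let S : ShortComplex D := ShortComplex.mk (F.map ((spliceComplex f g w).d (i + 2) (i + 1)))
    (F.map ((spliceComplex f g w).d (i + 1) i)) ((F.map_comp _ _).symm.trans
      ((congrArg F.map ((spliceComplex f g w).d_comp_d _ _ _)).trans (F.map_zero _ _)))
  have hS : S.Exact := this
  let S' := (ShortComplex.mk _ _ (splice_comp f g w i)).map F
  have e : S.f = S'.f := congrArg F.map (spliceComplex_d f g w (i + 1))
  have e' : S.g = S'.g := congrArg F.map (spliceComplex_d f g w i)
  exact ShortComplex.exact_of_iso (S₁ := S) (S₂ := S')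
    (ShortComplex.isoMk (Iso.refl _) (Iso.refl _) (Iso.refl _)
    ((Category.id_comp _).trans (e.symm.trans (Category.comp_id _).symm))
    ((Category.id_comp _).trans (e'.symm.trans (Category.comp_id _).symm))) hS

end

end CategoryTheory

lemma FinRetract.projective {R : Type u} [Ring R] {X : Type v} [AddCommGroup X] [Module R X]
    {Z : Type w} [AddCommGroup Z] [Module R Z] [Module.Projective R Z]
    (h : FinRetract R Z X) : Module.Projective R X := by
  obtain ⟨n, φ, s, h⟩ := h
  have : Module.Projective R (Fin n → Z) := .of_equiv
    (DFinsupp.linearEquivFunOnFintype (R := R) (M := fun _ : Fin n => Z))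
  refine Module.Projective.of_split (LinearMap.pi φ) (∑ i, s i ∘ₗ LinearMap.proj i) ?_
  ext x
  simpa using h x

lemma projective_mulOpposite_self (Γ : Type u) [Ring Γ] : Module.Projective Γᵐᵒᵖ Γ :=
  Module.Projective.of_equiv (show Γᵐᵒᵖ ≃ₗ[Γᵐᵒᵖ] Γ from
    { toFun := unop, invFun := op, map_add' := fun _ _ => rfl, map_smul' := fun _ _ => rfl })

namespace BimoduleResolution

open NCTensor

variable {Γ : Type u} [Ring Γ] (D : BimoduleResolution Γ)

lemma shortExactR (i : ℕ) : (ShortComplex.mk (ModuleCat.ofHom (D.inclR i))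
    (ModuleCat.ofHom (D.projR i)) (by
      ext x; exact (D.exactR i).apply_apply_eq_zero x)).ShortExact where
  exact := (ShortComplex.ShortExact.moduleCat_exact_iff_function_exact _).2 (D.exactR i)
  mono_f := (ModuleCat.mono_iff_injective _).2 (D.injectiveR i)
  epi_g := (ModuleCat.epi_iff_surjective _).2 (D.surjectiveR i)

lemma exact_of_tor (N : Type u) [AddCommGroup N] [Module Γ N] (i : ℕ)
    (h : IsZero (NCTor Γ D.M N (i + 1))) :
    Function.Exact (map (D.inclR (i + 1) ∘ₗ D.projR (i + 2)) (LinearMap.id : N →ₗ[Γ] N))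
      (map (D.inclR i ∘ₗ D.projR (i + 1)) (LinearMap.id : N →ₗ[Γ] N)) := by
  have (i : ℕ) : Projective (ModuleCat.of Γᵐᵒᵖ (D.R i).carrier) := by
    have := projective_mulOpposite_self Γ
    have := (D.right_R i).projective
    exact (IsProjective.iff_projective _).1 this
  exact (ShortComplex.ab_exact_iff_function_exact _).1 (exact_map_splice_of_isZero_leftDerived
    (C := ModuleCat.{u} Γᵐᵒᵖ)
    (Ω := fun i => ModuleCat.of _ (D.Ω i).carrier) (R := fun i => ModuleCat.of _ (D.R i).carrier)
    (fun i => ModuleCat.ofHom (D.inclR i)) (fun i => ModuleCat.ofHom (D.projR i)) _ D.shortExactR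
    (NCTensor.functor Γ N) i h)

/-- An element killed by `h ⊗ N` lifts along `g`; by exactness the lift comes from `f`, so its image
under `g` is zero. -/
lemma injective_of_exact_comp {X₀ X₁ X₂ X₃ : Type u} [AddCommGroup X₀] [Module Γᵐᵒᵖ X₀]
    [AddCommGroup X₁] [Module Γᵐᵒᵖ X₁] [AddCommGroup X₂] [Module Γᵐᵒᵖ X₂] [AddCommGroup X₃]
    [Module Γᵐᵒᵖ X₃] {N : Type u} [AddCommGroup N] [Module Γ N] {f : X₀ →ₗ[Γᵐᵒᵖ] X₁}
    {g : X₁ →ₗ[Γᵐᵒᵖ] X₂} {h : X₂ →ₗ[Γᵐᵒᵖ] X₃} (hg : Function.Surjective g)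
    (hfg : Function.Exact (map f (LinearMap.id : N →ₗ[Γ] N)) (map (h ∘ₗ g)
      (LinearMap.id : N →ₗ[Γ] N))) (w : g ∘ₗ f = 0) :
    Function.Injective (map h (LinearMap.id : N →ₗ[Γ] N)) := by
  refine (injective_iff_map_eq_zero _).2 fun t ht => ?_
  obtain ⟨s, hs⟩ := map_surjective _ (LinearMap.id : N →ₗ[Γ] N) hg Function.surjective_id t
  have hs' : map (h ∘ₗ g) (LinearMap.id : N →ₗ[Γ] N) s = 0 := by
    rw [← ht, ← hs, map_map]
    rfl
  obtain ⟨u, hu⟩ := (hfg s).1 hs'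
  rw [← hs, ← hu, map_map, w, map_zero_left]

/-- `Tor_{i+1}` is the homology of the spliced complex at `R (i+1) ⊗ N`; its vanishing gives
injectivity of `Ω (i+1) ⊗ N → R i ⊗ N`. -/
lemma leftVanishing_of_tor (N : Type u) [AddCommGroup N] [Module Γ N]
    (h : ∀ i, IsZero (NCTor Γ D.M N (i + 1))) : D.LeftVanishing N := fun i => 
  injective_of_exact_comp (D.surjectiveR (i + 1)) (D.exact_of_tor N i (h i))
    (LinearMap.ext fun x => (D.exactR (i + 1)).apply_apply_eq_zero _)

lemma powVanishing_of_torVanishing (h : TorVanishing Γ D.M) : D.PowVanishing := fun j =>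
  D.leftVanishing_of_tor _ fun i => h (i + 1) (j + 1) (by simp) (by simp)

end BimoduleResolution

end

noncomputable section

/-! ### Bimodules as modules over the enveloping algebra. -/

section Enveloping

variable (k : Type w) [Field k] (Γ : Type u) [Ring Γ] [Algebra k Γ]

/-- A module over the enveloping algebra, as a bimodule. -/
def BimoduleObj.ofEnveloping (W : Type u) [AddCommGroup W] [Module (Γ ⊗[k] Γᵐᵒᵖ) W] :
    BimoduleObj Γ where
  carrier := W
  left := Module.compHom W (Algebra.TensorProduct.includeLeft : Γ →ₐ[k] Γ ⊗[k] Γᵐᵒᵖ).toRingHom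
  right := Module.compHom W (Algebra.TensorProduct.includeRight : Γᵐᵒᵖ →ₐ[k] Γ ⊗[k] Γᵐᵒᵖ).toRingHom
  comm := by
    letI := Module.compHom W (Algebra.TensorProduct.includeLeft : Γ →ₐ[k] Γ ⊗[k] Γᵐᵒᵖ).toRingHom
    letI := Module.compHom W
      (Algebra.TensorProduct.includeRight : Γᵐᵒᵖ →ₐ[k] Γ ⊗[k] Γᵐᵒᵖ).toRingHom
    refine ⟨fun γ γ' x => ?_⟩
    change (γ ⊗ₜ[k] (1 : Γᵐᵒᵖ)) • ((1 : Γ) ⊗ₜ[k] γ') • x =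
      ((1 : Γ) ⊗ₜ[k] γ') • (γ ⊗ₜ[k] (1 : Γᵐᵒᵖ)) • x
    simp [← mul_smul]

variable {k Γ}

namespace BimoduleObj

section

variable {W W' : Type u} [AddCommGroup W] [Module (Γ ⊗[k] Γᵐᵒᵖ) W]
  [AddCommGroup W'] [Module (Γ ⊗[k] Γᵐᵒᵖ) W']

/-- A morphism over the enveloping algebra as a map of left modules. -/
def leftMap (f : W →ₗ[Γ ⊗[k] Γᵐᵒᵖ] W') :
    (ofEnveloping k Γ W).carrier →ₗ[Γ] (ofEnveloping k Γ W').carrier where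
  toFun := f
  map_add' := f.map_add
  map_smul' γ x := f.map_smul (γ ⊗ₜ[k] (1 : Γᵐᵒᵖ)) x

/-- A morphism over the enveloping algebra as a map of right modules. -/
def rightMap (f : W →ₗ[Γ ⊗[k] Γᵐᵒᵖ] W') :
    (ofEnveloping k Γ W).carrier →ₗ[Γᵐᵒᵖ] (ofEnveloping k Γ W').carrier where
  toFun := f
  map_add' := f.map_add
  map_smul' γ x := f.map_smul ((1 : Γ) ⊗ₜ[k] γ) x

lemma finRetract_leftMap (h : FinRetract (Γ ⊗[k] Γᵐᵒᵖ) W W') :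
    FinRetract Γ (ofEnveloping k Γ W).carrier (ofEnveloping k Γ W').carrier := by
  obtain ⟨n, φ, s, h⟩ := h
  exact ⟨n, fun i => leftMap (φ i), fun i => leftMap (s i), h⟩

lemma finRetract_rightMap (h : FinRetract (Γ ⊗[k] Γᵐᵒᵖ) W W') :
    FinRetract Γᵐᵒᵖ (ofEnveloping k Γ W).carrier (ofEnveloping k Γ W').carrier := by
  obtain ⟨n, φ, s, h⟩ := h
  exact ⟨n, fun i => rightMap (φ i), fun i => rightMap (s i), h⟩

open NCTensor in
lemma finRetract_tensor (V : Type u) [AddCommGroup V] [Module Γᵐᵒᵖ V]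
    (h : FinRetract (Γ ⊗[k] Γᵐᵒᵖ) W W') :
    FinRetract Γᵐᵒᵖ (NCTensor Γ V (ofEnveloping k Γ W).carrier)
      (NCTensor Γ V (ofEnveloping k Γ W').carrier) := by
  obtain ⟨n, φ, s, h⟩ := h
  refine ⟨n, fun i => mapRight LinearMap.id (leftMap (φ i)) (rightMap (φ i)).map_smul,
    fun i => mapRight LinearMap.id (leftMap (s i)) (rightMap (s i)).map_smul, fun t => ?_⟩
  have h1 : (LinearMap.id : (ofEnveloping k Γ W').carrier →ₗ[Γ] (ofEnveloping k Γ W').carrier) =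
      ∑ i, leftMap (s i) ∘ₗ leftMap (φ i) := by
    ext x
    rw [LinearMap.sum_apply]
    exact (h x).symm
  have h3 : t = NCTensor.map LinearMap.id (∑ i, leftMap (s i) ∘ₗ leftMap (φ i)) t := by
    rw [← h1, NCTensor.map_id]
  conv_rhs => rw [h3, map_sum_right]
  exact Finset.sum_congr rfl fun i _ => map_map _ _ _ _ t

end


/-- `γ ⊗ x ↦ f(x) γ`. -/
def contractRight (f : Γᵐᵒᵖ →ₗ[k] k) : Γ ⊗[k] Γᵐᵒᵖ →ₗ[k] Γ :=
  (TensorProduct.rid k Γ).toLinearMap ∘ₗ f.lTensor Γ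

/-- `γ ⊗ x ↦ f(γ) x`. -/
def contractLeft (f : Γ →ₗ[k] k) : Γ ⊗[k] Γᵐᵒᵖ →ₗ[k] Γᵐᵒᵖ :=
  (TensorProduct.lid k Γᵐᵒᵖ).toLinearMap ∘ₗ f.rTensor Γᵐᵒᵖ

lemma contractRight_mul (f : Γᵐᵒᵖ →ₗ[k] k) (γ : Γ) (x : Γ ⊗[k] Γᵐᵒᵖ) :
    contractRight f (γ ⊗ₜ[k] 1 * x) = γ * contractRight f x := by
  induction x with
  | zero => simp
  | tmul x y => simp [contractRight]
  | add x y hx hy => rw [mul_add, map_add, hx, hy, map_add, mul_add]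

lemma contractLeft_mul (f : Γ →ₗ[k] k) (γ : Γᵐᵒᵖ) (x : Γ ⊗[k] Γᵐᵒᵖ) :
    contractLeft f (1 ⊗ₜ[k] γ * x) = γ * contractLeft f x := by
  induction x with
  | zero => simp
  | tmul x y => simp [contractLeft]
  | add x y hx hy => rw [mul_add, map_add, hx, hy, map_add, mul_add]

-- `Γ ⊗_k Γᵒᵖ` is free over `Γ` on a `k`-basis of the second factor; the coordinates are the
-- contractions with the dual basis.
variable (k Γ) in
lemma finRetract_left_self [Module.Finite k Γ] :
    FinRetract Γ Γ (ofEnveloping k Γ (Γ ⊗[k] Γᵐᵒᵖ)).carrier := by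
  let b := Module.finBasis k Γᵐᵒᵖ
  refine .of_fintype (fun a =>
    { toFun := contractRight (b.coord a)
      map_add' := map_add (contractRight (b.coord a))
      map_smul' := contractRight_mul (b.coord a) }) (fun a =>
    { toFun := fun γ => γ ⊗ₜ[k] b a
      map_add' := fun x y => TensorProduct.add_tmul _ _ _
      map_smul' := fun γ x => show (γ * x) ⊗ₜ[k] b a = (γ ⊗ₜ[k] 1) * (x ⊗ₜ[k] b a) by simp }) ?_
  intro (x : Γ ⊗[k] Γᵐᵒᵖ)
  change ∑ a, contractRight (b.coord a) x ⊗ₜ[k] b a = x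
  induction x with
  | zero => simp
  | tmul x y =>
    simp only [contractRight, LinearMap.comp_apply, LinearEquiv.coe_coe, LinearMap.lTensor_tmul,
      TensorProduct.rid_tmul, TensorProduct.smul_tmul, ← TensorProduct.tmul_sum]
    exact congrArg _ (b.sum_repr y)
  | add x y hx hy => simp only [map_add, TensorProduct.add_tmul, Finset.sum_add_distrib, hx, hy]

variable (k Γ) in
lemma finRetract_right_self [Module.Finite k Γ] :
    FinRetract Γᵐᵒᵖ Γ (ofEnveloping k Γ (Γ ⊗[k] Γᵐᵒᵖ)).carrier := by
  let b := Module.finBasis k Γ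
  refine .of_fintype (fun a =>
    { toFun := fun x => (contractLeft (b.coord a) x).unop
      map_add' := fun x y => congrArg unop (map_add (contractLeft (b.coord a)) x y)
      map_smul' := fun γ x => congrArg unop (contractLeft_mul (b.coord a) γ x) }) (fun a =>
    { toFun := fun γ => b a ⊗ₜ[k] op γ
      map_add' := fun x y => TensorProduct.tmul_add _ _ _
      map_smul' := fun γ x =>
        show b a ⊗ₜ[k] (γ * op x) = (1 ⊗ₜ[k] γ) * (b a ⊗ₜ[k] op x) by simp }) ?_
  intro (x : Γ ⊗[k] Γᵐᵒᵖ)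
  change ∑ a, b a ⊗ₜ[k] contractLeft (b.coord a) x = x
  induction x with
  | zero => simp
  | tmul x y =>
    simp only [contractLeft, LinearMap.comp_apply, LinearEquiv.coe_coe, LinearMap.rTensor_tmul,
      TensorProduct.lid_tmul, ← TensorProduct.smul_tmul, ← TensorProduct.sum_tmul]
    exact congrArg (· ⊗ₜ[k] y) (b.sum_repr x)
  | add x y hx hy => simp only [map_add, TensorProduct.tmul_add, Finset.sum_add_distrib, hx, hy]

section

variable (V : Type u) [AddCommGroup V] [Module Γᵐᵒᵖ V] [Module k V] [IsScalarTower k Γᵐᵒᵖ V]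

variable {V} in
/-- The map `γ ↦ f(v γ)`. -/
def orbitMap (f : V →ₗ[k] k) (v : V) : Γ →ₗ[k] k where
  toFun γ := f (op γ • v)
  map_add' x y := by rw [MulOpposite.op_add, add_smul, map_add]
  map_smul' c x := by rw [MulOpposite.op_smul, smul_assoc, map_smul]; rfl

lemma contractLeft_orbitMap_mul (f : V →ₗ[k] k) (v : V) (γ : Γ) (x : Γ ⊗[k] Γᵐᵒᵖ) :
    contractLeft (orbitMap f (op γ • v)) x = contractLeft (orbitMap f v) (γ ⊗ₜ[k] 1 * x) := by
  induction x with
  | zero => simp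
  | tmul x y => simp [contractLeft, orbitMap, mul_smul]
  | add x y hx hy => rw [mul_add, map_add, hx, hy, map_add]

lemma contractLeft_orbitMap_add (f : V →ₗ[k] k) (v v' : V) (x : Γ ⊗[k] Γᵐᵒᵖ) :
    contractLeft (orbitMap f (v + v')) x =
      contractLeft (orbitMap f v) x + contractLeft (orbitMap f v') x := by
  induction x with
  | zero => simp
  | tmul x y => simp [contractLeft, orbitMap, add_smul]
  | add x y hx hy => rw [map_add, hx, hy, map_add, map_add]; abel

/-- The map `v ⊗ (γ ⊗ x) ↦ f(v γ) x`. -/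
def tensorContract (f : V →ₗ[k] k) :
    NCTensor Γ V (ofEnveloping k Γ (Γ ⊗[k] Γᵐᵒᵖ)).carrier →ₗ[Γᵐᵒᵖ] Γ :=
  let φ : NCTensor Γ V (ofEnveloping k Γ (Γ ⊗[k] Γᵐᵒᵖ)).carrier →+ Γ := NCTensor.lift
    (AddMonoidHom.mk' (fun v => AddMonoidHom.mk' (fun x => (contractLeft (orbitMap f v) x).unop)
        (fun x y => congrArg unop (map_add (contractLeft (orbitMap f v)) x y)))
      (fun v v' => by ext x; exact congrArg unop (contractLeft_orbitMap_add V f v v' x)))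
    (fun v γ x => congrArg unop (contractLeft_orbitMap_mul V f v γ x))
  { φ with
    map_smul' := fun γ t => DFunLike.congr_fun (NCTensor.hom_ext
      (f := φ.comp (DistribSMul.toAddMonoidHom _ γ)) (g := (DistribSMul.toAddMonoidHom _ γ).comp φ)
      (fun v x => congrArg unop (contractLeft_mul (orbitMap f v) γ x))) t }

variable {V} in
/-- The element `v ⊗ x`. -/
def envTmul (v : V) (x : Γ ⊗[k] Γᵐᵒᵖ) :
    NCTensor Γ V (ofEnveloping k Γ (Γ ⊗[k] Γᵐᵒᵖ)).carrier :=
  NCTensor.tmul (N := (ofEnveloping k Γ (Γ ⊗[k] Γᵐᵒᵖ)).carrier) Γ v x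

variable {V} in
lemma envTmul_add (v : V) (x y : Γ ⊗[k] Γᵐᵒᵖ) :
    envTmul v (x + y) = envTmul v x + envTmul v y :=
  NCTensor.tmul_add (N := (ofEnveloping k Γ (Γ ⊗[k] Γᵐᵒᵖ)).carrier) Γ v x y

variable {V} in
lemma smul_envTmul (v : V) (γ : Γ) (x : Γ ⊗[k] Γᵐᵒᵖ) :
    envTmul (op γ • v) x = envTmul v (γ ⊗ₜ[k] 1 * x) :=
  NCTensor.smul_tmul (N := (ofEnveloping k Γ (Γ ⊗[k] Γᵐᵒᵖ)).carrier) Γ v γ x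

/-- The map `x ↦ v ⊗ (1 ⊗ x)`. -/
def tensorInclude (v : V) :
    Γ →ₗ[Γᵐᵒᵖ] NCTensor Γ V (ofEnveloping k Γ (Γ ⊗[k] Γᵐᵒᵖ)).carrier where
  toFun x := envTmul v ((1 : Γ) ⊗ₜ[k] op x)
  map_add' x y := (congrArg (envTmul v) (TensorProduct.tmul_add _ _ _)).trans (envTmul_add _ _ _)
  map_smul' γ x := congrArg (envTmul v)
    (show (1 : Γ) ⊗ₜ[k] (γ * op x) = (1 ⊗ₜ[k] γ) * ((1 : Γ) ⊗ₜ[k] op x) by simp)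

/-- `V ⊗_Γ (Γ ⊗_k Γᵒᵖ)` is `V ⊗_k Γ`, free on a `k`-basis of `V`. This is why tensoring any
finite-dimensional `V` with a projective bimodule gives a projective module. -/
lemma finRetract_tensor_self [Module.Finite k V] :
    FinRetract Γᵐᵒᵖ Γ (NCTensor Γ V (ofEnveloping k Γ (Γ ⊗[k] Γᵐᵒᵖ)).carrier) := by
  let b := Module.finBasis k V
  refine .of_fintype (fun a => tensorContract (k := k) (Γ := Γ) V (b.coord a))
    (fun a => tensorInclude (k := k) (Γ := Γ) V (b a)) ?_
  intro t
  have : ∑ a, (tensorInclude (k := k) (Γ := Γ) V (b a)).toAddMonoidHom.comp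
      (tensorContract (k := k) (Γ := Γ) V (b.coord a)).toAddMonoidHom = AddMonoidHom.id _ := by
    refine NCTensor.hom_ext fun v (x : Γ ⊗[k] Γᵐᵒᵖ) => ?_
    rw [AddMonoidHom.finsetSum_apply]
    change ∑ a, tensorInclude (k := k) (Γ := Γ) V (b a) (contractLeft (orbitMap (b.coord a) v) x).unop =
      envTmul v x
    induction x with
    | zero =>
      have : envTmul v (0 : Γ ⊗[k] Γᵐᵒᵖ) = 0 :=
        NCTensor.tmul_zero (N := (ofEnveloping k Γ (Γ ⊗[k] Γᵐᵒᵖ)).carrier) v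
      simp [this]
    | tmul γ y =>
      have h₁ : envTmul v (γ ⊗ₜ[k] y) = envTmul (op γ • v) ((1 : Γ) ⊗ₜ[k] y) := by
        rw [smul_envTmul]
        simp
      have h₂ (a) : tensorInclude (k := k) (Γ := Γ) V (b a)
          (contractLeft (orbitMap (b.coord a) v) (γ ⊗ₜ[k] y)).unop =
          envTmul (b.coord a (op γ • v) • b a) ((1 : Γ) ⊗ₜ[k] y) := by
        -- The scalar is viewed in `Γ`, moved across the balanced tensor, and then across the tensor
        -- over `k` to act on `y`.
        have e : b.coord a (op γ • v) • b a = op (algebraMap k Γ (b.coord a (op γ • v))) • b a := by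
          rw [← MulOpposite.algebraMap_apply, algebraMap_smul]
        rw [e, smul_envTmul]
        refine congrArg (envTmul (b a)) ?_
        have h : contractLeft (orbitMap (b.coord a) v) (γ ⊗ₜ[k] y) = b.coord a (op γ • v) • y := by
          simp [contractLeft, orbitMap]
        rw [h, Algebra.TensorProduct.tmul_mul_tmul, mul_one, one_mul,
          Algebra.algebraMap_eq_smul_one, TensorProduct.smul_tmul]
        rfl
      simp_rw [h₂, h₁]
      conv_rhs => rw [← b.sum_repr (op γ • v)]
      exact (map_sum ((NCTensor.tmulHom Γ V (ofEnveloping k Γ (Γ ⊗[k] Γᵐᵒᵖ)).carrier).flip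
        ((1 : Γ) ⊗ₜ[k] y : Γ ⊗[k] Γᵐᵒᵖ)) _ _).symm
    | add x y hx hy =>
      rw [envTmul_add, ← hx, ← hy]
      simp only [map_add, MulOpposite.unop_add, Finset.sum_add_distrib]
  exact (AddMonoidHom.finsetSum_apply _ _ _).symm.trans (DFunLike.congr_fun this t)

end

end BimoduleObj

end Enveloping

end

noncomputable section

lemma FinRetract.finite {R : Type u} [Ring R] {X : Type v} [AddCommGroup X] [Module R X]
    {Z : Type w} [AddCommGroup Z] [Module R Z] [Module.Finite R Z]
    (h : FinRetract R Z X) : Module.Finite R X := by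
  obtain ⟨n, φ, s, h⟩ := h
  refine Module.Finite.of_surjective (∑ i, s i ∘ₗ LinearMap.proj i : (Fin n → Z) →ₗ[R] X)
    fun x => ⟨fun i => φ i x, ?_⟩
  simpa using h x

lemma finite_mulOpposite_self (Γ : Type u) [Ring Γ] : Module.Finite Γᵐᵒᵖ Γ :=
  Module.Finite.equiv (show Γᵐᵒᵖ ≃ₗ[Γᵐᵒᵖ] Γ from
    { toFun := unop, invFun := op, map_add' := fun _ _ => rfl, map_smul' := fun _ _ => rfl })

/-! ### Iterated syzygies and the resolution of the bimodule `M`. -/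

section Syzygy

variable {R : Type u} [Ring R] 

/-- The number of chosen generators. -/
def rankCover (W : Type u) [AddCommGroup W] [Module R W] [Module.Finite R W] : ℕ :=
  (Module.Finite.exists_fin' R W).choose

variable (R) in
/-- The chosen surjection from a free module of finite rank. -/
def cover (W : Type u) [AddCommGroup W] [Module R W] [Module.Finite R W] :
    (Fin (rankCover (R := R) W) → R) →ₗ[R] W := (Module.Finite.exists_fin' R W).choose_spec.choose

lemma cover_surjective (W : Type u) [AddCommGroup W] [Module R W] [Module.Finite R W] :
    Function.Surjective (cover R W) := (Module.Finite.exists_fin' R W).choose_spec.choose_spec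

variable [IsNoetherianRing R]

/-- Iterated syzygies. -/
def syzygy (W : ModuleCat.{u} R) [Module.Finite R W] : ℕ → FGModuleCat.{u} R
  | 0 => FGModuleCat.of R W
  | i + 1 => FGModuleCat.of R (LinearMap.ker (cover R (syzygy W i)))

variable (W : ModuleCat.{u} R) [Module.Finite R W]

/-- The inclusion of the next syzygy. -/
def syzygyIncl (i : ℕ) :
    syzygy W (i + 1) →ₗ[R] (Fin (rankCover (R := R) (syzygy W i)) → R) :=
  (LinearMap.ker (cover R (syzygy W i))).subtype

lemma exact_syzygy (i : ℕ) : Function.Exact (syzygyIncl W i) (cover R (syzygy W i)) :=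
  LinearMap.exact_subtype_ker_map _

lemma syzygyIncl_injective (i : ℕ) : Function.Injective (syzygyIncl W i) :=
  Subtype.val_injective

/-- Dimension shifting: each syzygy lowers the bound by one. The recursion raises `n`, because the
previous syzygy satisfies a bound larger by one. -/
lemma hasProjectiveDimensionLT_syzygy (n : ℕ) : ∀ i, HasProjectiveDimensionLT W (n + i + 1) →
    HasProjectiveDimensionLT (ModuleCat.of R (syzygy W i)) (n + 1)
  | 0 => fun h => h
  | i + 1 => fun h => by
    have ih := hasProjectiveDimensionLT_syzygy (n + 1) i (by rwa [Nat.add_right_comm n 1 i])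
    let S : ShortComplex (ModuleCat.{u} R) := ShortComplex.mk (ModuleCat.ofHom (syzygyIncl W i))
      (ModuleCat.ofHom (cover R (syzygy W i)))
      (by ext x; exact (exact_syzygy W i).apply_apply_eq_zero x)
    have hS : S.ShortExact :=
      { exact := (ShortComplex.ShortExact.moduleCat_exact_iff_function_exact _).2 (exact_syzygy W i)
        mono_f := (ModuleCat.mono_iff_injective _).2 (syzygyIncl_injective W i)
        epi_g := (ModuleCat.epi_iff_surjective _).2 (cover_surjective _) }
    exact (hS.hasProjectiveDimensionLT_X₃_iff n ((IsProjective.iff_projective _).1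
      (inferInstanceAs (Module.Projective R (Fin (rankCover (R := R) (syzygy W i)) → R))))).1 ih

lemma exists_projective_syzygy (h : projectiveDimension W < ⊤) :
    ∃ n, Module.Projective R (syzygy W n) := by
  obtain ⟨n, hn⟩ := (projectiveDimension_ne_top_iff W).1 h.ne
  refine ⟨n, ?_⟩
  have h₁ := hasProjectiveDimensionLT_syzygy W 0 n (by rwa [zero_add])
  rw [zero_add, ← projective_iff_hasProjectiveDimensionLT_one] at h₁
  exact (IsProjective.iff_projective (ModuleCat.of R (syzygy W n))).2 h₁

end Syzygy

section

variable {k : Type w} [Field k] {Γ : Type u} [Ring Γ] [Algebra k Γ] [Module.Finite k Γ]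

variable (k Γ) in
lemma isNoetherianRing_enveloping : IsNoetherianRing (Γ ⊗[k] Γᵐᵒᵖ) :=
  isNoetherian_of_tower k (inferInstance : IsNoetherian k (Γ ⊗[k] Γᵐᵒᵖ))

open BimoduleObj

lemma BimoduleObj.finite_ofEnveloping (W : Type u) [AddCommGroup W] [Module (Γ ⊗[k] Γᵐᵒᵖ) W]
    [Module.Finite (Γ ⊗[k] Γᵐᵒᵖ) W] : Module.Finite Γᵐᵒᵖ (ofEnveloping k Γ W).carrier := by
  obtain ⟨n, f, hf⟩ := Module.Finite.exists_fin' (Γ ⊗[k] Γᵐᵒᵖ) W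
  have := finite_mulOpposite_self Γ
  have := (finRetract_right_self k Γ).finite
  have := (finRetract_rightMap (FinRetract.pi (R := Γ ⊗[k] Γᵐᵒᵖ) (Z := Γ ⊗[k] Γᵐᵒᵖ) n)).finite
  exact Module.Finite.of_surjective (rightMap f) hf

lemma finRetract_tensor_ofEnveloping {W : Type u} [AddCommGroup W] [Module (Γ ⊗[k] Γᵐᵒᵖ) W]
    (h : FinRetract (Γ ⊗[k] Γᵐᵒᵖ) (Γ ⊗[k] Γᵐᵒᵖ) W) (V : Type u) [AddCommGroup V] [Module Γᵐᵒᵖ V]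
    [Module.Finite Γᵐᵒᵖ V] : FinRetract Γᵐᵒᵖ Γ (NCTensor Γ V (ofEnveloping k Γ W).carrier) := by
  letI := Module.compHom V (algebraMap k Γᵐᵒᵖ)
  haveI : IsScalarTower k Γᵐᵒᵖ V := ⟨fun x y z => by
    rw [Algebra.smul_def, mul_smul]; rfl⟩
  haveI : Module.Finite k V := Module.Finite.trans Γᵐᵒᵖ V
  exact (finRetract_tensor_self (k := k) V).trans (finRetract_tensor V h)

/-- The resolution of a bimodule given by iterated syzygies over the enveloping algebra. -/
def BimoduleResolution.ofEnveloping (W : ModuleCat.{u} (Γ ⊗[k] Γᵐᵒᵖ))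
    [Module.Finite (Γ ⊗[k] Γᵐᵒᵖ) W] (n : ℕ)
    (hn : haveI := isNoetherianRing_enveloping k Γ
      Module.Projective (Γ ⊗[k] Γᵐᵒᵖ) (syzygy W n)) : BimoduleResolution Γ :=
  haveI := isNoetherianRing_enveloping k Γ
  { Ω i := .ofEnveloping k Γ (syzygy W i)
    R i := .ofEnveloping k Γ (Fin (rankCover (R := Γ ⊗[k] Γᵐᵒᵖ) (syzygy W i)) → Γ ⊗[k] Γᵐᵒᵖ)
    incl i := leftMap (syzygyIncl W i)
    incl_smul i := (rightMap (syzygyIncl W i)).map_smul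
    proj i := leftMap (cover _ (syzygy W i))
    proj_smul i γ x := (cover _ (syzygy W i)).map_smul ((1 : Γ) ⊗ₜ[k] γ) x
    injective := syzygyIncl_injective W
    exact := exact_syzygy W
    surjective i := cover_surjective (syzygy W i)
    finite_Ω i := finite_ofEnveloping _
    finite_R i := finite_ofEnveloping _
    left_R i := (finRetract_left_self k Γ).trans (finRetract_leftMap (.pi _))
    right_R i := (finRetract_right_self k Γ).trans (finRetract_rightMap (.pi _))
    tensor_R i V _ _ _ := finRetract_tensor_ofEnveloping (.pi _) V
    length := n
    left_Ω := (finRetract_left_self k Γ).trans (finRetract_leftMap .of_finite_projective)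
    tensor_Ω V _ _ _ := finRetract_tensor_ofEnveloping .of_finite_projective V }

/-- Used to get an equality, not just an isomorphism, between `M` and the start of its resolution,
so that one can be substituted for the other. -/
lemma BimoduleObj.mk_congr {B : Type u} [AddCommGroup B] {l l' : Module Γ B} {r r' : Module Γᵐᵒᵖ B}
    {c : @SMulCommClass Γ Γᵐᵒᵖ B l.toSMul r.toSMul} {c' : @SMulCommClass Γ Γᵐᵒᵖ B l'.toSMul r'.toSMul}
    (hl : ∀ (γ : Γ) (x : B), l.smul γ x = l'.smul γ x)
    (hr : ∀ (γ : Γᵐᵒᵖ) (x : B), r.smul γ x = r'.smul γ x) :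
    (@BimoduleObj.mk Γ _ B _ l r c) = (@BimoduleObj.mk Γ _ B _ l' r' c') := by
  obtain rfl : l = l' := Module.ext' _ _ hl
  obtain rfl : r = r' := Module.ext' _ _ hr
  rfl

/-- `M` is finite over `k`, hence over `Γᵉ`, which is Noetherian, so finitely generated syzygies
exist; finite projective dimension makes one of them projective. -/
theorem exists_bimoduleResolution (M : Type u) [AddCommGroup M] [Module k M] [Module Γ M]
    [Module Γᵐᵒᵖ M] [SMulCommClass Γ Γᵐᵒᵖ M] [IsScalarTower k Γ M] [IsScalarTower k Γᵐᵒᵖ M]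
    [Module.Finite Γᵐᵒᵖ M] (hpd : projectiveDimension (envelopingModule Γ M k) < ⊤) :
    ∃ D : BimoduleResolution Γ, D.Ω 0 = { carrier := M } := by
  have := isNoetherianRing_enveloping k Γ
  let _ : Module (Γ ⊗[k] Γᵐᵒᵖ) M := TensorProduct.Algebra.module
  have hsmul (x : Γ) (y : Γᵐᵒᵖ) (m : M) : (x ⊗ₜ[k] y) • m = x • y • m :=
    TensorProduct.Algebra.smul_def x y m
  have : Module.Finite k M := Module.Finite.trans Γᵐᵒᵖ M
  have : IsScalarTower k (Γ ⊗[k] Γᵐᵒᵖ) M := ⟨fun c x m => by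
    induction x with
    | zero =>
      have h0 : (0 : Γ ⊗[k] Γᵐᵒᵖ) • m = 0 := zero_smul (Γ ⊗[k] Γᵐᵒᵖ) m
      exact (congrArg (· • m) (smul_zero c)).trans (h0.trans (by rw [h0, smul_zero]))
    | tmul x y => rw [TensorProduct.smul_tmul', hsmul, hsmul, smul_assoc]
    | add x y hx hy => rw [smul_add, add_smul, hx, hy, add_smul, smul_add]⟩
  have : Module.Finite (Γ ⊗[k] Γᵐᵒᵖ) M := Module.Finite.of_restrictScalars_finite k _ M
  have : Module.Finite (Γ ⊗[k] Γᵐᵒᵖ) (envelopingModule Γ M k) := this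
  obtain ⟨n, hn⟩ := exists_projective_syzygy (envelopingModule Γ M k) hpd
  refine ⟨.ofEnveloping (envelopingModule Γ M k) n hn, ?_⟩
  change BimoduleObj.ofEnveloping k Γ M = _
  refine BimoduleObj.mk_congr (B := M) (fun γ x => ?_) (fun γ x => ?_)
  · exact (hsmul γ 1 x).trans (by rw [one_smul]; rfl)
  · exact (hsmul 1 γ x).trans (by rw [one_smul]; rfl)

end

end

/-! ### Finitely generated modules and tensoring with a bimodule. -/

noncomputable section

namespace FGModuleCat

variable {R : Type u} [Ring R] [IsNoetherianRing R]

instance : PreservesFiniteLimits (ModuleCat.isFG.{u} R).ι :=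
  inferInstanceAs (PreservesFiniteLimits (forget₂ (FGModuleCat.{u} R) (ModuleCat.{u} R)))

instance : PreservesFiniteColimits (ModuleCat.isFG.{u} R).ι :=
  inferInstanceAs (PreservesFiniteColimits (forget₂ (FGModuleCat.{u} R) (ModuleCat.{u} R)))

lemma mono_iff {X Y : FGModuleCat.{u} R} (f : X ⟶ Y) : Mono f ↔ Function.Injective f.hom.hom :=
  ((ModuleCat.isFG R).ι.mono_map_iff_mono f).symm.trans (ModuleCat.mono_iff_injective _)

lemma epi_iff {X Y : FGModuleCat.{u} R} (f : X ⟶ Y) : Epi f ↔ Function.Surjective f.hom.hom :=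
  ((ModuleCat.isFG R).ι.epi_map_iff_epi f).symm.trans (ModuleCat.epi_iff_surjective _)

lemma exact_iff (S : ShortComplex (FGModuleCat.{u} R)) :
    S.Exact ↔ Function.Exact S.f.hom.hom S.g.hom.hom :=
  (S.exact_map_iff_of_faithful (ModuleCat.isFG R).ι).symm.trans
    (ShortComplex.ShortExact.moduleCat_exact_iff_function_exact _)

lemma shortExact_iff (S : ShortComplex (FGModuleCat.{u} R)) :
    S.ShortExact ↔ Function.Injective S.f.hom.hom ∧ Function.Exact S.f.hom.hom S.g.hom.hom ∧
      Function.Surjective S.g.hom.hom :=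
  ⟨fun h => ⟨(mono_iff _).1 h.mono_f, (exact_iff _).1 h.exact, (epi_iff _).1 h.epi_g⟩,
    fun h => { exact := (exact_iff _).2 h.2.1, mono_f := (mono_iff _).2 h.1,
               epi_g := (epi_iff _).2 h.2.2 }⟩

/-- Projectivity among finitely generated modules suffices to split a surjection from a finite free
module; conversely a summand of one is projective among all modules. -/
lemma projective_iff (P : FGModuleCat.{u} R) : Projective P ↔ FinRetract R R P := by
  constructor
  · intro h
    obtain ⟨n, f, hf⟩ := Module.Finite.exists_fin' R P
    let f' : FGModuleCat.of R (Fin n → R) ⟶ P := FGModuleCat.ofHom f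
    have : Epi f' := (epi_iff _).2 hf
    refine (FinRetract.pi n).trans (.of_retract (Projective.factorThru (𝟙 P) f').hom.hom f
      fun x => ?_)
    exact congr(($(Projective.factorThru_comp (𝟙 P) f')).hom.hom x)
  · intro h
    have := h.projective
    refine ⟨fun {X Y} f g hg => ?_⟩
    obtain ⟨l, hl⟩ := Module.projective_lifting_property g.hom.hom f.hom.hom ((epi_iff _).1 hg)
    exact ⟨FGModuleCat.ofHom l, FGModuleCat.hom_ext hl⟩

omit [IsNoetherianRing R] in
lemma isZero_of_subsingleton (X : FGModuleCat.{u} R) [Subsingleton X] : IsZero X := by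
  rw [IsZero.iff_id_eq_zero]
  ext x
  exact Subsingleton.elim _ _

end FGModuleCat

section TensorBimodule

open NCTensor

variable {Γ : Type u} [Ring Γ]

/-- Finitely many generators of `X` give a surjection from a finite power of `N`. -/
instance NCTensor.finite_right (X : Type u) [AddCommGroup X] [Module Γᵐᵒᵖ X] [Module.Finite Γᵐᵒᵖ X]
    (N : Type u) [AddCommGroup N] [Module Γ N] [Module Γᵐᵒᵖ N] [SMulCommClass Γ Γᵐᵒᵖ N]
    [Module.Finite Γᵐᵒᵖ N] : Module.Finite Γᵐᵒᵖ (NCTensor Γ X N) := by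
  obtain ⟨n, f, hf⟩ := Module.Finite.exists_fin' Γᵐᵒᵖ X
  let φ (x : X) : N →ₗ[Γᵐᵒᵖ] NCTensor Γ X N :=
    { toFun := tmul Γ x, map_add' := tmul_add Γ x, map_smul' := fun _ _ => rfl }
  let Φ : (Fin n → N) →ₗ[Γᵐᵒᵖ] NCTensor Γ X N :=
    ∑ i, φ (f (Pi.single i 1)) ∘ₗ LinearMap.proj i
  refine Module.Finite.of_surjective Φ fun t => ?_
  induction t using NCTensor.induction_on with
  | zero => exact ⟨0, map_zero _⟩
  | tmul x m =>
    obtain ⟨c, rfl⟩ := hf x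
    refine ⟨fun i => (c i).unop • m, ?_⟩
    have hc : f c = ∑ i, c i • f (Pi.single i 1) := by
      conv_lhs => rw [← Finset.univ_sum_single c, map_sum]
      refine Finset.sum_congr rfl fun i _ => ?_
      rw [← map_smul, ← Pi.single_smul', smul_eq_mul, mul_one]
    rw [LinearMap.sum_apply, hc]
    refine Eq.trans (Finset.sum_congr rfl fun i _ => ?_)
      (map_sum ((tmulHom Γ X N).flip m) _ _).symm
    exact (smul_tmul Γ _ (c i).unop m).symm
  | add a b ha hb =>
    obtain ⟨a, rfl⟩ := ha
    obtain ⟨b, rfl⟩ := hb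
    exact ⟨a + b, map_add _ _ _⟩

variable (N : Type u) [AddCommGroup N] [Module Γ N] [Module Γᵐᵒᵖ N] [SMulCommClass Γ Γᵐᵒᵖ N]
    [Module.Finite Γᵐᵒᵖ N]

variable (Γ) in
/-- The functor `- ⊗_Γ N` on finitely generated right modules. -/
def tensorBimod : FGRightMod Γ ⥤ FGRightMod Γ where
  obj X := FGModuleCat.of Γᵐᵒᵖ (NCTensor Γ X N)
  map f := FGModuleCat.ofHom (mapRight f.hom.hom (LinearMap.id : N →ₗ[Γ] N) (fun _ _ => rfl))
  map_id X := by
    ext t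
    exact NCTensor.map_id t
  map_comp f g := by
    ext t
    exact (map_map f.hom.hom g.hom.hom LinearMap.id LinearMap.id t).symm

instance : (tensorBimod Γ N).Additive where
  map_add {X Y f g} := by
    ext t
    exact map_add_left f.hom.hom g.hom.hom LinearMap.id t

instance [IsNoetherianRing Γᵐᵒᵖ] : PreservesFiniteColimits (tensorBimod Γ N) := by
  rw [Functor.preservesFiniteColimits_iff_forall_exact_map_and_epi]
  intro S hS
  rw [FGModuleCat.shortExact_iff] at hS
  exact ⟨(FGModuleCat.exact_iff _).2 (exact_map_left N _ _ hS.2.1 hS.2.2),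
    (FGModuleCat.epi_iff _).2 (map_surjective _ _ hS.2.2 Function.surjective_id)⟩

variable {N} in
/-- Morphisms of bimodules induce natural transformations. -/
def tensorBimodMap {N' : Type u} [AddCommGroup N'] [Module Γ N'] [Module Γᵐᵒᵖ N']
    [SMulCommClass Γ Γᵐᵒᵖ N'] [Module.Finite Γᵐᵒᵖ N'] (g : N →ₗ[Γ] N')
    (hg : ∀ (γ : Γᵐᵒᵖ) n, g (γ • n) = γ • g n) : tensorBimod Γ N ⟶ tensorBimod Γ N' where
  app X := FGModuleCat.ofHom (mapRight (LinearMap.id : X →ₗ[Γᵐᵒᵖ] X) g hg)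
  naturality X Y f := by
    ext t
    exact NCTensor.map_comm f.hom.hom g t

end TensorBimodule

end

noncomputable section

open NCTensor

section

variable {Γ : Type u} [Ring Γ] {M : Type u} [AddCommGroup M] [Module Γ M] [Module Γᵐᵒᵖ M]
  [SMulCommClass Γ Γᵐᵒᵖ M] [Module.Finite Γᵐᵒᵖ M]

/-- Rebrackets `(V ⊗ M^{⊗ j}) ⊗ g` as `V ⊗ (M^{⊗ j} ⊗ g)`. Only injectivity is transported, so no
natural isomorphism of iterated tensors has to be built. -/
lemma injective_map_iter_iff (V : FGRightMod Γ) (j : ℕ) : ∀ {N N' : ModuleCat.{u} Γ} (g : N ⟶ N'),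
    Function.Injective (map (LinearMap.id : ((tensorBimod Γ M).iter j).obj V →ₗ[Γᵐᵒᵖ] _) g.hom) ↔
      Function.Injective (map (LinearMap.id : V →ₗ[Γᵐᵒᵖ] V)
        (((tensorLeft M).iter j).map g).hom) := by
  induction j with
  | zero => exact fun g => Iff.rfl
  | succ j ih =>
    intro N N' g
    refine (map_tensor_injective_iff (((tensorBimod Γ M).iter j).obj V) M g.hom).trans ?_
    have := ih ((tensorLeft M).map g)
    refine this.trans ?_
    change Function.Injective (map (LinearMap.id : V →ₗ[Γᵐᵒᵖ] V)
        ((tensorLeft M ⋙ (tensorLeft M).iter j).map g).hom) ↔ _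
    rw [Functor.comp_iter]

lemma FinRetract.subsingleton {R : Type u} [Ring R] {Z : Type v} {X : Type w} [AddCommGroup Z]
    [Module R Z] [AddCommGroup X] [Module R X] [Subsingleton Z] (h : FinRetract R Z X) :
    Subsingleton X := by
  obtain ⟨n, φ, s, h⟩ := h
  refine subsingleton_of_forall_eq 0 fun x => ?_
  rw [← h x]
  exact Finset.sum_eq_zero fun i _ => by rw [Subsingleton.elim (φ i x) 0, map_zero]

lemma NCTensor.subsingleton_of_right (X N : Type u) [AddCommGroup X] [Module Γᵐᵒᵖ X]
    [AddCommGroup N] [Module Γ N] [Subsingleton N] : Subsingleton (NCTensor Γ X N) := by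
  refine subsingleton_of_forall_eq 0 fun t => ?_
  induction t using NCTensor.induction_on with
  | zero => rfl
  | tmul x n => rw [Subsingleton.elim n 0, tmul_zero]
  | add a b ha hb => rw [ha, hb, add_zero]

lemma isZero_iter_of_isNilpotentBimodule (h : IsNilpotentBimodule Γ M) :
    ∃ n, ∀ X : FGRightMod Γ, IsZero (((tensorBimod Γ M).iter n).obj X) := by
  obtain ⟨n, hn, hs⟩ := h
  obtain ⟨m, rfl⟩ := Nat.exists_eq_add_of_le' hn
  refine ⟨m + 1, fun X => ?_⟩
  have h₁ := finRetract_tensorLeft_iter M (N := ModuleCat.of Γ M)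
      (finRetract_tensorLeft_self M) m
  rw [tensorLeft_iter_obj] at h₁
  have h₂ : Subsingleton ((tensorLeft M ⋙ (tensorLeft M).iter m).obj (ModuleCat.of Γ Γ)) :=
    have : Subsingleton (ModuleCat.of Γ (bimodulePow Γ M (m + 1)).carrier) := hs
    h₁.subsingleton
  rw [Functor.comp_iter] at h₂
  -- Rebracketing for the zero map `Γ → 0`: its source becomes `X ⊗ (M^{⊗ (m+1)} ⊗ Γ) = 0`, so it is
  -- injective; hence `F^{m+1} X ⊗ Γ` injects into zero.
  have h₃ := (injective_map_iter_iff (M := M) X (m + 1)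
    (0 : ModuleCat.of Γ Γ ⟶ ModuleCat.of Γ PUnit)).2 (by
      have := NCTensor.subsingleton_of_right (Γ := Γ) X
        (((tensorLeft M).iter (m + 1)).obj (ModuleCat.of Γ Γ))
      exact Function.injective_of_subsingleton _)
  have := NCTensor.subsingleton_of_right (Γ := Γ) (((tensorBimod Γ M).iter (m + 1)).obj X)
    (ModuleCat.of Γ PUnit.{u + 1})
  have := h₃.subsingleton
  have := (rid (Γ := Γ) (((tensorBimod Γ M).iter (m + 1)).obj X)).symm.injective.subsingleton
  exact FGModuleCat.isZero_of_subsingleton _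

end

/-! ### Verification of the homological conditions from a bimodule resolution. -/

namespace BimoduleResolution

variable {Γ : Type u} [Ring Γ] [IsNoetherianRing Γᵐᵒᵖ] {D : BimoduleResolution Γ}

instance (i : ℕ) : Module.Finite Γᵐᵒᵖ (D.Ω i).carrier := D.finite_Ω i

instance (i : ℕ) : Module.Finite Γᵐᵒᵖ (D.R i).carrier := D.finite_R i

variable (D) in
/-- The functor `- ⊗ Ω i`. -/
abbrev tensorΩ (i : ℕ) : FGRightMod Γ ⥤ FGRightMod Γ := tensorBimod Γ (D.Ω i).carrier

variable (D) in
/-- The functor `- ⊗ R i`. -/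
abbrev tensorR (i : ℕ) : FGRightMod Γ ⥤ FGRightMod Γ := tensorBimod Γ (D.R i).carrier

variable (D) in
/-- The functor `- ⊗ M`. -/
abbrev F : FGRightMod Γ ⥤ FGRightMod Γ := tensorBimod Γ D.M

variable (D) in
/-- The natural transformation induced by the inclusions. -/
abbrev natIncl (i : ℕ) : D.tensorΩ (i + 1) ⟶ D.tensorR i := tensorBimodMap (D.incl i) (D.incl_smul i)

variable (D) in
/-- The natural transformation induced by the projections. -/
abbrev natProj (i : ℕ) : D.tensorR i ⟶ D.tensorΩ i := tensorBimodMap (D.proj i) (D.proj_smul i)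

omit [IsNoetherianRing Γᵐᵒᵖ] in
lemma natIncl_natProj (i : ℕ) (X : FGRightMod Γ) :
    (D.natIncl i).app X ≫ (D.natProj i).app X = 0 := by
  ext t
  exact (exact_map_right X _ _ (D.exact i) (D.surjective i)).apply_apply_eq_zero t

lemma natIncl_natProj_exact (i : ℕ) (X : FGRightMod Γ) :
    (ShortComplex.mk _ _ (D.natIncl_natProj i X)).Exact :=
  (FGModuleCat.exact_iff _).2 (exact_map_right X _ _ (D.exact i) (D.surjective i))

instance (i : ℕ) (X : FGRightMod Γ) : Epi ((D.natProj i).app X) :=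
  (FGModuleCat.epi_iff _).2 (map_surjective _ _ Function.surjective_id (D.surjective i))

lemma rightVanishing_iff (X : FGRightMod Γ) :
    D.RightVanishing X ↔ ∀ i, Mono ((D.natIncl i).app X) :=
  forall_congr' fun i => (FGModuleCat.mono_iff ((D.natIncl i).app X)).symm

lemma RightVanishing.shortExact {X : FGRightMod Γ} (hX : D.RightVanishing X) (i : ℕ) :
    (ShortComplex.mk _ _ (D.natIncl_natProj i X)).ShortExact :=
  { exact := D.natIncl_natProj_exact i X
    mono_f := (rightVanishing_iff X).1 hX i
    epi_g := inferInstanceAs (Epi ((D.natProj i).app X)) }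

omit D in
lemma _root_.FGRightMod.projective_iff (P : FGRightMod Γ) :
    Projective P ↔ FinRetract Γᵐᵒᵖ Γ P := by
  let a : Γᵐᵒᵖ →ₗ[Γᵐᵒᵖ] Γ :=
    { toFun := unop, map_add' := fun _ _ => rfl, map_smul' := fun _ _ => rfl }
  let b : Γ →ₗ[Γᵐᵒᵖ] Γᵐᵒᵖ :=
    { toFun := op, map_add' := fun _ _ => rfl, map_smul' := fun _ _ => rfl }
  rw [FGModuleCat.projective_iff]
  exact ⟨(FinRetract.of_retract a b fun _ => rfl).trans,
    (FinRetract.of_retract b a fun _ => rfl).trans⟩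

lemma projective_tensorR (i : ℕ) (X : FGRightMod Γ) : Projective ((D.tensorR i).obj X) :=
  (FGRightMod.projective_iff _).2 (D.tensor_R i X)

lemma projective_tensorΩ (X : FGRightMod Γ) : Projective ((D.tensorΩ D.length).obj X) :=
  (FGRightMod.projective_iff _).2 (D.tensor_Ω X)

lemma preservesMonomorphisms_tensor (B : BimoduleObj Γ) [Module.Finite Γᵐᵒᵖ B.carrier]
    (h : FinRetract Γ Γ B.carrier) : (tensorBimod Γ B.carrier).PreservesMonomorphisms where
  preserves f _ := (FGModuleCat.mono_iff _).2
    (map_left_injective ((FGModuleCat.mono_iff f).1 inferInstance) h)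

/-- The tensored sequences form a finite projective resolution of `X ⊗ M`, since every `X ⊗ R i` and
the last `X ⊗ Ω n` are projective. -/
lemma RightVanishing.finProjDim {X : FGRightMod Γ} (hX : D.RightVanishing X) :
    FinProjDim (D.F.obj X) := by
  suffices ∀ i ≤ D.length, FinProjDim ((D.tensorΩ i).obj X) from this 0 (Nat.zero_le _)
  intro i hi
  induction hi using Nat.decreasingInduction with
  | self => exact .of_projective _ (D.projective_tensorΩ X)
  | of_succ i _ ih =>
    exact .of_shortExact _ (hX.shortExact i) ih (.of_projective _ (D.projective_tensorR i X))

variable (h : D.PowVanishing)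
include h

omit [IsNoetherianRing Γᵐᵒᵖ] in
lemma PowVanishing.rightVanishing_iter (V : FGRightMod Γ)
    (hV : FinRetract Γᵐᵒᵖ (Γ × D.M) V) (j : ℕ) : D.RightVanishing ((D.F.iter j).obj V) :=
  fun i => (injective_map_iter_iff V j (ModuleCat.ofHom (D.incl i))).2 (h.injective_iter V hV i j)

section

variable {C : Type u'} [Category.{v'} C] [Abelian C] {U : C ⥤ FGRightMod Γ} [U.Additive]
  [PreservesFiniteLimits U] [PreservesFiniteColimits U]
  (hU : ∀ (P : C) [Projective P], FinRetract Γᵐᵒᵖ (Γ × D.M) (U.obj P))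
include hU

-- Descending induction on `i` from the last syzygy, which is projective on the left and so tensors
-- exactly. The step is `ExactOnGProj.cokernel`; injectivity on projectives holds because `U` sends
-- them to summands of powers of `Γ ⊕ M`.
omit [PreservesFiniteLimits U] in
lemma PowVanishing.exactOnGProj_tensorΩ (j : ℕ) (hj : ExactOnGProj (U ⋙ D.F.iter j)) (i : ℕ)
    (hi : i ≤ D.length) : ExactOnGProj ((U ⋙ D.F.iter j) ⋙ D.tensorΩ i) := by
  induction hi using Nat.decreasingInduction with
  | self =>
    have := preservesMonomorphisms_tensor (D.Ω D.length) D.left_Ω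
    exact hj.comp _
  | of_succ i _ ih =>
    have := preservesMonomorphisms_tensor (D.R i) (D.left_R i)
    have : PreservesFiniteColimits (U ⋙ D.F.iter j) := comp_preservesFiniteColimits _ _
    have : PreservesFiniteColimits ((U ⋙ D.F.iter j) ⋙ D.tensorΩ (i + 1)) :=
      comp_preservesFiniteColimits _ _
    exact .cokernel ih (hj.comp (D.tensorR i)) (Functor.whiskerLeft _ (D.natIncl i))
      (Functor.whiskerLeft _ (D.natProj i)) (fun X => D.natIncl_natProj i _)
      (fun X => D.natIncl_natProj_exact i _)
      (fun X => inferInstanceAs (Epi ((D.natProj i).app _)))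
      (fun P _ => (rightVanishing_iff _).1 (h.rightVanishing_iter _ (hU P) j) i)

lemma PowVanishing.exactOnGProj (j : ℕ) : ExactOnGProj (U ⋙ D.F.iter j) := by
  induction j with
  | zero =>
    have : PreservesFiniteLimits (U ⋙ D.F.iter 0) := inferInstanceAs (PreservesFiniteLimits U)
    exact .of_preservesMonomorphisms _
  | succ j ih => exact h.exactOnGProj_tensorΩ hU j ih 0 (Nat.zero_le _)

/-- Since `- ⊗ Ω (i+1)` after `U ⋙ F^j` is exact on Gorenstein projectives, injectivity of the
inclusions passes from projectives to `Y`, so the resolution of `M` stays exact on `F^j U Y`. -/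
lemma PowVanishing.finProjDim_iter (j : ℕ) {Y : C} (hY : gorensteinProjective C Y) :
    FinProjDim ((D.F.iter (j + 1)).obj (U.obj Y)) := by
  have hj := h.exactOnGProj hU j
  suffices ∀ i ≤ D.length, FinProjDim ((D.tensorΩ i).obj ((D.F.iter j).obj (U.obj Y))) from
    this 0 (Nat.zero_le _)
  intro i hi
  induction hi using Nat.decreasingInduction with
  | self => exact .of_projective _ (D.projective_tensorΩ _)
  | of_succ i hi ih =>
    refine .of_shortExact (ShortComplex.mk _ _ (D.natIncl_natProj i _))
      { exact := D.natIncl_natProj_exact i _, mono_f := ?_,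
        epi_g := inferInstanceAs (Epi ((D.natProj i).app _)) } ih
      (.of_projective _ (D.projective_tensorR i _))
    exact ExactOnGProj.mono_app (T₁ := (U ⋙ D.F.iter j) ⋙ D.tensorΩ (i + 1))
      (h.exactOnGProj_tensorΩ hU j hj (i + 1) hi) (Functor.whiskerLeft _ (D.natIncl i))
      (fun P _ => (rightVanishing_iff _).1 (h.rightVanishing_iter _ (hU P) j) i) hY

end

omit h in
lemma finRetract_of_projective (P : FGRightMod Γ) [Projective P] :
    FinRetract Γᵐᵒᵖ (Γ × D.M) P :=
  (FinRetract.of_retract (LinearMap.inl Γᵐᵒᵖ Γ D.M) (LinearMap.fst Γᵐᵒᵖ Γ D.M)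
    fun _ => rfl).trans ((FGRightMod.projective_iff P).1 inferInstance)

lemma PowVanishing.exactOnGProj_F : ExactOnGProj D.F :=
  h.exactOnGProj (U := 𝟭 _) (fun P _ => finRetract_of_projective P) 1

lemma PowVanishing.finProjDim_F (P : FGRightMod Γ) [Projective P] : FinProjDim (D.F.obj P) :=
  (h.rightVanishing_iter P (finRetract_of_projective P) 0).finProjDim

-- `V ⊗ Ω (i+1)` is the kernel of `V ⊗ R i → V ⊗ Ω i`, whose middle term is projective; this
-- propagates vanishing from `V ⊗ Ω 0 = F V`.
omit h in
lemma RightVanishing.tensorΩ {V : FGRightMod Γ} (hV : D.RightVanishing V)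
    (hV' : D.RightVanishing (D.F.obj V)) : ∀ i, D.RightVanishing ((D.tensorΩ i).obj V)
  | 0 => hV'
  | i + 1 =>
    have hS := (FGModuleCat.shortExact_iff _).1 (hV.shortExact i)
    (hV.tensorΩ hV' i).of_exact (D.rightVanishing_self.of_finRetract (D.tensor_R i V))
      hS.1 hS.2.1 hS.2.2

/-- `l` turns the tensored resolution of `F^j P ⊗ M` into a finite projective one. By `hm` its
exactness needs the inclusions to stay injective under `F`, which is vanishing for `V ⊗ Ω i`. -/
lemma PowVanishing.finProjDim_map {C : Type u'} [Category.{v'} C] [Abelian C]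
    {l : FGRightMod Γ ⥤ C} [l.Additive] [PreservesFiniteColimits l]
    (hl : ∀ (P : FGRightMod Γ) [Projective P], Projective (l.obj P))
    (hm : ∀ {A B : FGRightMod Γ} (f : A ⟶ B) [Mono f] [Mono (D.F.map f)], Mono (l.map f)) (j : ℕ)
    (P : FGRightMod Γ) [Projective P] : FinProjDim (l.obj ((D.F.iter j).obj P)) := by
  cases j with
  | zero => exact .of_projective _ (hl P)
  | succ j =>
    have hV := h.rightVanishing_iter P (finRetract_of_projective P) j
    have hV' := hV.tensorΩ (h.rightVanishing_iter P (finRetract_of_projective P) (j + 1))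
    suffices ∀ i ≤ D.length, FinProjDim (l.obj ((D.tensorΩ i).obj ((D.F.iter j).obj P))) from
      this 0 (Nat.zero_le _)
    intro i hi
    induction hi using Nat.decreasingInduction with
    | self =>
      have := D.projective_tensorΩ ((D.F.iter j).obj P)
      exact .of_projective _ (hl _)
    | of_succ i _ ih =>
      have hS := hV.shortExact i
      have := hS.mono_f
      have hS' := (FGModuleCat.shortExact_iff _).1 hS
      have : Mono (D.F.map ((D.natIncl i).app ((D.F.iter j).obj P))) :=
        (FGModuleCat.mono_iff _).2 ((hV' i).injective_map hS'.1 hS'.2.1 hS'.2.2 0)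
      have := D.projective_tensorR i ((D.F.iter j).obj P)
      have hl' := (Functor.preservesFiniteColimits_iff_forall_exact_map_and_epi l).1 inferInstance
        _ hS
      exact .of_shortExact _ { exact := hl'.1, mono_f := hm _, epi_g := hl'.2 } ih
        (.of_projective _ (hl _))

end BimoduleResolution

end

/-! ### The free module `X ⊗_Γ Λ` and the adjunction with restriction. -/

noncomputable section

open NCTensor

namespace ThetaExt

variable {Γ : Type u} [Ring Γ] {M : Type u} [AddCommGroup M] [Module Γ M] [Module Γᵐᵒᵖ M]
  [SMulCommClass Γ Γᵐᵒᵖ M] (θ : ThetaMap Γ M)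

/-- The inclusion `M → Γ ⋉_θ M`. -/
def inr : M →+ ThetaExt θ where
  toFun m := (0, m)
  map_zero' := rfl
  map_add' _ _ := ThetaExt.ext (add_zero (0 : Γ)).symm rfl

/-- The projection `Γ ⋉_θ M → Γ`. -/
def fst : ThetaExt θ →+* Γ where
  toFun x := x.1
  map_one' := rfl
  map_mul' _ _ := rfl
  map_zero' := rfl
  map_add' _ _ := rfl

@[simp] lemma inr_fst (m : M) : (inr θ m).1 = 0 := rfl
@[simp] lemma inr_snd (m : M) : (inr θ m).2 = m := rfl
@[simp] lemma inl_fst (γ : Γ) : (inl θ γ).1 = γ := rfl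
@[simp] lemma inl_snd (γ : Γ) : (inl θ γ).2 = 0 := rfl

lemma inl_add_inr (x : ThetaExt θ) : inl θ x.1 + inr θ x.2 = x :=
  ThetaExt.ext (add_zero _) (zero_add _)

lemma inl_mul_inr (γ : Γ) (m : M) : inl θ γ * inr θ m = inr θ (γ • m) := by
  ext <;> simp [θ.zero_mul]

lemma inr_mul_inl (γ : Γ) (m : M) : inr θ m * inl θ γ = inr θ (op γ • m) := by
  ext <;> simp [θ.mul_zero]

lemma inr_mul_inr (m m' : M) : inr θ m * inr θ m' = inr θ (θ.mul m m') := by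
  ext <;> simp

lemma mul_inl (x : ThetaExt θ) (γ : Γ) : x * inl θ γ = (x.1 * γ, op γ • x.2) := by
  apply ThetaExt.ext
  · rfl
  · simp [θ.mul_zero]

/-- Right multiplication by an element of `M`. -/
def mulRight (m : M) : M →ₗ[Γ] M where
  toFun a := θ.mul a m
  map_add' a b := θ.add_mul a b m
  map_smul' γ a := θ.smul_mul γ a m

lemma mulRight_apply (m a : M) : mulRight θ m a = θ.mul a m := rfl

/-- The underlying group of the free right module over `Γ ⋉_θ M` on a right `Γ`-module. -/
def Free (_ : ThetaMap Γ M) (X : Type u) [AddCommGroup X] [Module Γᵐᵒᵖ X] : Type u :=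
  X × NCTensor Γ X M

section Free

variable (X : Type u) [AddCommGroup X] [Module Γᵐᵒᵖ X]

instance : AddCommGroup (Free θ X) := inferInstanceAs (AddCommGroup (X × NCTensor Γ X M))

/-- The action on `X ⊗_Γ Λ = X ⊕ (X ⊗_Γ M)`: an element `m` of `M` moves `x` to `x ⊗ m` and acts on
`X ⊗ M` by `θ`. -/
instance : SMul (ThetaExt θ)ᵐᵒᵖ (Free θ X) where
  smul r x := (op r.unop.1 • x.1,
    tmul Γ x.1 r.unop.2 + op r.unop.1 • x.2 + map LinearMap.id (mulRight θ r.unop.2) x.2)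

variable {X}

@[ext] lemma Free.ext {x y : Free θ X} (h₁ : x.1 = y.1) (h₂ : x.2 = y.2) : x = y := Prod.ext h₁ h₂

@[simp] lemma Free.smul_fst (r : (ThetaExt θ)ᵐᵒᵖ) (x : Free θ X) :
    (r • x).1 = op r.unop.1 • x.1 := rfl

@[simp] lemma Free.smul_snd (r : (ThetaExt θ)ᵐᵒᵖ) (x : Free θ X) : (r • x).2 =
    tmul Γ x.1 r.unop.2 + op r.unop.1 • x.2 + map LinearMap.id (mulRight θ r.unop.2) x.2 := rfl

@[simp] lemma Free.add_fst (x y : Free θ X) : (x + y).1 = x.1 + y.1 := rfl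
@[simp] lemma Free.add_snd (x y : Free θ X) : (x + y).2 = x.2 + y.2 := rfl
@[simp] lemma Free.zero_fst : (0 : Free θ X).1 = 0 := rfl
@[simp] lemma Free.zero_snd : (0 : Free θ X).2 = 0 := rfl

lemma mulRight_add (m m' : M) : mulRight θ (m + m') = mulRight θ m + mulRight θ m' := by
  ext a; exact θ.mul_add a m m'

lemma mulRight_zero : mulRight θ (0 : M) = 0 := by
  ext a; exact θ.mul_zero a

/-- This is associativity of `θ`, needed for the multiplicativity law of the free module. -/
lemma mulRight_comp (m m' : M) : mulRight θ m' ∘ₗ mulRight θ m = mulRight θ (θ.mul m m') := by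
  ext a; exact θ.assoc a m m'

lemma map_mulRight_smul (γ : Γ) (m : M) (t : NCTensor Γ X M) :
    map LinearMap.id (mulRight θ (γ • m)) t = map LinearMap.id (mulRight θ m) (op γ • t) :=
  DFunLike.congr_fun (hom_ext (f := map LinearMap.id (mulRight θ (γ • m)))
    (g := (map LinearMap.id (mulRight θ m)).comp (DistribSMul.toAddMonoidHom _ (op γ)))
    fun x a => congrArg (tmul Γ x) (θ.op_smul_mul γ a m).symm) t

lemma map_mulRight_op_smul (γ : Γᵐᵒᵖ) (m : M) (t : NCTensor Γ X M) :
    map LinearMap.id (mulRight θ (γ • m)) t = γ • map LinearMap.id (mulRight θ m) t :=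
  DFunLike.congr_fun (hom_ext (f := map LinearMap.id (mulRight θ (γ • m)))
    (g := (DistribSMul.toAddMonoidHom _ γ).comp (map LinearMap.id (mulRight θ m)))
    fun x a => congrArg (tmul Γ x) (θ.mul_op_smul γ a m)) t

instance : Module (ThetaExt θ)ᵐᵒᵖ (Free θ X) where
  one_smul x := by
    ext
    · simp
    · simp [tmul_zero, mulRight_zero, map_zero_right]
  mul_smul r s x := by
    ext
    · simp [mul_smul]
    · simp only [Free.smul_snd, Free.smul_fst, unop_mul, mul_fst, mul_snd, tmul_add,
        mulRight_add, map_add_right, map_mulRight_smul, map_mulRight_op_smul, smul_add, map_add,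
        map_map, mulRight_apply, op_mul, mul_smul, smul_tmul, smul_tmul_right, ← mulRight_comp,
        LinearMap.id_comp, map_tmul, LinearMap.id_apply]
      abel
  smul_zero r := by
    ext
    · simp
    · simp [zero_tmul]
  smul_add r x y := by
    ext
    · simp
    · simp only [Free.smul_snd, Free.add_fst, Free.add_snd, NCTensor.add_tmul, smul_add, map_add]
      abel
  add_smul r s x := by
    ext
    · simp [add_smul]
    · simp only [Free.smul_snd, Free.add_snd, MulOpposite.unop_add, ThetaExt.add_fst,
        ThetaExt.add_snd, NCTensor.tmul_add, mulRight_add, map_add_right, MulOpposite.op_add,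
        add_smul]
      abel
  zero_smul x := by
    ext
    · simp
    · simp [tmul_zero, mulRight_zero, map_zero_right]

end Free

end ThetaExt

end

noncomputable section

open NCTensor

namespace ThetaExt

variable {Γ : Type u} [Ring Γ] {M : Type u} [AddCommGroup M] [Module Γ M] [Module Γᵐᵒᵖ M]
  [SMulCommClass Γ Γᵐᵒᵖ M] [Module.Finite Γᵐᵒᵖ M] (θ : ThetaMap Γ M)

omit [Module.Finite Γᵐᵒᵖ M] in
lemma finite_of_finite (Y : Type u) [AddCommGroup Y] [Module (ThetaExt θ)ᵐᵒᵖ Y] [Module Γᵐᵒᵖ Y]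
    [Module.Finite Γᵐᵒᵖ Y] (h : ∀ (γ : Γᵐᵒᵖ) (y : Y), γ • y = op (inl θ γ.unop) • y) :
    Module.Finite (ThetaExt θ)ᵐᵒᵖ Y := by
  let _ : Module Γᵐᵒᵖ (ThetaExt θ)ᵐᵒᵖ := Module.compHom _ (inl θ).op
  have : IsScalarTower Γᵐᵒᵖ (ThetaExt θ)ᵐᵒᵖ Y := ⟨fun γ r y => by
    rw [h, ← mul_smul]; rfl⟩
  exact Module.Finite.of_restrictScalars_finite Γᵐᵒᵖ _ Y

omit [Module.Finite Γᵐᵒᵖ M] in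
lemma Free.op_inl_smul {X : Type u} [AddCommGroup X] [Module Γᵐᵒᵖ X] (γ : Γᵐᵒᵖ) (x : Free θ X) :
    op (inl θ γ.unop) • x = (γ • x.1, γ • x.2) := by
  apply Free.ext
  · rfl
  · simp [tmul_zero, mulRight_zero, map_zero_right]

omit [Module.Finite Γᵐᵒᵖ M] in
lemma Free.op_inr_smul {X : Type u} [AddCommGroup X] [Module Γᵐᵒᵖ X] (m : M) (x : Free θ X) :
    op (inr θ m) • x = (0, tmul Γ x.1 m + map LinearMap.id (mulRight θ m) x.2) := by
  apply Free.ext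
  · simp
  · simp

instance (X : Type u) [AddCommGroup X] [Module Γᵐᵒᵖ X] [Module.Finite Γᵐᵒᵖ X] :
    Module.Finite (ThetaExt θ)ᵐᵒᵖ (Free θ X) :=
  let _ : Module Γᵐᵒᵖ (Free θ X) := inferInstanceAs (Module Γᵐᵒᵖ (X × NCTensor Γ X M))
  have : Module.Finite Γᵐᵒᵖ (Free θ X) :=
    inferInstanceAs (Module.Finite Γᵐᵒᵖ (X × NCTensor Γ X M))
  finite_of_finite θ _ fun γ y => (Free.op_inl_smul θ γ y).symm

/-- Functoriality of free modules. -/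
def Free.map {X Y : Type u} [AddCommGroup X] [Module Γᵐᵒᵖ X] [AddCommGroup Y] [Module Γᵐᵒᵖ Y]
    (f : X →ₗ[Γᵐᵒᵖ] Y) : Free θ X →ₗ[(ThetaExt θ)ᵐᵒᵖ] Free θ Y where
  toFun x := (f x.1, NCTensor.map f LinearMap.id x.2)
  map_add' x y := Free.ext θ (f.map_add _ _) (map_add _ _ _)
  map_smul' r x := Free.ext θ (f.map_smul _ _) <| by
    have h := (mapRight f (LinearMap.id : M →ₗ[Γ] M) fun _ _ => rfl).map_smul (op r.unop.1) x.2
    change NCTensor.map f LinearMap.id (op r.unop.1 • x.2) = _ at h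
    change NCTensor.map f LinearMap.id (r • x).2 = _
    rw [Free.smul_snd, map_add, map_add, h, ← map_comm]
    rfl

/-- The functor sending a right module over `Γ` to the free right module over `Γ ⋉_θ M` on it. -/
def freeFunctor : FGRightMod Γ ⥤ FGRightMod (ThetaExt θ) where
  obj X := FGModuleCat.of _ (Free θ X)
  map f := FGModuleCat.ofHom (Free.map θ f.hom.hom)
  map_id X := FGModuleCat.hom_ext (LinearMap.ext fun (x : X × NCTensor Γ X M) =>
    congrArg (Prod.mk x.1) (NCTensor.map_id x.2))
  map_comp {X _ _} f g := FGModuleCat.hom_ext (LinearMap.ext fun (x : X × NCTensor Γ X M) =>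
    congrArg (Prod.mk (g.hom.hom (f.hom.hom x.1)))
      (map_map f.hom.hom g.hom.hom LinearMap.id LinearMap.id x.2).symm)

variable {θ} in
/-- The restriction of a morphism. -/
abbrev restrictMap {Y Z : FGRightMod (ThetaExt θ)} (f : Y →ₗ[(ThetaExt θ)ᵐᵒᵖ] Z) :
    (restriction θ).obj Y →ₗ[Γᵐᵒᵖ] (restriction θ).obj Z where
  toFun := f
  map_add' := f.map_add
  map_smul' γ y := f.map_smul (op (inl θ γ.unop)) y

variable {θ} in
/-- The action of `M` on a module over `Γ ⋉_θ M`. -/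
def act (Y : FGRightMod (ThetaExt θ)) :
    NCTensor Γ ((restriction θ).obj Y) M →ₗ[Γᵐᵒᵖ] (restriction θ).obj Y :=
  let φ : NCTensor Γ ((restriction θ).obj Y) M →+ Y := lift
    (AddMonoidHom.mk' (fun (y : Y) => AddMonoidHom.mk' (fun m => op (inr θ m) • y)
      (fun m m' => by rw [map_add, MulOpposite.op_add, add_smul]))
      (fun y y' => by ext m; exact smul_add _ _ _))
    (fun (y : Y) γ m => show op (inr θ m) • op (inl θ γ) • y = op (inr θ (γ • m)) • y by
      rw [← mul_smul, ← op_mul, inl_mul_inr])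
  { φ with
    map_smul' := fun γ t => DFunLike.congr_fun (hom_ext
      (f := φ.comp (DistribSMul.toAddMonoidHom _ γ))
      (g := (DistribSMul.toAddMonoidHom Y (op (inl θ γ.unop))).comp φ)
      (fun (y : Y) m => show op (inr θ (γ • m)) • y = op (inl θ γ.unop) • op (inr θ m) • y by
        rw [← mul_smul, ← op_mul, inr_mul_inl, op_unop])) t }

/-- The identity `y (a m) = (y a) m`, which makes the counit linear over `M`. -/
lemma act_mulRight (Y : FGRightMod (ThetaExt θ)) (m : M)
    (t : NCTensor Γ ((restriction θ).obj Y) M) :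
    act Y (NCTensor.map LinearMap.id (mulRight θ m) t) = op (inr θ m) • (show Y from act Y t) :=
  DFunLike.congr_fun (hom_ext
    (f := (act Y).toAddMonoidHom.comp (NCTensor.map LinearMap.id (mulRight θ m)))
    (g := (DistribSMul.toAddMonoidHom Y (op (inr θ m))).comp (act Y).toAddMonoidHom)
    (fun (y : Y) a => show op (inr θ (θ.mul a m)) • y = op (inr θ m) • op (inr θ a) • y by
      rw [← mul_smul, ← op_mul, inr_mul_inr])) t

lemma act_naturality {Y Z : FGRightMod (ThetaExt θ)} (f : Y ⟶ Z)
    (t : NCTensor Γ ((restriction θ).obj Y) M) :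
    act Z (NCTensor.map (restrictMap f.hom.hom) LinearMap.id t) = f.hom.hom (act Y t) :=
  DFunLike.congr_fun (hom_ext
    (f := (act Z).toAddMonoidHom.comp (NCTensor.map (restrictMap f.hom.hom) LinearMap.id))
    (g := f.hom.hom.toAddMonoidHom.comp (act Y).toAddMonoidHom)
    (fun (y : Y) m => (f.hom.hom.map_smul (op (inr θ m)) y).symm)) t

/-- The unit of the adjunction. -/
def freeUnit (X : FGRightMod Γ) : X →ₗ[Γᵐᵒᵖ] (restriction θ).obj ((freeFunctor θ).obj X) where
  toFun x := show Free θ X from (x, 0)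
  map_add' _ _ := Free.ext θ rfl (add_zero 0).symm
  map_smul' γ x := ((Free.op_inl_smul θ γ (x, 0)).trans (Free.ext θ rfl (smul_zero _))).symm

variable {θ} in
/-- The counit of the adjunction. -/
def freeCounit (Y : FGRightMod (ThetaExt θ)) :
    Free θ ((restriction θ).obj Y) →ₗ[(ThetaExt θ)ᵐᵒᵖ] Y :=
  let φ : Free θ ((restriction θ).obj Y) →+ Y :=
    AddMonoidHom.coprod (AddMonoidHom.id Y) (act Y).toAddMonoidHom
  { φ with
    map_smul' := fun r (x : Free θ ((restriction θ).obj Y)) => by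
      change φ (r • x) = r • φ x
      have hr : r = op (inl θ r.unop.1) + op (inr θ r.unop.2) := by
        rw [← MulOpposite.op_add, inl_add_inr, op_unop]
      rw [hr, add_smul, add_smul, map_add]
      congr 1
      · refine (congrArg φ (Free.op_inl_smul θ (op r.unop.1) x)).trans ?_
        refine Eq.trans ?_ (smul_add (op (inl θ r.unop.1)) (show Y from x.1)
          (show Y from act Y x.2)).symm
        exact congrArg (op (inl θ r.unop.1) • (show Y from x.1) + ·)
          ((act Y).map_smul (op r.unop.1) x.2)
      · refine (congrArg φ (Free.op_inr_smul θ r.unop.2 x)).trans ?_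
        refine Eq.trans ?_ (smul_add (op (inr θ r.unop.2)) (show Y from x.1)
          (show Y from act Y x.2)).symm
        refine (zero_add _).trans (((act Y).map_add _ _).trans ?_)
        exact congrArg (op (inr θ r.unop.2) • (show Y from x.1) + ·)
          (act_mulRight θ Y r.unop.2 x.2) }

/-- The unit of the adjunction as a morphism. -/
def freeUnitHom (X : FGRightMod Γ) : X ⟶ (restriction θ).obj ((freeFunctor θ).obj X) :=
  ObjectProperty.homMk (X := X) (Y := (restriction θ).obj ((freeFunctor θ).obj X))
    (ModuleCat.ofHom (X := X.obj) (Y := ((restriction θ).obj ((freeFunctor θ).obj X)).obj)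
      (freeUnit θ X))

/-- `M` acting on the generators `X` of the free module gives exactly the summand `X ⊗ M`, which is
the left triangle identity. -/
lemma act_freeUnit (X : FGRightMod Γ) (t : NCTensor Γ X M) :
    act ((freeFunctor θ).obj X) (NCTensor.map (freeUnit θ X) LinearMap.id t) =
      (show Free θ X from (0, t)) :=
  DFunLike.congr_fun (hom_ext
    (f := (act ((freeFunctor θ).obj X)).toAddMonoidHom.comp
      (NCTensor.map (freeUnit θ X) LinearMap.id))
    (g := AddMonoidHom.inr X (NCTensor Γ X M))
    (fun x m => (Free.op_inr_smul θ m (x, 0)).trans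
      (congrArg (Prod.mk 0) ((congrArg (tmul Γ x m + ·) (map_zero _)).trans (add_zero _))))) t

/-- The counit of the adjunction as a morphism. -/
def freeCounitHom (Y : FGRightMod (ThetaExt θ)) :
    (freeFunctor θ).obj ((restriction θ).obj Y) ⟶ Y :=
  ObjectProperty.homMk (ModuleCat.ofHom (freeCounit Y))

lemma freeCounitHom_naturality {Y Z : FGRightMod (ThetaExt θ)} (f : Y ⟶ Z) :
    (freeFunctor θ).map ((restriction θ).map f) ≫ freeCounitHom θ Z = freeCounitHom θ Y ≫ f :=
  FGModuleCat.hom_ext (LinearMap.ext fun (x : Free θ ((restriction θ).obj Y)) => by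
    refine Eq.trans ?_ (f.hom.hom.map_add (show Y from x.1) (act Y x.2)).symm
    exact congrArg (f.hom.hom (show Y from x.1) + ·) (act_naturality θ f x.2))

/-- Restriction is right adjoint to the formation of free modules. -/
def freeAdj : freeFunctor θ ⊣ restriction θ where
  unit :=
    { app := freeUnitHom θ
      naturality X Y f := FGModuleCat.hom_ext (LinearMap.ext fun (x : X) =>
        congrArg (Prod.mk (f.hom.hom x))
          (map_zero (NCTensor.map f.hom.hom (LinearMap.id : M →ₗ[Γ] M))).symm) }
  counit :=
    { app := freeCounitHom θ
      naturality Y Z f := freeCounitHom_naturality θ f }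
  left_triangle_components X := FGModuleCat.hom_ext (LinearMap.ext fun (x : Free θ X) => by
    refine (congrArg (((x.1, 0) : Free θ X) + ·) (act_freeUnit θ X x.2)).trans ?_
    exact Free.ext θ (add_zero _) (zero_add _))
  right_triangle_components Y := FGModuleCat.hom_ext (LinearMap.ext fun (y : Y) =>
    (congrArg (y + ·) (map_zero (act Y))).trans (add_zero y))

end ThetaExt

end

/-! ### The kernel of the counit, coinvariants, and the proof of the theorem. -/

noncomputable section

open NCTensor

namespace ThetaExt

variable {Γ : Type u} [Ring Γ] {M : Type u} [AddCommGroup M] [Module Γ M] [Module Γᵐᵒᵖ M]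
  [SMulCommClass Γ Γᵐᵒᵖ M] [Module.Finite Γᵐᵒᵖ M] (θ : ThetaMap Γ M)

variable {θ} in
/-- The inclusion of the kernel of the counit. -/
def kernelInclusion (Y : FGRightMod (ThetaExt θ)) :
    NCTensor Γ ((restriction θ).obj Y) M →ₗ[Γᵐᵒᵖ]
      (restriction θ).obj ((freeFunctor θ).obj ((restriction θ).obj Y)) where
  -- The counit is `(y, t) ↦ y + act t`, so its kernel consists of the pairs `(act t, -t)`.
  toFun t := show Free θ ((restriction θ).obj Y) from (act Y t, -t)
  map_add' s t := Free.ext θ ((act Y).map_add s t) (neg_add s t)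
  map_smul' γ t := ((Free.op_inl_smul θ γ (act Y t, -t)).trans
    (Free.ext θ ((act Y).map_smul γ t).symm (smul_neg γ t))).symm

/-- The inclusion of the kernel of the counit as a morphism. -/
def kernelInclusionHom (Y : FGRightMod (ThetaExt θ)) :
    (tensorBimod Γ M).obj ((restriction θ).obj Y) ⟶
      (restriction θ).obj ((freeFunctor θ).obj ((restriction θ).obj Y)) :=
  ObjectProperty.homMk (X := (tensorBimod Γ M).obj ((restriction θ).obj Y))
    (Y := (restriction θ).obj ((freeFunctor θ).obj ((restriction θ).obj Y)))
    (ModuleCat.ofHom (X := ((tensorBimod Γ M).obj ((restriction θ).obj Y)).obj)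
      (Y := ((restriction θ).obj ((freeFunctor θ).obj ((restriction θ).obj Y))).obj)
      (kernelInclusion Y))

lemma kernelInclusionHom_naturality {Y Z : FGRightMod (ThetaExt θ)} (f : Y ⟶ Z) :
    (tensorBimod Γ M).map ((restriction θ).map f) ≫ kernelInclusionHom θ Z =
      kernelInclusionHom θ Y ≫ (restriction θ).map ((freeFunctor θ).map ((restriction θ).map f)) :=
  FGModuleCat.hom_ext (LinearMap.ext fun t => Free.ext θ (act_naturality θ f t)
    (map_neg (NCTensor.map (restrictMap f.hom.hom) (LinearMap.id : M →ₗ[Γ] M)) t).symm)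

lemma kernelInclusionHom_counit (Y : FGRightMod (ThetaExt θ)) :
    kernelInclusionHom θ Y ≫ (restriction θ).map ((freeAdj θ).counit.app Y) = 0 :=
  FGModuleCat.hom_ext (LinearMap.ext fun t =>
    (congrArg (act Y t + ·) ((act Y).map_neg t)).trans (add_neg_cancel (act Y t)))

instance (Y : FGRightMod (ThetaExt θ)) [IsNoetherianRing Γᵐᵒᵖ] : Mono (kernelInclusionHom θ Y) :=
  (FGModuleCat.mono_iff _).2 fun _ _ h => neg_injective (congrArg Prod.snd h)

lemma kernelInclusionHom_exact [IsNoetherianRing Γᵐᵒᵖ] (Y : FGRightMod (ThetaExt θ)) :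
    (ShortComplex.mk _ _ (kernelInclusionHom_counit θ Y)).Exact := by
  refine (FGModuleCat.exact_iff _).2 fun (x : Free θ ((restriction θ).obj Y)) => ⟨fun h => ?_, ?_⟩
  · have h' : x.1 + act Y x.2 = 0 := h
    refine ⟨-x.2, Free.ext θ (((act Y).map_neg x.2).trans ?_) (neg_neg x.2)⟩
    exact (eq_neg_of_add_eq_zero_left h').symm
  · rintro ⟨t, rfl⟩
    exact congr($(kernelInclusionHom_counit θ Y).hom.hom t)

omit [Module.Finite Γᵐᵒᵖ M] in
lemma finite_fst_op : letI := Module.compHom Γᵐᵒᵖ (fst θ).op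
    Module.Finite (ThetaExt θ)ᵐᵒᵖ Γᵐᵒᵖ := by
  let _ := Module.compHom Γᵐᵒᵖ (fst θ).op
  refine Module.Finite.of_surjective (LinearMap.toSpanSingleton (ThetaExt θ)ᵐᵒᵖ Γᵐᵒᵖ 1) fun γ => ?_
  exact ⟨op (inl θ γ.unop), mul_one γ⟩

/-- Restriction of scalars along the projection `Γ ⋉_θ M → Γ`. -/
abbrev inflation : FGRightMod Γ ⥤ FGRightMod (ThetaExt θ) :=
  restrictFG (fst θ).op (finite_fst_op θ)

variable {θ} in
/-- The quotient of a module over `Γ ⋉_θ M` by the action of `M`. -/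
abbrev coinvariants (Y : FGRightMod (ThetaExt θ)) : FGRightMod Γ :=
  FGModuleCat.of Γᵐᵒᵖ ((restriction θ).obj Y ⧸ LinearMap.range (act Y))

omit [Module.Finite Γᵐᵒᵖ M] in
lemma smul_eq (Y : FGRightMod (ThetaExt θ)) (r : (ThetaExt θ)ᵐᵒᵖ) (y : Y) :
    r • y = op (inl θ r.unop.1) • y + op (inr θ r.unop.2) • y := by
  rw [← add_smul, ← MulOpposite.op_add, inl_add_inr, op_unop]

variable {θ} in
/-- The projection onto the coinvariants. -/
def toCoinvariants (Y : FGRightMod (ThetaExt θ)) :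
    Y →ₗ[(ThetaExt θ)ᵐᵒᵖ] (inflation θ).obj (coinvariants Y) where
  toFun := (LinearMap.range (act Y)).mkQ
  map_add' := (LinearMap.range (act Y)).mkQ.map_add
  map_smul' r (y : Y) := by
    rw [smul_eq]
    refine ((LinearMap.range (act Y)).mkQ.map_add _ _).trans ?_
    have h₀ : (LinearMap.range (act Y)).mkQ (act Y (tmul (M := (restriction θ).obj Y) Γ y
        r.unop.2)) = 0 :=
      (Submodule.Quotient.mk_eq_zero _).2 (LinearMap.mem_range_self _ _)
    exact (congrArg₂ (· + ·) ((LinearMap.range (act Y)).mkQ.map_smul (op r.unop.1) y) h₀).trans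
      (add_zero _)

/-- `M` acts by zero on an inflated module, so a map to one kills `Y M` and factors through the
coinvariants `Y / Y M = Y ⊗_Λ Γ`. -/
lemma act_inflation (X : FGRightMod Γ) {Y : FGRightMod (ThetaExt θ)}
    (f : Y →ₗ[(ThetaExt θ)ᵐᵒᵖ] (inflation θ).obj X) (t : NCTensor Γ ((restriction θ).obj Y) M) :
    f (act Y t) = 0 :=
  DFunLike.congr_fun (hom_ext
    (f := f.toAddMonoidHom.comp (act Y).toAddMonoidHom) (g := 0)
    (fun (y : Y) m => (f.map_smul (op (inr θ m)) y).trans (zero_smul Γᵐᵒᵖ (A := X) (f y)))) t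

/-- The universal property of the coinvariants. -/
def coinvariantsHomEquiv (Y : FGRightMod (ThetaExt θ)) (X : FGRightMod Γ) :
    (coinvariants Y ⟶ X) ≃ (Y ⟶ (inflation θ).obj X) where
  toFun g := ObjectProperty.homMk (ModuleCat.ofHom (toCoinvariants Y)) ≫ (inflation θ).map g
  invFun f := ObjectProperty.homMk (X := coinvariants Y) (Y := X) (ModuleCat.ofHom
    ((LinearMap.range (act Y)).liftQ
      { toFun := f.hom.hom
        map_add' := f.hom.hom.map_add
        map_smul' := fun γ y => f.hom.hom.map_smul (op (inl θ γ.unop)) y } (by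
        rintro _ ⟨t, rfl⟩
        exact act_inflation θ X f.hom.hom t)))
  left_inv g := by
    refine FGModuleCat.hom_ext (Submodule.linearMap_qext _ ?_)
    rfl
  right_inv f := rfl

/-- The functor of coinvariants. -/
def coinvariantsFunctor : FGRightMod (ThetaExt θ) ⥤ FGRightMod Γ :=
  Adjunction.leftAdjointOfEquiv (coinvariantsHomEquiv θ) fun _ _ _ _ _ => rfl

/-- The functor of coinvariants is left adjoint to inflation. -/
def coinvariantsAdj : coinvariantsFunctor θ ⊣ inflation θ :=
  Adjunction.adjunctionOfEquivLeft (coinvariantsHomEquiv θ) fun _ _ _ _ _ => rfl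

/-- Restricting an inflated module gives back the module. -/
def inflationRestriction : inflation θ ⋙ restriction θ ≅ 𝟭 (FGRightMod Γ) := Iso.refl _

instance : (restriction θ).Faithful where
  map_injective h := FGModuleCat.hom_ext (LinearMap.ext fun y =>
    congr(($h).hom.hom y))

variable [IsNoetherianRing Γᵐᵒᵖ]

/-- The categories of modules over `Γ ⋉_θ M` and over `Γ`. -/
def extensionData : ExtensionData (FGRightMod (ThetaExt θ)) (FGRightMod Γ) where
  e := restriction θ
  l := freeFunctor θ
  q := coinvariantsFunctor θ
  i := inflation θ
  F := tensorBimod Γ M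
  adj := freeAdj θ
  adj' := coinvariantsAdj θ
  retraction := inflationRestriction θ
  faithful := inferInstance
  additive_e := inferInstance
  preservesFiniteLimits_e := inferInstance
  preservesFiniteColimits_e := inferInstance
  preservesFiniteLimits_i := inferInstance
  preservesFiniteColimits_i := inferInstance
  additive_F := inferInstance
  preservesFiniteColimits_F := inferInstance
  j := kernelInclusionHom θ
  j_naturality f := kernelInclusionHom_naturality θ f
  zero Y := kernelInclusionHom_counit θ Y
  exact Y := kernelInclusionHom_exact θ Y
  mono_j _ := inferInstance

/-- `P` is a summand of a power of `Λ`, and `Λ` restricts to `Γ ⊕ M` on the right, since multiplying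
by `(γ, 0)` involves no `θ`. -/
lemma finRetract_restriction (P : FGRightMod (ThetaExt θ)) [Projective P] :
    FinRetract Γᵐᵒᵖ (Γ × M) ((restriction θ).obj P) := by
  obtain ⟨n, φ, s, h⟩ := (FGRightMod.projective_iff P).1 inferInstance
  refine ⟨n, fun i =>
    { toFun := fun p => φ i p
      map_add' := (φ i).map_add
      map_smul' := fun γ p => ((φ i).map_smul (op (inl θ γ.unop)) p).trans (mul_inl θ _ _) },
    fun i =>
    { toFun := fun x => s i x
      map_add' := (s i).map_add
      map_smul' := fun γ x => (congrArg (s i) (mul_inl θ x γ.unop).symm).trans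
        ((s i).map_smul (op (inl θ γ.unop)) x) }, h⟩

end ThetaExt

lemma ThetaExt.inducesStableTriangleEquivalence_of_resolution {Γ : Type u} [Ring Γ]
    [IsNoetherianRing Γᵐᵒᵖ] {D : BimoduleResolution Γ} (θ : ThetaMap Γ D.M)
    (hTor : TorVanishing Γ D.M) (hnil : IsNilpotentBimodule Γ D.M) :
    InducesStableTriangleEquivalence (ThetaExt.restriction θ) := by
  have h := D.powVanishing_of_torVanishing hTor
  let E := extensionData θ
  have hU (P : FGRightMod (ThetaExt θ)) [Projective P] : FinRetract Γᵐᵒᵖ (Γ × D.M) (E.e.obj P) :=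
    finRetract_restriction θ P
  have hE : E.GorensteinConditions :=
    { nilpotent := isZero_iter_of_isNilpotentBimodule hnil
      exactOnGProj_e := h.exactOnGProj hU
      exactOnGProj_F := h.exactOnGProj_F
      finProjDim_e := h.finProjDim_iter hU
      finProjDim_F := fun P _ => h.finProjDim_F P
      finProjDim_l := h.finProjDim_map (fun P _ => inferInstanceAs (Projective (E.l.obj P)))
        (fun f hf hFf => @ExtensionData.mono_l_map _ _ _ _ _ _ E _ _ f hf hFf) }
  exact hE.inducesStableTriangleEquivalence

end

theorem mainTheorem10 {k : Type w} [Field k] {Γ : Type u} [Ring Γ] [Algebra k Γ] [Module.Finite k Γ]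
    {M : Type u} [AddCommGroup M] [Module k M] [Module Γ M] [Module Γᵐᵒᵖ M]
    [SMulCommClass Γ Γᵐᵒᵖ M] [IsScalarTower k Γ M] [IsScalarTower k Γᵐᵒᵖ M]
    [Module.Finite Γ M] [Module.Finite Γᵐᵒᵖ M]
    (θ : ThetaMap Γ M) (hTor : TorVanishing Γ M)
    (hpd : projectiveDimension (envelopingModule Γ M k) < ⊤) (hnil : IsNilpotentBimodule Γ M) :
    haveI := isNoetherianRing_op_of_finite k Γ
    InducesStableTriangleEquivalence (ThetaExt.restriction θ) := by
  have := isNoetherianRing_op_of_finite k Γ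
  -- `M` is replaced by a bundled variable so that its equality with `D.Ω 0` can be eliminated,
  -- carrying `θ` and the hypotheses along.
  suffices ∀ (B : BimoduleObj Γ) [Module.Finite Γᵐᵒᵖ B.carrier],
      (∃ D : BimoduleResolution Γ, D.Ω 0 = B) → ∀ θ : ThetaMap Γ B.carrier,
      TorVanishing Γ B.carrier → IsNilpotentBimodule Γ B.carrier →
      InducesStableTriangleEquivalence (ThetaExt.restriction θ) from
    this { carrier := M } (exists_bimoduleResolution M hpd) θ hTor hnil
  rintro _ _ ⟨D, rfl⟩ θ hTor hnil
  exact ThetaExt.inducesStableTriangleEquivalence_of_resolution θ hTor hnil
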